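/- Let $X\in\mathbb R^{p\times n}$ have independent entries $X_{jt}\sim N(\theta_{jt},1)$, and write $[m]=\{1,\dots,m\}$. Let $\Theta_0(p,n)$ be the set of $\theta\in\mathbb R^{p\times n}$ all of whose rows are constant. For $\rho>0$ and $s\in[p]$ let $\Theta_1(p,n,\rho,s)$ be the set of $\theta$ for which there are a time $t^*\in[n-1]$, a set $S\subseteq[p]$ with $|S|\ge s$, and reals $\mu_{j1},\mu_{j2}$ $(j\in[p])$ such that $\theta_{jt}=\mu_{j1}$ for $t\le t^*$ and $\theta_{jt}=\mu_{j2}$ for $t>t^*$, with $\sqrt{t^*(n-t^*)/n}\,|\mu_{j1}-\mu_{j2}|\ge\rho$ for $j\in S$ and $\mu_{j1}=\mu_{j2}$ for $j\notin S$. For a Borel test $\psi:\mathbb R^{p\times n}\to\{0,1\}$ put $$\mathcal R(\psi,p,n,\rho,s)=\sup_{\theta\in\Theta_0(p,n)}\mathbb E_\theta\psi(X)+\sup_{\theta\in\Theta_1(p,n,\rho,s)}\mathbb E_\theta\{1-\psi(X)\},\qquad \mathcal R(p,n,\rho,s)=\inf_\psi\mathcal R(\psi,p,n,\rho,s).$$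 For $a>0$ and $\beta\in(0,1)$ define $\rho^*(a,\beta)=\rho^*_p(a,\beta)\ge 0$ by $$\rho^*(a,\beta)^2=\begin{cases}p^{(a-(1-2\beta))/2}& a\le 1-2\beta,\\ (a-(1-2\beta))\log p & 1-2\beta<a\le 1-4\beta/3,\\ 2(\sqrt{1-a}-\sqrt{1-a-\beta})^2\log p & 1-4\beta/3<a\le 1-\beta,\\ p^{a-(1-\beta)} & a>1-\beta.\end{cases}$$ The two-sided penalized Berk–Jones test with constant $\gamma>0$ is defined as follows. Let $b=1+1/\log\log n$, let $M=\lfloor\log_b(n/2)\rfloor$, and let $\mathcal T=\{\lfloor b^k\rfloor:0\le k\le M\}\cup\{\lfloor n-b^k\rfloor:0\le k\le M\}$. For $t\in\mathcal T$ let $Y_{jt}=\sqrt{t(n-t)/n}\,\bigl(\frac1t\sum_{i\le t}X_{ji}-\frac1{n-t}\sum_{i>t}X_{ji}\bigr)$. With $\bar\Phi$ the standard normal upper tail, let $\bar S_t(q)=\frac1p\,\#\{j:|Y_{jt}|>\bar\Phi^{-1}(q/2)\}$, and let $K(x,y)=x\log\frac xy+(1-x)\log\frac{1-x}{1-y}$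 with $0\log 0=0$. The test $\psi_\gamma$ rejects, that is $\psi_\gamma(X)=1$, if and only if $$\max_{t\in\mathcal T}\sup_{q\in(0,1)}pK(\bar S_t(q),q)-2\log|\mathcal T|>2(2+\gamma)\log p .$$ **Theorem.** Let $a>0$ and $\beta_1,\beta\in(0,1)$, let $n=n_p$ and $s=s_p$ be sequences of natural numbers with $\log\log\log n\sim a\log p$ and $s\sim p^{1-\beta}$ as $p\to\infty$, and let $\rho^*=\rho^*(a,\beta_1)$. 1. (Lower bound) If $\beta>\beta_1$, then $\mathcal R(p,n,\rho^*,s)$ stays bounded away from $0$: there is $c>0$ with $\mathcal R(p,n,\rho^*,s)\ge c$ for all sufficiently large $p$. In particular $\mathcal R(p,n,\rho^*,s)\not\to0$ as $p\to\infty$. 2. (Upper bound) If $\beta<\beta_1$, then $\mathcal R(p,n,\rho^*,s)\to0$ as $p\to\infty$. Moreover, for every $\gamma>0$ the two-sided penalized Berk–Jones test $\psi_\gamma$ is a Borel test and is consistent: $\mathcal R(\psi_\gamma,p,n,\rho^*,s)\to0$ as $p\to\infty$. -/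

import Mathlib

open MeasureTheory ProbabilityTheory Filter Topology

noncomputable section

namespace Changepoint

/-- A `p × n` real matrix; rows are coordinates, columns are times.
The time `t ∈ {1, …, n}` of the mathematics is the index `t - 1` of `Fin n`. -/
abbrev Obs (p n : ℕ) : Type := Fin p → Fin n → ℝ

/-- The law of `X = θ + E`, where the entries of `E` are independent standard Gaussians. -/
def law {p n : ℕ} (θ : Obs p n) : Measure (Obs p n) :=
  Measure.pi fun j => Measure.pi fun i => gaussianReal (θ j i) 1

/-- The null parameter space: every row is constant. -/
def nullSpace (p n : ℕ) : Set (Obs p n) :=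
  {θ | ∃ μ : Fin p → ℝ, ∀ j i, θ j i = μ j}

/-- The two-sided alternative: at a common time `t ∈ {1, …, n - 1}`, all rows in a set `S` of at
least `s` rows undergo a change in mean, up or down, of normalized size at least `ρ`; the other rows
are constant. -/
def altSpace (p n : ℕ) (ρ : ℝ) (s : ℕ) : Set (Obs p n) :=
  {θ | ∃ (S : Finset (Fin p)) (μ₁ μ₂ : Fin p → ℝ) (t : ℕ),
    1 ≤ t ∧ t < n ∧ s ≤ S.card ∧
    (∀ j i, θ j i = if (i : ℕ) < t then μ₁ j else μ₂ j) ∧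
    (∀ j ∈ S, ρ ≤ √((t : ℝ) * ((n : ℝ) - t) / n) * |μ₁ j - μ₂ j|) ∧
    (∀ j, j ∉ S → μ₁ j = μ₂ j)}

/-- A (non-randomized) test: a Borel function with values in `{0, 1}`. -/
structure IsTest {p n : ℕ} (ψ : Obs p n → ℝ) : Prop where
  measurable : Measurable ψ
  zero_or_one : ∀ x, ψ x = 0 ∨ ψ x = 1

/-- Worst-case Type I error plus worst-case Type II error of `ψ`. -/
def worstCaseError {p n : ℕ} (ψ : Obs p n → ℝ) (ρ : ℝ) (s : ℕ) : ℝ :=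
  (⨆ θ : nullSpace p n, ∫ x, ψ x ∂(law θ.1)) +
    ⨆ θ : altSpace p n ρ s, ∫ x, (1 - ψ x) ∂(law θ.1)

/-- The two-sided minimax testing error. -/
def minimaxError (p n : ℕ) (ρ : ℝ) (s : ℕ) : ℝ :=
  ⨅ ψ : {ψ : Obs p n → ℝ // IsTest ψ}, worstCaseError ψ.1 ρ s

/-- The square of the two-sided detection boundary. -/
def boundarySq (a β : ℝ) (p : ℕ) : ℝ :=
  if a ≤ 1 - 2 * β then (p : ℝ) ^ ((a - (1 - 2 * β)) / 2)
  else if a ≤ 1 - 4 * β / 3 then (a - (1 - 2 * β)) * Real.log p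
  else if a ≤ 1 - β then 2 * (√(1 - a) - √(1 - a - β)) ^ 2 * Real.log p
  else (p : ℝ) ^ (a - (1 - β))

/-- The two-sided detection boundary `ρ*(a, β)`, at dimension `p`. -/
def boundary (a β : ℝ) (p : ℕ) : ℝ := √(boundarySq a β p)

/-- The asymptotic calibration `log log log n ∼ a log p`, `s ∼ p ^ (1 - β)` as `p → ∞`. -/
def Calibrated (a β : ℝ) (n s : ℕ → ℕ) : Prop :=
  Tendsto (fun p : ℕ => Real.log (Real.log (Real.log (n p))) / (a * Real.log p)) atTop (𝓝 1) ∧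
  Tendsto (fun p : ℕ => (s p : ℝ) / (p : ℝ) ^ (1 - β)) atTop (𝓝 1)

/-! The two-sided penalized Berk–Jones test. -/

/-- The normalized contrast of row `j` at the candidate changepoint `t`. -/
def contrast {p n : ℕ} (x : Obs p n) (t : ℕ) (j : Fin p) : ℝ :=
  √((t : ℝ) * ((n : ℝ) - t) / n) *
    ((∑ i : Fin n with i.val < t, x j i) / t - (∑ i : Fin n with t ≤ i.val, x j i) / ((n : ℝ) - t))

/-- The upper tail of the standard Gaussian distribution. -/
def gaussianTail (z : ℝ) : ℝ := (gaussianReal 0 1).real (Set.Ioi z)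

/-- The inverse function on `(0, 1)` of the (continuous, strictly decreasing) tail. -/
def gaussianTailInv (u : ℝ) : ℝ := sInf {z | gaussianTail z ≤ u}

/-- The fraction of rows whose contrast at `t` exceeds, in absolute value, the two-sided
Gaussian critical value of level `q`. -/
def exceedFraction {p n : ℕ} (x : Obs p n) (t : ℕ) (q : ℝ) : ℝ :=
  (Set.ncard {j : Fin p | gaussianTailInv (q / 2) < |contrast x t j|} : ℝ) / p

/-- The Kullback–Leibler divergence between Bernoulli laws of parameters `x` and `t`. -/
def bernoulliKL (x t : ℝ) : ℝ :=
  x * Real.log (x / t) + (1 - x) * Real.log ((1 - x) / (1 - t))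

/-- The symmetric geometric grid of candidate changepoints, with ratio `1 + 1 / log log n`. -/
def grid (n : ℕ) : Finset ℕ :=
  let b : ℝ := 1 + 1 / Real.log (Real.log n)
  let K : ℕ := ⌊Real.logb b ((n : ℝ) / 2)⌋₊
  (Finset.range (K + 1)).image (fun k => ⌊b ^ k⌋₊) ∪
    (Finset.range (K + 1)).image (fun k => ⌊(n : ℝ) - b ^ k⌋₊)

/-- The penalized Berk–Jones statistic. It takes values in the extended reals because the supremum
over `q` is infinite on the null event that some contrast vanishes. -/
def pbjStat {p n : ℕ} (x : Obs p n) : EReal :=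
  (⨆ t ∈ grid n, ⨆ q ∈ Set.Ioo (0 : ℝ) 1,
      (((p : ℝ) * bernoulliKL (exceedFraction x t q) q : ℝ) : EReal)) -
    ((2 * Real.log ((grid n).card : ℝ) : ℝ) : EReal)

open Classical in
/-- The penalized Berk–Jones test with tuning constant `γ`; it uses no knowledge of `ρ`, `a`, `β`,
`s`. -/
def pbjTest (γ : ℝ) (p n : ℕ) (x : Obs p n) : ℝ :=
  if ((2 * (2 + γ) * Real.log p : ℝ) : EReal) < pbjStat x then 1 else 0

end Changepoint

end

open Changepoint

/-!
The contrast of a row at time `t` is its inner product with a unit vector, `stepVec n t`, that is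
orthogonal to constants. So under `law θ` the contrasts at one time are independent Gaussians of
unit variance, centred under the null; under a change at `τ` of normalized size `ρ` their means are
`± ρ` times the correlation `stepCorr n t τ`. The calibration says that `log log n = p ^ (a + o(1))`
(`Calibrated.loglog_bounds`), and this is the price, on the scale of log-likelihoods, of not knowing
the changepoint: the logarithm of the number of nearly uncorrelated times.

*Upper bound.* For a fixed value `k` of the count of significant rows, the events
`p K(k / p, q) > c` at varying levels `q` are nested, so Chernoff's inequality bounds the whole
Berk–Jones process at one time by `2 (p + 1) e ^ (-c)` (`measure_exists_lt_bjProcess_le`). The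
penalty pays for the union over the grid, whence a Type I error of at most `4 / p`
(`integral_pbjTest_null_le`). Every changepoint has correlation `1 - o(1)` with some grid point, and
the grid has `log`-cardinality `O(log log n)`, so the rejection threshold is `p ^ (a + o(1))`. With
signals of size about `ρ` at the critical value `z`, the count exceeds its null mean
`p q = 2 p Φ̄(z)` by about `X = s (P(|N(ρ, 1)| > z) - q)`, and the divergence is at least of order
`min X (X ^ 2 / (p q))` by the Hellinger bound. Comparison of exponents gives power in three
regimes: `z = 1` for weak signals, and, on the scale `√(2 log p)` with `ρ = u √(2 log p)`, the critical values
`2 u` and `√(1 - a)`. For signals of polynomial size the Hellinger bound is too weak, and the bound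
`K(x, q) ≥ x log (x / q) - x + q` at `z = ρ / 2` gives a divergence of order `s ρ ^ 2`
(`powerful_boundary`).

*Lower bound.* The prior draws the changepoint uniformly from `K ^ i`, `i < N`, where `K` is a power
of `p` large enough for mixtures at different times to be nearly uncorrelated and
`N ≥ (log n) ^ (1 / 2)`, and gives each row a signal `± ρ` with probability `4 s / p`. The mixture
likelihood ratio `mixLR` at each time is truncated at `√N`; the average of the truncated ratios has
bounded second moment, and it keeps half of the mass as soon as the moment of order `1 + κ` of
`mixLR` is at most `√N ^ κ / 2` for some `κ ∈ (0, 1]`. Then every test has error at least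
`1 / 16 - e ^ (-s)` (`sub_exp_le_minimaxError`). The moment is `exp (p ^ (x + o(1)))` with an explicit
exponent `x`, to be compared with `κ log N ≍ κ p ^ (a + o(1))`. The choice `κ = 1` serves for the
first two regimes; for weak signals the random signs matter, as they leave only
`ε ^ 2 (cosh (ρ ^ 2) - 1)` per row, where `ε = 4 s / p`. The sparse regime takes `κ` just above
`B / (A - B)`, with `A = √(1 - a)` and `B = √(1 - a - β₁)`, and signals of polynomial size take
`κ = ρ ^ (-2)`, which tends to `0` (`minimaxError_boundary`).
-/

noncomputable section

namespace Changepoint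

/-! ### The contrast as a linear functional -/

/-- The unit vector of `ℝⁿ` whose inner product with a row is the contrast of that row at `t`. -/
def stepVec (n t : ℕ) (i : Fin n) : ℝ :=
  √((t : ℝ) * ((n : ℝ) - t) / n) * (if (i : ℕ) < t then 1 / (t : ℝ) else -(1 / ((n : ℝ) - t)))

lemma contrast_eq_sum {p n : ℕ} (x : Obs p n) (t : ℕ) (j : Fin p) :
    contrast x t j = ∑ i, stepVec n t i * x j i := by
  have h : ∀ i : Fin n, stepVec n t i * x j i = √((t : ℝ) * ((n : ℝ) - t) / n) *
      ((if (i : ℕ) < t then x j i else 0) / t - (if t ≤ (i : ℕ) then x j i else 0) / ((n : ℝ) - t)) := by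
    intro i
    unfold stepVec
    by_cases hi : (i : ℕ) < t
    · simp only [hi, if_true, if_neg (not_le.2 hi)]; ring
    · simp only [hi, if_false, if_pos (not_lt.1 hi)]; ring
  rw [Finset.sum_congr rfl fun i _ => h i, ← Finset.mul_sum, Finset.sum_sub_distrib,
    ← Finset.sum_div, ← Finset.sum_div, ← Finset.sum_filter, ← Finset.sum_filter]
  rfl

lemma sum_ite_lt {n t : ℕ} (ht : t ≤ n) (a b : ℝ) :
    ∑ i : Fin n, (if (i : ℕ) < t then a else b) = t * a + ((n : ℝ) - t) * b := by
  rw [Fin.sum_univ_eq_sum_range (fun i => if i < t then a else b) n,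
    ← Finset.sum_range_add_sum_Ico _ ht]
  have h1 : ∑ i ∈ Finset.range t, (if i < t then a else b) = ∑ i ∈ Finset.range t, a :=
    Finset.sum_congr rfl fun i hi => if_pos (Finset.mem_range.1 hi)
  have h2 : ∑ i ∈ Finset.Ico t n, (if i < t then a else b) = ∑ i ∈ Finset.Ico t n, b :=
    Finset.sum_congr rfl fun i hi => if_neg (not_lt.2 (Finset.mem_Ico.1 hi).1)
  rw [h1, h2]
  simp [Nat.cast_sub ht]

lemma sum_stepVec {n t : ℕ} (h1 : 1 ≤ t) (h2 : t < n) : ∑ i, stepVec n t i = 0 := by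
  unfold stepVec
  have : (0 : ℝ) < t := by exact_mod_cast h1
  have h3 : (0 : ℝ) < (n : ℝ) - t := by rw [sub_pos]; exact_mod_cast h2
  rw [← Finset.mul_sum, sum_ite_lt h2.le]
  field_simp
  ring

/-- The correlation of the contrasts at two times. -/
def stepCorr (n t t' : ℕ) : ℝ := ∑ i, stepVec n t i * stepVec n t' i

lemma stepCorr_comm (n t t' : ℕ) : stepCorr n t t' = stepCorr n t' t := by
  unfold stepCorr; simp_rw [mul_comm]

lemma stepCorr_eq {n t t' : ℕ} (h1 : 1 ≤ t) (h : t ≤ t') (h2 : t' < n) :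
    stepCorr n t t' = √((t : ℝ) * ((n : ℝ) - t') / (t' * ((n : ℝ) - t))) := by
  have ht : (0 : ℝ) < t := by exact_mod_cast h1
  have htt : (t : ℝ) ≤ t' := by exact_mod_cast h
  have ht' : (0 : ℝ) < t' := by linarith
  have hn' : (0 : ℝ) < (n : ℝ) - t' := by rw [sub_pos]; exact_mod_cast h2
  have hn : (0 : ℝ) < (n : ℝ) - t := by linarith
  have hn0 : (0 : ℝ) < n := by linarith
  set w := √((t : ℝ) * ((n : ℝ) - t) / n) with hw
  set w' := √((t' : ℝ) * ((n : ℝ) - t') / n) with hw'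
  have e : ∀ i : Fin n, stepVec n t i * stepVec n t' i =
      w * w' * ((1 / t') * (if (i : ℕ) < t then 1 / (t : ℝ) else -(1 / ((n : ℝ) - t)))
      + ((if (i : ℕ) < t' then 1 / ((n : ℝ) - t) * (1 / ((n : ℝ) - t') + 1 / t') else
         1 / ((n : ℝ) - t) * (1 / ((n : ℝ) - t') + 1 / t')) - 
        (if (i : ℕ) < t' then 1 / ((n : ℝ) - t) * (1 / ((n : ℝ) - t') + 1 / t') else 0))) := by
    intro i
    unfold stepVec
    rw [← hw, ← hw']
    by_cases hi : (i : ℕ) < t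
    · have hi' : (i : ℕ) < t' := by omega
      simp only [hi, hi', if_true]; ring
    · by_cases hi' : (i : ℕ) < t'
      · simp only [hi, hi', if_true, if_false]; ring
      · simp only [hi, hi', if_false]; ring
  have hsum : stepCorr n t t' = w * w' * (n / (((n : ℝ) - t) * t')) := by
    unfold stepCorr
    rw [Finset.sum_congr rfl fun i _ => e i, ← Finset.mul_sum, Finset.sum_add_distrib,
      ← Finset.mul_sum, Finset.sum_sub_distrib, sum_ite_lt (by omega), sum_ite_lt (by omega),
      sum_ite_lt (by omega)]
    congr 1
    field_simp
    ring
  rw [hsum, eq_comm, Real.sqrt_eq_iff_mul_self_eq (by positivity) (by positivity), eq_comm]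
  have hw2 : w * w = (t : ℝ) * ((n : ℝ) - t) / n := Real.mul_self_sqrt (by positivity)
  have hw2' : w' * w' = (t' : ℝ) * ((n : ℝ) - t') / n := Real.mul_self_sqrt (by positivity)
  calc w * w' * (n / (((n : ℝ) - t) * t')) * (w * w' * (n / (((n : ℝ) - t) * t')))
      = (w * w) * (w' * w') * (n / (((n : ℝ) - t) * t')) ^ 2 := by ring
    _ = _ := by rw [hw2, hw2']; field_simp

lemma stepCorr_self {n t : ℕ} (h1 : 1 ≤ t) (h2 : t < n) : stepCorr n t t = 1 := by
  have ht : (0 : ℝ) < t := by exact_mod_cast h1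
  have hn : (0 : ℝ) < (n : ℝ) - t := by rw [sub_pos]; exact_mod_cast h2
  rw [stepCorr_eq h1 le_rfl h2, div_self (by positivity), Real.sqrt_one]

lemma stepCorr_nonneg {n t t' : ℕ} (h1 : 1 ≤ t) (h2 : t < n) (h1' : 1 ≤ t') (h2' : t' < n) :
    0 ≤ stepCorr n t t' := by
  rcases le_total t t' with h | h
  · rw [stepCorr_eq h1 h h2']; positivity
  · rw [stepCorr_comm, stepCorr_eq h1' h h2]; positivity

/-- A mean vector with a single change is a constant plus a multiple of the contrast direction. -/
lemma step_eq_const_add {n t : ℕ} (h1 : 1 ≤ t) (h2 : t < n) (a b : ℝ) (i : Fin n) :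
    (if (i : ℕ) < t then a else b) = ((t : ℝ) * a + ((n : ℝ) - t) * b) / n +
      √((t : ℝ) * ((n : ℝ) - t) / n) * (a - b) * stepVec n t i := by
  have ht : (0 : ℝ) < t := by exact_mod_cast h1
  have hn : (0 : ℝ) < (n : ℝ) - t := by rw [sub_pos]; exact_mod_cast h2
  have hn0 : (0 : ℝ) < n := by linarith
  have hw2 : √((t : ℝ) * ((n : ℝ) - t) / n) * √((t : ℝ) * ((n : ℝ) - t) / n) =
    (t : ℝ) * ((n : ℝ) - t) / n := Real.mul_self_sqrt (by positivity)
  unfold stepVec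
  set w := √((t : ℝ) * ((n : ℝ) - t) / n)
  have : ∀ c : ℝ, w * (a - b) * (w * c) = (w * w) * (a - b) * c := fun c => by ring
  rw [this, hw2]
  split_ifs
  · field_simp; ring
  · field_simp; ring

/-- Mean of the contrast at `t` of a row whose mean changes at `t'`. -/
lemma sum_stepVec_mul_step {n t t' : ℕ} (h1 : 1 ≤ t) (h2 : t < n) (h1' : 1 ≤ t') (h2' : t' < n)
    (a b : ℝ) : ∑ i, stepVec n t i * (if (i : ℕ) < t' then a else b) =
      √((t' : ℝ) * ((n : ℝ) - t') / n) * (a - b) * stepCorr n t t' := by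
  simp_rw [step_eq_const_add h1' h2' a b, mul_add]
  rw [Finset.sum_add_distrib, ← Finset.sum_mul, sum_stepVec h1 h2, zero_mul, zero_add, stepCorr,
    Finset.mul_sum]
  exact Finset.sum_congr rfl fun i _ => by ring

/-! ### Gaussian product measures -/

/-- The law of a row: independent unit-variance Gaussians with means `m`. -/
abbrev rowLaw {n : ℕ} (m : Fin n → ℝ) : Measure (Fin n → ℝ) :=
  Measure.pi fun i => gaussianReal (m i) 1

instance {p n : ℕ} (θ : Obs p n) : IsProbabilityMeasure (law θ) := by
  unfold law; infer_instance

lemma map_linear_rowLaw {n : ℕ} (m v : Fin n → ℝ) (hv : ∑ i, v i * v i = 1) :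
    (rowLaw m).map (fun y => ∑ i, v i * y i) = gaussianReal (∑ i, v i * m i) 1 := by
  have hmeas : Measurable fun y : Fin n → ℝ => ∑ i, v i * y i := by fun_prop
  have : IsProbabilityMeasure ((rowLaw m).map (fun y => ∑ i, v i * y i)) :=
    Measure.isProbabilityMeasure_map hmeas.aemeasurable
  refine Measure.ext_of_charFun ?_
  ext s
  rw [charFun_gaussianReal, charFun_apply_real, integral_map hmeas.aemeasurable (by fun_prop)]
  have h : ∀ y : Fin n → ℝ, Complex.exp (s * ((∑ i, v i * y i : ℝ) : ℂ) * Complex.I) =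
      ∏ i, Complex.exp (((s * v i : ℝ) : ℂ) * (y i) * Complex.I) := by
    intro y
    rw [← Complex.exp_sum]
    congr 1
    push_cast
    rw [Finset.mul_sum, Finset.sum_mul]
    exact Finset.sum_congr rfl fun i _ => by ring
  simp_rw [h]
  rw [integral_fintype_prod_eq_prod (𝕜 := ℂ)
    (fun i (y : ℝ) => Complex.exp (((s * v i : ℝ) : ℂ) * y * Complex.I))]
  have h2 : ∀ i, ∫ y, Complex.exp (((s * v i : ℝ) : ℂ) * y * Complex.I) ∂(gaussianReal (m i) 1) =
      Complex.exp ((s * v i : ℝ) * (m i) * Complex.I - (1 : NNReal) * ((s * v i : ℝ) : ℂ) ^ 2 / 2) := by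
    intro i
    rw [← charFun_apply_real, charFun_gaussianReal]
  rw [Finset.prod_congr rfl fun i _ => h2 i, ← Complex.exp_sum]
  congr 1
  have h3 : (∑ i, (v i : ℂ) * v i) = 1 := by exact_mod_cast congrArg Complex.ofReal hv
  rw [Finset.sum_sub_distrib]
  congr 1
  · push_cast
    rw [Finset.mul_sum, Finset.sum_mul]
    exact Finset.sum_congr rfl fun i _ => by ring
  · push_cast
    rw [← Finset.sum_div]
    congr 1
    calc ∑ i, (1 : ℂ) * ((s : ℂ) * v i) ^ 2 = (s : ℂ) ^ 2 * ∑ i, (v i : ℂ) * v i := by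
          rw [Finset.mul_sum]; exact Finset.sum_congr rfl fun i _ => by ring
      _ = _ := by rw [h3]; ring

lemma measurable_contrast {p n : ℕ} (t : ℕ) (j : Fin p) :
    Measurable fun x : Obs p n => contrast x t j := by
  simp_rw [contrast_eq_sum]; fun_prop

/-- The contrasts at a fixed time are independent unit-variance Gaussians. -/
lemma map_contrast_law {p n t : ℕ} (h1 : 1 ≤ t) (h2 : t < n) (θ : Obs p n) :
    (law θ).map (fun x j => contrast x t j) =
      Measure.pi fun j => gaussianReal (contrast θ t j) 1 := by
  simp_rw [contrast_eq_sum]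
  have : ∀ j, (rowLaw (θ j)).map (fun y => ∑ i, stepVec n t i * y i) =
    gaussianReal (∑ i, stepVec n t i * θ j i) 1 := fun j =>
      map_linear_rowLaw _ _ (stepCorr_self h1 h2)
  simp_rw [← this]
  have hmeas : Measurable fun y : Fin n → ℝ => ∑ i, stepVec n t i * y i := by fun_prop
  have hprob : ∀ j, IsProbabilityMeasure
      ((rowLaw (θ j)).map fun y => ∑ i, stepVec n t i * y i) := fun j =>
    Measure.isProbabilityMeasure_map hmeas.aemeasurable
  exact Measure.pi_map_pi (μ := fun j => rowLaw (θ j))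
    (f := fun _ y => ∑ i, stepVec n t i * y i) (fun _ => hmeas.aemeasurable)

/-- Exponential moments of linear functionals of a standard Gaussian vector. -/
lemma integral_exp_linear {n : ℕ} (v : Fin n → ℝ) :
    ∫ y, Real.exp (∑ i, v i * y i) ∂(rowLaw (0 : Fin n → ℝ)) =
      Real.exp ((∑ i, v i * v i) / 2) := by
  simp_rw [Real.exp_sum]
  rw [integral_fintype_prod_eq_prod (𝕜 := ℝ) (fun i (y : ℝ) => Real.exp (v i * y))]
  have : ∀ i, ∫ y, Real.exp (v i * y) ∂(gaussianReal ((0 : Fin n → ℝ) i) 1) =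
      Real.exp (v i * v i / 2) := by
    intro i
    have := congrFun (mgf_fun_id_gaussianReal (μ := 0) (v := 1)) (v i)
    rw [mgf] at this
    simp only [Pi.zero_apply]
    rw [this]; simp [pow_two]
  rw [Finset.prod_congr rfl fun i _ => this i, ← Real.exp_sum, Finset.sum_div]

lemma integrable_exp_linear {n : ℕ} (v : Fin n → ℝ) :
    Integrable (fun y => Real.exp (∑ i, v i * y i)) (rowLaw (0 : Fin n → ℝ)) := by
  simp_rw [Real.exp_sum]
  exact Integrable.fintype_prod (𝕜 := ℝ) (f := fun i (y : ℝ) => Real.exp (v i * y))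
    fun i => integrable_exp_mul_gaussianReal _

/-- A product of densities is a density of the product. -/
lemma pi_withDensity {ι : Type*} [Fintype ι] {E : ι → Type*} [∀ i, MeasurableSpace (E i)]
    (μ : ∀ i, Measure (E i)) [∀ i, IsProbabilityMeasure (μ i)] (f : ∀ i, E i → ℝ)
    (hf0 : ∀ i x, 0 ≤ f i x) (hfi : ∀ i, Integrable (f i) (μ i)) :
    Measure.pi (fun i => (μ i).withDensity fun x => ENNReal.ofReal (f i x)) =
      (Measure.pi μ).withDensity fun x => ENNReal.ofReal (∏ i, f i (x i)) := by
  have : ∀ i, IsFiniteMeasure ((μ i).withDensity fun x => ENNReal.ofReal (f i x)) := fun i =>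
    isFiniteMeasure_withDensity_ofReal (hfi i).2
  refine Measure.pi_eq fun s hs => ?_
  have hint : ∀ i, Integrable (f i) ((μ i).restrict (s i)) := fun i => (hfi i).restrict
  rw [withDensity_apply _ (MeasurableSet.univ_pi hs), Measure.restrict_pi_pi,
    ← ofReal_integral_eq_lintegral_ofReal (Integrable.fintype_prod_dep hint)
      (ae_of_all _ fun x => Finset.prod_nonneg fun i _ => hf0 i _),
    integral_fintype_prod_eq_prod, ENNReal.ofReal_prod_of_nonneg
      (fun i _ => integral_nonneg fun x => hf0 i x)]
  refine Finset.prod_congr rfl fun i _ => ?_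
  rw [withDensity_apply _ (hs i), ofReal_integral_eq_lintegral_ofReal (hint i)
    (ae_of_all _ fun x => hf0 i x)]

lemma gaussianReal_eq_withDensity (m : ℝ) : gaussianReal m 1 =
    (gaussianReal 0 1).withDensity fun x => ENNReal.ofReal (Real.exp (m * x - m * m / 2)) := by
  rw [gaussianReal_of_var_ne_zero _ one_ne_zero, gaussianReal_of_var_ne_zero _ one_ne_zero,
    ← withDensity_mul _ (measurable_gaussianPDF 0 1) (by fun_prop)]
  congr 1
  ext x
  simp only [Pi.mul_apply, gaussianPDF]
  rw [← ENNReal.ofReal_mul (gaussianPDFReal_nonneg _ _ _)]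
  congr 1
  simp only [gaussianPDFReal]
  rw [mul_assoc _ (Real.exp _) (Real.exp _), ← Real.exp_add]
  congr 2
  simp; ring

lemma rowLaw_eq_withDensity {n : ℕ} (m : Fin n → ℝ) : rowLaw m = (rowLaw 0).withDensity fun y =>
    ENNReal.ofReal (Real.exp (∑ i, m i * y i - (∑ i, m i * m i) / 2)) := by
  have h := pi_withDensity (fun i : Fin n => gaussianReal 0 1)
    (fun i y => Real.exp (m i * y - m i * m i / 2)) (fun i y => (Real.exp_pos _).le)
    (fun i => by
      simp_rw [Real.exp_sub]
      exact (integrable_exp_mul_gaussianReal _).div_const _)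
  simp_rw [← gaussianReal_eq_withDensity] at h
  simp only [rowLaw, Pi.zero_apply]
  rw [h]
  simp_rw [← Real.exp_sum, Finset.sum_sub_distrib, Finset.sum_div]

/-- Change of measure from pure noise to the mean `θ`. -/
lemma integral_law_eq {p n : ℕ} (θ : Obs p n) (g : Obs p n → ℝ) :
    ∫ x, g x ∂(law θ) = ∫ x, (∏ j, Real.exp (∑ i, θ j i * x j i - (∑ i, θ j i * θ j i) / 2)) * g x
      ∂(law (0 : Obs p n)) := by
  have h := pi_withDensity (fun j : Fin p => rowLaw (0 : Fin n → ℝ))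
    (fun j y => Real.exp (∑ i, θ j i * y i - (∑ i, θ j i * θ j i) / 2))
    (fun i y => (Real.exp_pos _).le)
    (fun j => by
      simp_rw [Real.exp_sub]
      exact (integrable_exp_linear _).div_const _)
  simp_rw [← rowLaw_eq_withDensity] at h
  change ∫ x, g x ∂(Measure.pi fun j => rowLaw (θ j)) = 
    ∫ x, _ ∂(Measure.pi fun j : Fin p => rowLaw (0 : Fin n → ℝ))
  rw [h, integral_withDensity_eq_integral_toReal_smul (by fun_prop) (by simp)]
  refine integral_congr_ae (ae_of_all _ fun x => ?_)
  simp only [smul_eq_mul]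
  rw [ENNReal.toReal_ofReal (Finset.prod_nonneg fun j _ => (Real.exp_pos _).le)]

/-! ### The standard Gaussian tail -/

lemma gaussianPDFReal_std (x : ℝ) :
    gaussianPDFReal 0 1 x = (√(2 * Real.pi))⁻¹ * Real.exp (-x ^ 2 / 2) := by
  simp [gaussianPDFReal]

lemma continuous_gaussianPDFReal_std : Continuous (gaussianPDFReal 0 1) := by
  rw [funext gaussianPDFReal_std]; fun_prop

lemma gaussianTail_eq_integral (z : ℝ) :
    gaussianTail z = ∫ x in Set.Ioi z, gaussianPDFReal 0 1 x := by
  rw [gaussianTail, Measure.real, gaussianReal_apply_eq_integral _ one_ne_zero,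
    ENNReal.toReal_ofReal (integral_nonneg fun x => gaussianPDFReal_nonneg _ _ _)]

lemma hasDerivAt_gaussianTail (z : ℝ) : HasDerivAt gaussianTail (-gaussianPDFReal 0 1 z) z := by
  have h : gaussianTail = fun w => gaussianTail 0 - ∫ x in (0 : ℝ)..w, gaussianPDFReal 0 1 x := by
    ext w
    rw [gaussianTail_eq_integral w, gaussianTail_eq_integral 0]
    rw [← intervalIntegral.integral_Ioi_sub_Ioi' (integrable_gaussianPDFReal 0 1).integrableOn
      (integrable_gaussianPDFReal 0 1).integrableOn]
    ring
  rw [h]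
  exact (intervalIntegral.integral_hasDerivAt_right
    (integrable_gaussianPDFReal 0 1).intervalIntegrable
    (stronglyMeasurable_gaussianPDFReal 0 1).stronglyMeasurableAtFilter
    continuous_gaussianPDFReal_std.continuousAt).const_sub _

lemma continuous_gaussianTail : Continuous gaussianTail :=
  continuous_iff_continuousAt.2 fun z => (hasDerivAt_gaussianTail z).continuousAt

lemma strictAnti_gaussianTail : StrictAnti gaussianTail :=
  strictAnti_of_hasDerivAt_neg hasDerivAt_gaussianTail
    fun _ => neg_lt_zero.2 (gaussianPDFReal_pos _ _ _ one_ne_zero)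

lemma gaussianReal_real_Iio (m z : ℝ) :
    (gaussianReal m 1).real (Set.Iio z) = gaussianTail (m - z) := by
  have h := gaussianReal_map_const_sub (μ := m) (v := 1) m
  rw [sub_self] at h
  rw [gaussianTail, ← h, map_measureReal_apply (by fun_prop) measurableSet_Ioi]
  congr 1; ext y; simp

lemma gaussianReal_real_Ioi (m z : ℝ) :
    (gaussianReal m 1).real (Set.Ioi z) = gaussianTail (z - m) := by
  have h := gaussianReal_map_sub_const (μ := m) (v := 1) m
  rw [sub_self] at h
  rw [gaussianTail, ← h, map_measureReal_apply (by fun_prop) measurableSet_Ioi]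
  congr 1; ext y; simp

lemma gaussianTail_nonneg (z : ℝ) : 0 ≤ gaussianTail z := measureReal_nonneg

lemma gaussianTail_pos (z : ℝ) : 0 < gaussianTail z :=
  (gaussianTail_nonneg (z + 1)).trans_lt (strictAnti_gaussianTail (by linarith))

lemma gaussianTail_neg (z : ℝ) : gaussianTail (-z) = 1 - gaussianTail z := by
  have : NullSingletonClass (gaussianReal 0 1) := nullSingletonClass_gaussianReal one_ne_zero
  have h1 := gaussianReal_real_Iio 0 z
  rw [zero_sub] at h1
  rw [← h1, gaussianTail, ← probReal_compl_eq_one_sub measurableSet_Ioi, Set.compl_Ioi]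
  exact measureReal_congr Iio_ae_eq_Iic

lemma gaussianTail_zero : gaussianTail 0 = 1 / 2 := by
  have := gaussianTail_neg 0
  rw [neg_zero] at this; linarith

/-- The Chernoff bound. -/
lemma gaussianTail_le_exp {z : ℝ} (hz : 0 ≤ z) : gaussianTail z ≤ Real.exp (-z ^ 2 / 2) := by
  have h := measure_ge_le_exp_mul_mgf (μ := gaussianReal 0 1) (X := fun x => x) (t := z) z hz
    (integrable_exp_mul_gaussianReal z)
  rw [mgf_fun_id_gaussianReal] at h
  refine (measureReal_mono (Set.Ioi_subset_Ici_self (a := z))).trans (h.trans ?_)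
  rw [← Real.exp_add]
  apply Real.exp_le_exp.2
  simp; nlinarith

/-- A lower tail bound that is sharp on the exponential scale. -/
lemma le_gaussianTail {w : ℝ} (hw : 0 ≤ w) : gaussianPDFReal 0 1 (w + 1) ≤ gaussianTail w := by
  obtain ⟨c, hc, h⟩ := exists_hasDerivAt_eq_slope gaussianTail (fun z => -gaussianPDFReal 0 1 z)
    (show w < w + 1 by linarith) continuous_gaussianTail.continuousOn
    fun z _ => hasDerivAt_gaussianTail z
  have h1 : gaussianPDFReal 0 1 (w + 1) ≤ gaussianPDFReal 0 1 c := by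
    rw [gaussianPDFReal_std, gaussianPDFReal_std]
    have : c ^ 2 ≤ (w + 1) ^ 2 := by nlinarith [hc.1, hc.2]
    gcongr
  have := gaussianTail_nonneg (w + 1)
  simp at h
  linarith

lemma exists_gaussianTail_eq {u : ℝ} (h0 : 0 < u) (h1 : u < 1) : ∃ z, gaussianTail z = u := by
  have key : ∀ v : ℝ, 0 < v → ∃ z, gaussianTail z ≤ v := by
    intro v hv
    have ht : Tendsto (fun z : ℝ => Real.exp (-z ^ 2 / 2)) atTop (𝓝 0) := by
      refine Real.tendsto_exp_atBot.comp ?_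
      have : Tendsto (fun z : ℝ => z ^ 2 / 2) atTop atTop :=
        (tendsto_pow_atTop two_ne_zero).atTop_div_const (by norm_num)
      exact (tendsto_neg_atTop_atBot.comp this).congr fun z => by simp [neg_div]
    obtain ⟨z, hz, hz0⟩ := ((ht.eventually (gt_mem_nhds hv)).and (eventually_ge_atTop 0)).exists
    exact ⟨z, (gaussianTail_le_exp hz0).trans hz.le⟩
  obtain ⟨a, ha⟩ := key u h0
  obtain ⟨b, hb⟩ := key (1 - u) (by linarith)
  have hb' : u ≤ gaussianTail (-b) := by rw [gaussianTail_neg]; linarith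
  exact mem_range_of_exists_le_of_exists_ge continuous_gaussianTail ⟨a, ha⟩ ⟨-b, hb'⟩

lemma gaussianTailInv_gaussianTail (z : ℝ) : gaussianTailInv (gaussianTail z) = z := by
  have : {w | gaussianTail w ≤ gaussianTail z} = Set.Ici z := by
    ext w; exact strictAnti_gaussianTail.le_iff_ge
  rw [gaussianTailInv, this, csInf_Ici]

lemma gaussianTailInv_lt_iff {u : ℝ} (h0 : 0 < u) (h1 : u < 1) (y : ℝ) :
    gaussianTailInv u < y ↔ gaussianTail y < u := by
  obtain ⟨z, rfl⟩ := exists_gaussianTail_eq h0 h1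
  rw [gaussianTailInv_gaussianTail, strictAnti_gaussianTail.lt_iff_gt]

/-! ### Two-sided exceedance probabilities -/

/-- The probability that a unit-variance Gaussian of mean `m` exceeds `z` in absolute value. -/
def exceedProb (z m : ℝ) : ℝ := (gaussianReal m 1).real {y | z < |y|}

lemma exceedProb_eq {z : ℝ} (hz : 0 ≤ z) (m : ℝ) :
    exceedProb z m = gaussianTail (z - m) + gaussianTail (z + m) := by
  have h : {y : ℝ | z < |y|} = Set.Ioi z ∪ Set.Iio (-z) := by
    ext y; simp [lt_abs, lt_neg]
  rw [exceedProb, h, measureReal_union (by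
      rw [Set.disjoint_left]; intro y hy hy'
      simp only [Set.mem_Ioi, Set.mem_Iio] at hy hy'; linarith) measurableSet_Iio,
    gaussianReal_real_Ioi, gaussianReal_real_Iio]
  congr 2; ring

lemma exceedProb_zero {z : ℝ} (hz : 0 ≤ z) : exceedProb z 0 = 2 * gaussianTail z := by
  rw [exceedProb_eq hz]; simp; ring

lemma exceedProb_le_one (z m : ℝ) : exceedProb z m ≤ 1 := measureReal_le_one

lemma hasDerivAt_exceedProb {z : ℝ} (hz : 0 ≤ z) (m : ℝ) : HasDerivAt (exceedProb z)
    (gaussianPDFReal 0 1 (z - m) - gaussianPDFReal 0 1 (z + m)) m := by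
  rw [funext (exceedProb_eq hz)]
  have h1 := (hasDerivAt_gaussianTail (z - m)).comp m ((hasDerivAt_id m).const_sub z)
  have h2 := (hasDerivAt_gaussianTail (z + m)).comp m ((hasDerivAt_id m).const_add z)
  exact (h1.add h2).congr_deriv (by ring)

lemma gaussianPDFReal_diff (z m : ℝ) : gaussianPDFReal 0 1 (z - m) - gaussianPDFReal 0 1 (z + m) =
    2 * (√(2 * Real.pi))⁻¹ * Real.exp (-(z ^ 2 + m ^ 2) / 2) * Real.sinh (z * m) := by
  rw [gaussianPDFReal_std, gaussianPDFReal_std, Real.sinh_eq,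
    show -(z - m) ^ 2 / 2 = -(z ^ 2 + m ^ 2) / 2 + z * m by ring,
    show -(z + m) ^ 2 / 2 = -(z ^ 2 + m ^ 2) / 2 + -(z * m) by ring, Real.exp_add, Real.exp_add]
  ring

lemma exceedProb_abs {z : ℝ} (hz : 0 ≤ z) (m : ℝ) : exceedProb z |m| = exceedProb z m := by
  rcases abs_cases m with ⟨h, _⟩ | ⟨h, _⟩ <;> rw [h]
  rw [exceedProb_eq hz, exceedProb_eq hz, add_comm]; congr 2; ring

lemma monotoneOn_exceedProb {z : ℝ} (hz : 0 ≤ z) : MonotoneOn (exceedProb z) (Set.Ici 0) := by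
  refine monotoneOn_of_deriv_nonneg (convex_Ici 0)
    (fun m _ => (hasDerivAt_exceedProb hz m).continuousAt.continuousWithinAt)
    (fun m _ => (hasDerivAt_exceedProb hz m).differentiableAt.differentiableWithinAt) ?_
  intro m hm
  rw [interior_Ici, Set.mem_Ioi] at hm
  rw [(hasDerivAt_exceedProb hz m).deriv, gaussianPDFReal_diff]
  have : 0 ≤ Real.sinh (z * m) := Real.sinh_nonneg_iff.2 (by positivity)
  positivity

lemma exceedProb_le_of_le_abs {z m m' : ℝ} (hz : 0 ≤ z) (hm : 0 ≤ m) (h : m ≤ |m'|) :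
    exceedProb z m ≤ exceedProb z m' := by
  rw [← exceedProb_abs hz m']
  exact monotoneOn_exceedProb hz hm (hm.trans h) h

lemma gaussianTail_sub_le_exceedProb {z : ℝ} (hz : 0 ≤ z) (m : ℝ) :
    gaussianTail (z - m) ≤ exceedProb z m := by
  rw [exceedProb_eq hz]; linarith [gaussianTail_nonneg (z + m)]

/-- A weak two-sided signal raises the exceedance probability by the order of its square. -/
lemma exists_exceedProb_one_ge : ∃ c : ℝ, 0 < c ∧ ∀ m ∈ Set.Icc (0 : ℝ) 1,
    exceedProb 1 0 + c * m ^ 2 ≤ exceedProb 1 m := by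
  set c : ℝ := (√(2 * Real.pi))⁻¹ * Real.exp (-1) with hc
  refine ⟨c, by positivity, ?_⟩
  have hd : ∀ m, HasDerivAt (fun m => exceedProb 1 m - c * m ^ 2)
      ((gaussianPDFReal 0 1 (1 - m) - gaussianPDFReal 0 1 (1 + m)) - c * (2 * m)) m := by
    intro m
    refine (hasDerivAt_exceedProb zero_le_one m).sub ?_
    simpa using ((hasDerivAt_pow 2 m).const_mul c)
  have hmono : MonotoneOn (fun m => exceedProb 1 m - c * m ^ 2) (Set.Icc 0 1) := by
    refine monotoneOn_of_deriv_nonneg (convex_Icc 0 1)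
      (fun m _ => (hd m).continuousAt.continuousWithinAt)
      (fun m _ => (hd m).differentiableAt.differentiableWithinAt) ?_
    intro m hm
    rw [interior_Icc] at hm
    rw [(hd m).deriv, gaussianPDFReal_diff, one_mul]
    have h1 : m ≤ Real.sinh m := Real.self_le_sinh_iff.2 hm.1.le
    have h2 : Real.exp (-1) ≤ Real.exp (-(1 ^ 2 + m ^ 2) / 2) := by
      apply Real.exp_le_exp.2; nlinarith [hm.1, hm.2]
    have h3 : c * (2 * m) ≤ 2 * (√(2 * Real.pi))⁻¹ * Real.exp (-(1 ^ 2 + m ^ 2) / 2) * m := by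
      have : 0 ≤ 2 * (√(2 * Real.pi))⁻¹ * m := by have := hm.1.le; positivity
      calc c * (2 * m) = 2 * (√(2 * Real.pi))⁻¹ * m * Real.exp (-1) := by rw [hc]; ring
        _ ≤ 2 * (√(2 * Real.pi))⁻¹ * m * Real.exp (-(1 ^ 2 + m ^ 2) / 2) := by gcongr
        _ = _ := by ring
    have h4 : 2 * (√(2 * Real.pi))⁻¹ * Real.exp (-(1 ^ 2 + m ^ 2) / 2) * m ≤
      2 * (√(2 * Real.pi))⁻¹ * Real.exp (-(1 ^ 2 + m ^ 2) / 2) * Real.sinh m := by gcongr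
    linarith
  intro m hm
  have := hmono (Set.left_mem_Icc.2 zero_le_one) hm hm.1
  simp at this
  linarith

/-! ### The Bernoulli divergence -/

lemma mul_log_ge_sub {u v : ℝ} (hu : 0 ≤ u) (hv : 0 < v) : u - v ≤ u * Real.log (u / v) := by
  rcases hu.eq_or_lt with rfl | hu
  · simp [hv.le]
  · have h := Real.log_le_sub_one_of_pos (show 0 < v / u by positivity)
    have h2 : Real.log (u / v) = -Real.log (v / u) := by rw [← Real.log_inv, inv_div]
    rw [h2]
    have : u * (v / u) = v := by field_simp
    nlinarith

lemma mul_log_sub_le_bernoulliKL {x q : ℝ} (hx1 : x ≤ 1) (hq1 : q < 1) :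
    x * Real.log (x / q) - x + q ≤ bernoulliKL x q := by
  have := mul_log_ge_sub (u := 1 - x) (v := 1 - q) (by linarith) (by linarith)
  unfold bernoulliKL; linarith

/-- The divergence dominates the squared Hellinger-type distance. -/
lemma sq_sqrt_sub_sqrt_le_bernoulliKL {x q : ℝ} (hx0 : 0 ≤ x) (hx1 : x ≤ 1) (hq0 : 0 < q)
    (hq1 : q < 1) : (√x - √q) ^ 2 ≤ bernoulliKL x q := by
  refine le_trans ?_ (mul_log_sub_le_bernoulliKL hx1 hq1)
  have hsx := Real.sq_sqrt hx0
  have hsq := Real.sq_sqrt hq0.le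
  have h := mul_log_ge_sub (Real.sqrt_nonneg x) (Real.sqrt_pos.2 hq0)
  have h2 : Real.log (x / q) = 2 * Real.log (√x / √q) := by
    rw [← Real.sqrt_div hx0, Real.log_sqrt (by positivity)]; ring
  rw [h2]
  have h3 := mul_le_mul_of_nonneg_left h (Real.sqrt_nonneg x)
  have h4 : √x * (√x * Real.log (√x / √q)) = x * Real.log (√x / √q) := by
    rw [← mul_assoc, Real.mul_self_sqrt hx0]
  nlinarith

lemma continuousAt_bernoulliKL (x : ℝ) {q : ℝ} (hq0 : 0 < q) (hq1 : q < 1) :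
    ContinuousAt (bernoulliKL x) q := by
  have h1 : q ≠ 0 := hq0.ne'
  have h2 : 1 - q ≠ 0 := by linarith
  have key : ∀ (u : ℝ) (g : ℝ → ℝ), ContinuousAt g q → g q ≠ 0 →
      ContinuousAt (fun r => u * Real.log (u / g r)) q := by
    intro u g hg hg0
    rcases eq_or_ne u 0 with rfl | hu
    · simpa using continuousAt_const
    · exact continuousAt_const.mul ((continuousAt_const.div hg hg0).log (div_ne_zero hu hg0))
  exact (key x id continuousAt_id h1).add (key (1 - x) (fun r => 1 - r) (by fun_prop) h2)

lemma exp_mul_bernoulliKL {p k : ℕ} (hp : 0 < p) (hk : k ≤ p) {q : ℝ} (hq0 : 0 < q)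
    (hq1 : q < 1) : Real.exp (p * bernoulliKL (k / p) q) =
      ((k / p : ℝ) / q) ^ k * ((1 - k / p : ℝ) / (1 - q)) ^ (p - k) := by
  have hp' : (0 : ℝ) < p := by exact_mod_cast hp
  have h1 : (p : ℝ) * bernoulliKL (k / p) q =
      k * Real.log ((k / p : ℝ) / q) + ((p - k : ℕ) : ℝ) * Real.log ((1 - k / p : ℝ) / (1 - q)) := by
    rw [bernoulliKL, Nat.cast_sub hk]; field_simp
  rw [h1, Real.exp_add, Real.exp_nat_mul, Real.exp_nat_mul]
  congr 1
  · rcases Nat.eq_zero_or_pos k with rfl | hk0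
    · simp
    · rw [Real.exp_log]
      have : (0 : ℝ) < k := by exact_mod_cast hk0
      positivity
  · rcases hk.eq_or_lt with rfl | hk1
    · simp
    · rw [Real.exp_log]
      have : (k : ℝ) < p := by exact_mod_cast hk1
      have : (k / p : ℝ) < 1 := by rwa [div_lt_one hp']
      apply div_pos <;> linarith

/-! ### Counts of independent exceedances -/

open Classical in
/-- The number of coordinates of `y` that lie in `A`. -/
def countIn {p : ℕ} (A : Set ℝ) (y : Fin p → ℝ) : ℕ := (Finset.univ.filter fun j => y j ∈ A).card

lemma countIn_le {p : ℕ} (A : Set ℝ) (y : Fin p → ℝ) : countIn A y ≤ p := by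
  classical
  simpa [countIn] using Finset.card_filter_le (Finset.univ : Finset (Fin p)) (fun j => y j ∈ A)

lemma countIn_mono {p : ℕ} {A B : Set ℝ} (h : A ⊆ B) (y : Fin p → ℝ) :
    countIn A y ≤ countIn B y := by
  classical
  exact Finset.card_le_card (Finset.monotone_filter_right _ fun _ _ hj => h hj)

open Classical in
lemma prod_ite_eq_pow_countIn {p : ℕ} (A : Set ℝ) (y : Fin p → ℝ) (a b : ℝ) :
    ∏ j, (if y j ∈ A then a else b) = a ^ countIn A y * b ^ (p - countIn A y) := by
  rw [Finset.prod_ite, Finset.prod_const, Finset.prod_const, countIn]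
  congr 2
  have := Finset.card_filter_add_card_filter_not (s := (Finset.univ : Finset (Fin p)))
    (fun j => y j ∈ A)
  rw [Finset.card_univ, Fintype.card_fin] at this
  omega

lemma measurable_countIn {p : ℕ} {A : Set ℝ} (hA : MeasurableSet A) :
    Measurable (countIn A : (Fin p → ℝ) → ℕ) := by
  classical
  have : (countIn A : (Fin p → ℝ) → ℕ) = fun y => ∑ j, if y j ∈ A then 1 else 0 := by
    ext y; simp [countIn]
  rw [this]
  exact Finset.measurable_sum _ fun j _ =>
    Measurable.ite (hA.preimage (measurable_pi_apply j)) measurable_const measurable_const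

/-- The two-variable generating function of a count of independent events. -/
lemma integral_pow_countIn {p : ℕ} (ν : Fin p → Measure ℝ) [∀ j, IsProbabilityMeasure (ν j)]
    {A : Set ℝ} (hA : MeasurableSet A) (a b : ℝ) :
    ∫ y, a ^ countIn A y * b ^ (p - countIn A y) ∂(Measure.pi ν) =
      ∏ j, (a * (ν j).real A + b * (1 - (ν j).real A)) := by
  classical
  simp_rw [← prod_ite_eq_pow_countIn]
  rw [integral_fintype_prod_eq_prod (𝕜 := ℝ) (fun _ (v : ℝ) => if v ∈ A then a else b)]
  refine Finset.prod_congr rfl fun j _ => ?_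
  have : (fun v : ℝ => if v ∈ A then a else b) =
      fun v => A.indicator (fun _ => a - b) v + b := by
    ext v; by_cases hv : v ∈ A <;> simp [hv]
  rw [this, integral_add ((integrable_const _).indicator hA) (integrable_const _),
    integral_indicator_const _ hA]
  simp; ring

lemma integrable_comp_countIn {p : ℕ} (ν : Fin p → Measure ℝ) [∀ j, IsProbabilityMeasure (ν j)]
    {A : Set ℝ} (hA : MeasurableSet A) (f : ℕ → ℝ) :
    Integrable (fun y => f (countIn A y)) (Measure.pi ν) := by
  refine Integrable.of_bound (C := ∑ k ∈ Finset.range (p + 1), |f k|)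
    ((measurable_from_top (f := f)).comp (measurable_countIn hA)).aestronglyMeasurable
    (ae_of_all _ fun y => ?_)
  exact Finset.single_le_sum (f := fun k => |f k|) (fun _ _ => abs_nonneg _)
    (Finset.mem_range.2 (Nat.lt_succ_of_le (countIn_le A y)))

/-- Chernoff's inequality, upper and lower tails at once: an event on which the likelihood ratio
between success probabilities `k / p` and `q` is at least its value at `k`. -/
lemma measureReal_countIn_le_exp {p k : ℕ} (hp : 0 < p) (hk : k ≤ p) (ν : Fin p → Measure ℝ)
    [∀ j, IsProbabilityMeasure (ν j)] {A : Set ℝ} (hA : MeasurableSet A) {q : ℝ} (hq0 : 0 < q)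
    (hq1 : q < 1) (hν : ∀ j, (ν j).real A = q) {E : Set (Fin p → ℝ)}
    (hE : ∀ y ∈ E, (q ≤ k / p ∧ k ≤ countIn A y) ∨ ((k : ℝ) / p ≤ q ∧ countIn A y ≤ k)) :
    (Measure.pi ν).real E ≤ Real.exp (-(p * bernoulliKL (k / p) q)) := by
  have hp' : (0 : ℝ) < p := by exact_mod_cast hp
  have hq1' : 0 < 1 - q := by linarith
  set a : ℝ := (k / p : ℝ) / q with ha
  set b : ℝ := (1 - k / p : ℝ) / (1 - q) with hb
  have hx1 : (k / p : ℝ) ≤ 1 := by rw [div_le_one hp']; exact_mod_cast hk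
  have ha0 : 0 ≤ a := by positivity
  have hb0 : 0 ≤ b := div_nonneg (by linarith) hq1'.le
  have hint := integral_pow_countIn ν hA a b
  have hone : ∏ j : Fin p, (a * (ν j).real A + b * (1 - (ν j).real A)) = 1 := by
    refine Finset.prod_eq_one fun j _ => ?_
    rw [hν, ha, hb, div_mul_cancel₀ _ hq0.ne', div_mul_cancel₀ _ hq1'.ne']; ring
  rw [hone] at hint
  have hmarkov := mul_meas_ge_le_integral_of_nonneg (μ := Measure.pi ν)
    (ae_of_all _ fun y => by positivity)
    (integrable_comp_countIn ν hA fun m => a ^ m * b ^ (p - m))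
    (Real.exp (p * bernoulliKL (k / p) q))
  rw [hint] at hmarkov
  have hsub : E ⊆ {y | Real.exp (p * bernoulliKL (k / p) q) ≤
      a ^ countIn A y * b ^ (p - countIn A y)} := by
    intro y hy
    rw [Set.mem_ofPred_eq, exp_mul_bernoulliKL hp hk hq0 hq1]
    rcases hE y hy with ⟨h1, h2⟩ | ⟨h1, h2⟩
    · have ha1 : 1 ≤ a := by rwa [ha, one_le_div hq0]
      have hb1 : b ≤ 1 := by rw [hb, div_le_one hq1']; linarith
      exact mul_le_mul (pow_le_pow_right₀ ha1 h2)
        (pow_le_pow_of_le_one hb0 hb1 (by omega)) (by positivity) (by positivity)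
    · have ha1 : a ≤ 1 := by rwa [ha, div_le_one hq0]
      have hb1 : 1 ≤ b := by rw [hb, one_le_div hq1']; linarith
      exact mul_le_mul (pow_le_pow_of_le_one ha0 ha1 h2)
        (pow_le_pow_right₀ hb1 (by omega)) (by positivity) (by positivity)
  have h3 := (measureReal_mono (μ := Measure.pi ν) hsub)
  rw [Real.exp_neg, ← one_div, le_div_iff₀ (Real.exp_pos _), mul_comm]
  exact (mul_le_mul_of_nonneg_left h3 (Real.exp_pos _).le).trans hmarkov

/-- A count of independent events of total probability at least `μ₀` is rarely below `μ₀ - d`. -/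
lemma measureReal_countIn_lt_le {p : ℕ} (ν : Fin p → Measure ℝ)
    [∀ j, IsProbabilityMeasure (ν j)] {A : Set ℝ} (hA : MeasurableSet A) {μ₀ d : ℝ}
    (hμ₀ : 0 < μ₀) (hd0 : 0 ≤ d) (hd : d ≤ μ₀) (hν : μ₀ ≤ ∑ j, (ν j).real A) :
    (Measure.pi ν).real {y | (countIn A y : ℝ) ≤ μ₀ - d} ≤ Real.exp (-(d ^ 2 / (4 * μ₀))) := by
  -- this tilt minimizes the exponent `l ^ 2 μ₀ - l d` of the final bound
  set l : ℝ := d / (2 * μ₀) with hl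
  have hl0 : 0 ≤ l := by positivity
  have hl1 : l ≤ 1 := by rw [hl, div_le_one (by positivity)]; linarith
  have hbound : Real.exp (-l) ≤ 1 - l + l ^ 2 := by
    have := Real.abs_exp_sub_one_sub_id_le (x := -l) (by rw [abs_neg, abs_of_nonneg hl0]; exact hl1)
    have := (abs_le.1 this).2
    nlinarith
  have hint := integral_pow_countIn ν hA (Real.exp (-l)) 1
  simp only [one_pow, mul_one, one_mul] at hint
  have hprod : ∏ j, (Real.exp (-l) * (ν j).real A + (1 - (ν j).real A)) ≤
      Real.exp (-(l - l ^ 2) * μ₀) := by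
    calc _ ≤ ∏ j, Real.exp (-(l - l ^ 2) * (ν j).real A) := by
          refine Finset.prod_le_prod (fun j _ => ?_) fun j _ => ?_
          · have : (ν j).real A ≤ 1 := measureReal_le_one
            have := measureReal_nonneg (μ := ν j) (s := A)
            have := Real.exp_pos (-l)
            nlinarith
          · have := Real.add_one_le_exp (-(l - l ^ 2) * (ν j).real A)
            have := measureReal_nonneg (μ := ν j) (s := A)
            nlinarith
      _ = Real.exp (-(l - l ^ 2) * ∑ j, (ν j).real A) := by rw [← Real.exp_sum, Finset.mul_sum]
      _ ≤ _ := by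
          apply Real.exp_le_exp.2
          have : 0 ≤ l - l ^ 2 := by nlinarith
          nlinarith
  have hmarkov := mul_meas_ge_le_integral_of_nonneg (μ := Measure.pi ν)
    (ae_of_all _ fun y => by positivity)
    (integrable_comp_countIn ν hA fun m => Real.exp (-l) ^ m) (Real.exp (-l * (μ₀ - d)))
  rw [hint] at hmarkov
  have hsub : {y : Fin p → ℝ | (countIn A y : ℝ) ≤ μ₀ - d} ⊆
      {y | Real.exp (-l * (μ₀ - d)) ≤ Real.exp (-l) ^ countIn A y} := by
    intro y hy
    rw [Set.mem_ofPred_eq] at hy ⊢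
    rw [← Real.exp_nat_mul]
    apply Real.exp_le_exp.2
    nlinarith
  have h3 := (measureReal_mono (μ := Measure.pi ν) hsub)
  have h4 : Real.exp (-l * (μ₀ - d)) * (Measure.pi ν).real {y | (countIn A y : ℝ) ≤ μ₀ - d} ≤
      Real.exp (-(l - l ^ 2) * μ₀) :=
    (mul_le_mul_of_nonneg_left h3 (Real.exp_pos _).le).trans (hmarkov.trans hprod)
  rw [← le_div_iff₀' (Real.exp_pos _), ← Real.exp_sub] at h4
  refine h4.trans (Real.exp_le_exp.2 (le_of_eq ?_))
  rw [hl]; field_simp; ring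

/-! ### The Berk–Jones process at one time -/

/-- The set of contrasts that are significant at level `q`. -/
def levelSet (q : ℝ) : Set ℝ := {v | 2 * gaussianTail |v| < q}

lemma measurableSet_levelSet (q : ℝ) : MeasurableSet (levelSet q) :=
  measurableSet_lt ((continuous_gaussianTail.comp continuous_abs).measurable.const_mul 2)
    measurable_const

lemma levelSet_mono {q q' : ℝ} (h : q ≤ q') : levelSet q ⊆ levelSet q' :=
  fun _ hv => lt_of_lt_of_le hv h

lemma levelSet_two_mul_gaussianTail (z : ℝ) : levelSet (2 * gaussianTail z) = {v | z < |v|} := by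
  ext v
  simp only [levelSet, Set.mem_ofPred_eq, mul_lt_mul_iff_right₀ (zero_lt_two' ℝ)]
  exact strictAnti_gaussianTail.lt_iff_gt

lemma exists_level_eq {q : ℝ} (h0 : 0 < q) (h1 : q < 1) : ∃ z, 0 < z ∧ 2 * gaussianTail z = q := by
  obtain ⟨z, hz⟩ := exists_gaussianTail_eq (u := q / 2) (by linarith) (by linarith)
  refine ⟨z, ?_, by linarith⟩
  rw [← strictAnti_gaussianTail.lt_iff_gt, hz, gaussianTail_zero]; linarith

lemma gaussianReal_real_levelSet {q : ℝ} (h0 : 0 < q) (h1 : q < 1) :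
    (gaussianReal 0 1).real (levelSet q) = q := by
  obtain ⟨z, hz, rfl⟩ := exists_level_eq h0 h1
  rw [levelSet_two_mul_gaussianTail]
  exact exceedProb_zero hz.le

lemma exceedFraction_eq {p n : ℕ} (x : Obs p n) (t : ℕ) {q : ℝ} (h0 : 0 < q) (h1 : q < 1) :
    exceedFraction x t q = (countIn (levelSet q) (contrast x t) : ℝ) / p := by
  classical
  unfold exceedFraction countIn
  congr 2
  rw [Set.ncard_eq_toFinset_card']
  congr 1
  ext j
  have hj : contrast x t j ∈ levelSet q ↔ 2 * gaussianTail |contrast x t j| < q := Iff.rfl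
  rw [Set.mem_toFinset, Set.mem_ofPred_eq, Finset.mem_filter, hj,
    gaussianTailInv_lt_iff (by linarith) (by linarith)]
  simp only [Finset.mem_univ, true_and]
  constructor <;> intro h <;> linarith

/-- The scaled divergence of the fraction of contrasts significant at level `q` from `q`. -/
def bjProcess {p : ℕ} (y : Fin p → ℝ) (q : ℝ) : ℝ :=
  p * bernoulliKL ((countIn (levelSet q) y : ℝ) / p) q

lemma measurable_bjProcess {p : ℕ} (q : ℝ) :
    Measurable fun y : Fin p → ℝ => bjProcess y q :=
  (measurable_from_top (f := fun m : ℕ => (p : ℝ) * bernoulliKL ((m : ℝ) / p) q)).comp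
    (measurable_countIn (measurableSet_levelSet q))

/-- The count of significant contrasts is left-continuous in the level, so a strict lower bound
for the divergence persists at slightly smaller levels. -/
lemma exists_rat_level {p : ℕ} (y : Fin p → ℝ) {q c : ℝ} (h0 : 0 < q) (h1 : q < 1)
    (hc : c < bjProcess y q) : ∃ r : ℚ, 0 < (r : ℝ) ∧ (r : ℝ) < 1 ∧ c < bjProcess y r := by
  have hcount : ∀ᶠ r in 𝓝[<] q, countIn (levelSet r) y = countIn (levelSet q) y := by
    have : ∀ᶠ r in 𝓝[<] q, ∀ j, (y j ∈ levelSet r ↔ y j ∈ levelSet q) := by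
      rw [eventually_all]
      intro j
      by_cases hj : y j ∈ levelSet q
      · filter_upwards [nhdsWithin_le_nhds (lt_mem_nhds (show 2 * gaussianTail |y j| < q from hj))]
          with r hr
        exact iff_of_true hr hj
      · filter_upwards [self_mem_nhdsWithin] with r hr
        exact iff_of_false (fun h => hj (levelSet_mono (le_of_lt hr) h)) hj
    filter_upwards [this] with r hr
    unfold countIn
    congr 1
    ext j
    simp [hr]
  have hcont : ∀ᶠ r in 𝓝[<] q,
      c < p * bernoulliKL ((countIn (levelSet q) y : ℝ) / p) r :=
    nhdsWithin_le_nhds ((continuousAt_const.mul (continuousAt_bernoulliKL _ h0 h1)).eventually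
      (lt_mem_nhds hc))
  obtain ⟨l, hl, hlq⟩ := (mem_nhdsLT_iff_exists_Ioo_subset).1
    (hcount.and (hcont.and (nhdsWithin_le_nhds (lt_mem_nhds h0))))
  obtain ⟨r, hlr, hrq⟩ := exists_rat_btwn (show l < q from hl)
  obtain ⟨hr1, hr2, hr3⟩ := hlq ⟨hlr, hrq⟩
  refine ⟨r, hr3, hrq.trans h1, ?_⟩
  rw [bjProcess, hr1]
  exact hr2

lemma measure_iUnion_le_of_directed {Ω ι : Type*} [MeasurableSpace Ω] [Countable ι]
    {μ : Measure Ω} {E : ι → Set Ω} (hd : Directed (· ⊆ ·) E) {c : ENNReal}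
    (h : ∀ i, μ (E i) ≤ c) : μ (⋃ i, E i) ≤ c := by
  rw [hd.measure_iUnion]; exact iSup_le h

/-- Under independent standard Gaussian contrasts the supremum of the Berk–Jones process has
exponential tails. For each value `k` of the count, the events at varying levels are nested, so no
union bound over levels is needed. -/
lemma measure_exists_lt_bjProcess_le {p : ℕ} (hp : 0 < p) (c : ℝ) :
    Measure.pi (fun _ : Fin p => gaussianReal 0 1)
      {y | ∃ q ∈ Set.Ioo (0 : ℝ) 1, c < bjProcess y q} ≤
      ENNReal.ofReal (2 * (p + 1) * Real.exp (-c)) := by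
  set μ := Measure.pi (fun _ : Fin p => gaussianReal 0 1) with hμ
  let U : ℕ → Set ℚ := fun k => {r | 0 < (r : ℝ) ∧ (r : ℝ) < 1 ∧
    c < p * bernoulliKL ((k : ℝ) / p) r ∧ (r : ℝ) ≤ k / p}
  let V : ℕ → Set ℚ := fun k => {r | 0 < (r : ℝ) ∧ (r : ℝ) < 1 ∧
    c < p * bernoulliKL ((k : ℝ) / p) r ∧ (k : ℝ) / p ≤ r}
  have hsub : {y : Fin p → ℝ | ∃ q ∈ Set.Ioo (0 : ℝ) 1, c < bjProcess y q} ⊆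
      ⋃ k ∈ Finset.range (p + 1), ((⋃ r : U k, {y | k ≤ countIn (levelSet (r.1 : ℝ)) y}) ∪
        ⋃ r : V k, {y | countIn (levelSet (r.1 : ℝ)) y ≤ k}) := by
    rintro y ⟨q, ⟨h0, h1⟩, hq⟩
    obtain ⟨r, hr0, hr1, hr⟩ := exists_rat_level y h0 h1 hq
    refine Set.mem_biUnion (x := countIn (levelSet (r : ℝ)) y)
      (Finset.mem_coe.2 (Finset.mem_range.2 (Nat.lt_succ_of_le (countIn_le _ _)))) ?_
    rcases le_total (r : ℝ) (countIn (levelSet (r : ℝ)) y / p) with h | h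
    · exact Or.inl (Set.mem_iUnion.2 ⟨⟨r, hr0, hr1, hr, h⟩, by simp⟩)
    · exact Or.inr (Set.mem_iUnion.2 ⟨⟨r, hr0, hr1, hr, h⟩, by simp⟩)
  have hbound : ∀ k ∈ Finset.range (p + 1),
      μ ((⋃ r : U k, {y | k ≤ countIn (levelSet (r.1 : ℝ)) y}) ∪
        ⋃ r : V k, {y | countIn (levelSet (r.1 : ℝ)) y ≤ k}) ≤
      ENNReal.ofReal (2 * Real.exp (-c)) := by
    intro k hk
    have hk' : k ≤ p := Nat.lt_succ_iff.1 (Finset.mem_range.1 hk)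
    have hU : μ (⋃ r : U k, {y | k ≤ countIn (levelSet (r.1 : ℝ)) y}) ≤
        ENNReal.ofReal (Real.exp (-c)) := by
      refine measure_iUnion_le_of_directed ?_ fun r => ?_
      · refine Monotone.directed_le fun r r' h y hy => ?_
        exact le_trans (Set.mem_ofPred_eq ▸ hy) (countIn_mono (levelSet_mono (by exact_mod_cast h)) y)
      · obtain ⟨r, h0, h1, h2, h3⟩ := r
        rw [← ofReal_measureReal]
        refine ENNReal.ofReal_le_ofReal ((measureReal_countIn_le_exp hp hk' _
          (measurableSet_levelSet r) h0 h1 (fun _ => gaussianReal_real_levelSet h0 h1)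
          fun y hy => Or.inl ⟨h3, hy⟩).trans (Real.exp_le_exp.2 (by linarith)))
    have hV : μ (⋃ r : V k, {y | countIn (levelSet (r.1 : ℝ)) y ≤ k}) ≤
        ENNReal.ofReal (Real.exp (-c)) := by
      refine measure_iUnion_le_of_directed ?_ fun r => ?_
      · refine Antitone.directed_le fun r r' h y hy => ?_
        exact le_trans (countIn_mono (levelSet_mono (by exact_mod_cast h)) y) (Set.mem_ofPred_eq ▸ hy)
      · obtain ⟨r, h0, h1, h2, h3⟩ := r
        rw [← ofReal_measureReal]
        refine ENNReal.ofReal_le_ofReal ((measureReal_countIn_le_exp hp hk' _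
          (measurableSet_levelSet r) h0 h1 (fun _ => gaussianReal_real_levelSet h0 h1)
          fun y hy => Or.inr ⟨h3, hy⟩).trans (Real.exp_le_exp.2 (by linarith)))
    refine (measure_union_le _ _).trans ((add_le_add hU hV).trans (le_of_eq ?_))
    rw [← ENNReal.ofReal_add (Real.exp_pos _).le (Real.exp_pos _).le]; congr 1; ring
  refine (measure_mono hsub).trans ((measure_biUnion_finset_le _ _).trans
    ((Finset.sum_le_sum hbound).trans (le_of_eq ?_)))
  rw [Finset.sum_const, Finset.card_range, nsmul_eq_mul, ← ENNReal.ofReal_natCast,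
    ← ENNReal.ofReal_mul (by positivity)]
  congr 1; push_cast; ring

/-! ### The penalized Berk–Jones test -/

lemma lt_pbjStat_iff {p n : ℕ} (x : Obs p n) (c : ℝ) : (c : EReal) < pbjStat x ↔
    ∃ t ∈ grid n, ∃ q ∈ Set.Ioo (0 : ℝ) 1,
      c + 2 * Real.log ((grid n).card : ℝ) < bjProcess (contrast x t) q := by
  rw [pbjStat, EReal.lt_sub_iff_add_lt (Or.inl (EReal.coe_ne_bot _)) (Or.inl (EReal.coe_ne_top _)),
    ← EReal.coe_add]
  simp only [lt_iSup_iff, EReal.coe_lt_coe_iff, exists_prop]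
  refine exists_congr fun t => and_congr_right fun _ => exists_congr fun q =>
    and_congr_right fun hq => ?_
  rw [exceedFraction_eq x t hq.1 hq.2]
  rfl

lemma pbjTest_eq_one_or_zero (γ : ℝ) {p n : ℕ} (x : Obs p n) :
    pbjTest γ p n x = 0 ∨ pbjTest γ p n x = 1 := by
  unfold pbjTest; split_ifs <;> simp

lemma measurable_contrasts {p n : ℕ} (t : ℕ) :
    Measurable fun x : Obs p n => contrast x t :=
  measurable_pi_lambda _ fun j => measurable_contrast t j

lemma measurableSet_lt_pbjStat {p n : ℕ} (c : ℝ) :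
    MeasurableSet {x : Obs p n | (c : EReal) < pbjStat x} := by
  set c' := c + 2 * Real.log ((grid n).card : ℝ) with hc'
  have : {x : Obs p n | (c : EReal) < pbjStat x} = ⋃ t ∈ grid n,
      ⋃ r ∈ {r : ℚ | 0 < (r : ℝ) ∧ (r : ℝ) < 1}, {x | c' < bjProcess (contrast x t) r} := by
    ext x
    rw [Set.mem_ofPred_eq, lt_pbjStat_iff]
    simp only [Set.mem_iUnion, Set.mem_ofPred_eq, exists_prop]
    refine exists_congr fun t => and_congr_right fun _ => ⟨?_, ?_⟩
    · rintro ⟨q, hq, h⟩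
      obtain ⟨r, h0, h1, hr⟩ := exists_rat_level _ hq.1 hq.2 h
      exact ⟨r, ⟨h0, h1⟩, hr⟩
    · rintro ⟨r, hr, h⟩
      exact ⟨r, hr, h⟩
  rw [this]
  refine Finset.measurableSet_biUnion _ fun t _ =>
    MeasurableSet.biUnion (Set.to_countable _) fun r _ => ?_
  exact measurableSet_lt measurable_const ((measurable_bjProcess _).comp (measurable_contrasts t))

lemma isTest_pbjTest (γ : ℝ) (p n : ℕ) : IsTest (pbjTest γ p n) :=
  ⟨Measurable.ite (measurableSet_lt_pbjStat _) measurable_const measurable_const,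
    pbjTest_eq_one_or_zero γ⟩

lemma contrast_of_mem_nullSpace {p n t : ℕ} (h1 : 1 ≤ t) (h2 : t < n) {θ : Obs p n}
    (hθ : θ ∈ nullSpace p n) (j : Fin p) : contrast θ t j = 0 := by
  obtain ⟨μ, hμ⟩ := hθ
  rw [contrast_eq_sum]
  simp_rw [hμ, ← Finset.sum_mul, sum_stepVec h1 h2, zero_mul]

/-- Type I error of the test, by a union bound over the grid. -/
lemma integral_pbjTest_null_le {γ : ℝ} (hγ : 0 < γ) {p n : ℕ} (hp : 0 < p)
    (hgrid : ∀ t ∈ grid n, 1 ≤ t ∧ t < n) (hcard : 0 < (grid n).card) {θ : Obs p n}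
    (hθ : θ ∈ nullSpace p n) : ∫ x, pbjTest γ p n x ∂(law θ) ≤ 4 / p := by
  have hp1 : (1 : ℝ) ≤ p := by exact_mod_cast hp
  have hp' : (0 : ℝ) < p := by linarith
  have hT : (1 : ℝ) ≤ (grid n).card := by exact_mod_cast hcard
  set T : ℝ := ((grid n).card : ℝ) with hTdef
  set c : ℝ := 2 * (2 + γ) * Real.log p with hc
  have hind : pbjTest γ p n = Set.indicator {x : Obs p n | (c : EReal) < pbjStat x} 1 := by
    ext x
    by_cases h : (c : EReal) < pbjStat x
    · rw [Set.indicator_of_mem (by exact h)]; exact if_pos h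
    · rw [Set.indicator_of_notMem (by exact h)]; exact if_neg h
  rw [hind, integral_indicator_one (measurableSet_lt_pbjStat c)]
  set c' := c + 2 * Real.log T with hc'
  have hsub : {x : Obs p n | (c : EReal) < pbjStat x} ⊆ ⋃ t ∈ grid n,
      (fun x => contrast x t) ⁻¹' {y | ∃ q ∈ Set.Ioo (0 : ℝ) 1, c' < bjProcess y q} := by
    intro x hx
    obtain ⟨t, ht, q, hq, h⟩ := (lt_pbjStat_iff x c).1 hx
    exact Set.mem_biUnion (Finset.mem_coe.2 ht) ⟨q, hq, h⟩
  have hone : ∀ t ∈ grid n, law θ ((fun x => contrast x t) ⁻¹'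
      {y | ∃ q ∈ Set.Ioo (0 : ℝ) 1, c' < bjProcess y q}) ≤
      ENNReal.ofReal (2 * (p + 1) * Real.exp (-c')) := by
    intro t ht
    refine (Measure.le_map_apply (measurable_contrasts t).aemeasurable _).trans ?_
    have := map_contrast_law (hgrid t ht).1 (hgrid t ht).2 θ
    rw [show (fun x : Obs p n => contrast x t) = fun x j => contrast x t j from rfl, this]
    simp_rw [contrast_of_mem_nullSpace (hgrid t ht).1 (hgrid t ht).2 hθ]
    exact measure_exists_lt_bjProcess_le hp c'
  have hle : law θ {x : Obs p n | (c : EReal) < pbjStat x} ≤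
      ENNReal.ofReal (T * (2 * (p + 1) * Real.exp (-c'))) := by
    refine (measure_mono hsub).trans ((measure_biUnion_finset_le _ _).trans
      ((Finset.sum_le_sum hone).trans (le_of_eq ?_)))
    rw [Finset.sum_const, nsmul_eq_mul, ← ENNReal.ofReal_natCast, ← ENNReal.ofReal_mul (by positivity)]
  refine (ENNReal.toReal_le_of_le_ofReal (by positivity) hle).trans ?_
  have hlogp : 0 ≤ Real.log p := Real.log_nonneg hp1
  have hlogT : 0 ≤ Real.log T := Real.log_nonneg hT
  -- the penalty `2 log T` pays for the union over the grid, and the rest for the `p + 1` counts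
  have hexp : Real.exp (-c') ≤ ((p : ℝ) ^ 2)⁻¹ * T⁻¹ := by
    rw [← Real.exp_log (show (0 : ℝ) < ((p : ℝ) ^ 2)⁻¹ * T⁻¹ by positivity)]
    apply Real.exp_le_exp.2
    rw [Real.log_mul (by positivity) (by positivity), Real.log_inv, Real.log_inv, Real.log_pow,
      hc', hc]
    push_cast
    nlinarith [mul_nonneg hγ.le hlogp]
  calc T * (2 * (p + 1) * Real.exp (-c')) ≤ T * (2 * (p + 1) * (((p : ℝ) ^ 2)⁻¹ * T⁻¹)) := by
        gcongr
    _ = 2 * (p + 1) / p ^ 2 := by field_simp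
    _ ≤ 4 / p := by rw [div_le_div_iff₀ (by positivity) hp']; nlinarith

/-- The Type II error of the test is at most the probability that the Berk–Jones process misses the
threshold at one given time and level. -/
lemma integral_one_sub_pbjTest_le {γ : ℝ} {p n t : ℕ} (ht : t ∈ grid n) (h1 : 1 ≤ t) (h2 : t < n)
    {q : ℝ} (hq : q ∈ Set.Ioo (0 : ℝ) 1) (θ : Obs p n) :
    ∫ x, (1 - pbjTest γ p n x) ∂(law θ) ≤
      (Measure.pi fun j => gaussianReal (contrast θ t j) 1).real
        {y | bjProcess y q ≤ 2 * (2 + γ) * Real.log p + 2 * Real.log ((grid n).card : ℝ)} := by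
  set c : ℝ := 2 * (2 + γ) * Real.log p with hc
  set c' := c + 2 * Real.log ((grid n).card : ℝ) with hc'
  have hind : (fun x => 1 - pbjTest γ p n x) =
      Set.indicator {x : Obs p n | (c : EReal) < pbjStat x}ᶜ 1 := by
    ext x
    by_cases h : (c : EReal) < pbjStat x
    · rw [Set.indicator_of_notMem (by simpa using h), pbjTest, if_pos h, sub_self]
    · rw [Set.indicator_of_mem (by simpa using h), pbjTest, if_neg h, sub_zero]; rfl
  rw [hind, integral_indicator_one (measurableSet_lt_pbjStat c).compl, ← map_contrast_law h1 h2,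
    map_measureReal_apply (measurable_contrasts t)
      (measurableSet_le (measurable_bjProcess q) measurable_const)]
  refine measureReal_mono fun x hx => ?_
  by_contra h
  exact hx ((lt_pbjStat_iff x c).2 ⟨t, ht, q, hq, not_le.1 h⟩)

/-! ### The grid of candidate changepoints -/

section Grid

variable {n : ℕ} {b : ℝ}

lemma pow_floor_logb_le (hb : 1 < b) {x : ℝ} (hx : 1 ≤ x) : b ^ ⌊Real.logb b x⌋₊ ≤ x := by
  have h := Nat.floor_le (Real.logb_nonneg hb hx)
  rwa [Real.le_logb_iff_rpow_le hb (by linarith), Real.rpow_natCast] at h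

lemma lt_pow_floor_logb_succ (hb : 1 < b) {x : ℝ} (hx : 1 ≤ x) :
    x < b ^ (⌊Real.logb b x⌋₊ + 1) := by
  have h := Nat.lt_floor_add_one (Real.logb b x)
  rw [Real.logb_lt_iff_lt_rpow hb (by linarith)] at h
  exact_mod_cast h

lemma mem_grid {t : ℕ} : t ∈ grid n ↔
    (∃ k ≤ ⌊Real.logb (1 + 1 / Real.log (Real.log n)) ((n : ℝ) / 2)⌋₊,
      ⌊(1 + 1 / Real.log (Real.log n)) ^ k⌋₊ = t) ∨
    ∃ k ≤ ⌊Real.logb (1 + 1 / Real.log (Real.log n)) ((n : ℝ) / 2)⌋₊,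
      ⌊(n : ℝ) - (1 + 1 / Real.log (Real.log n)) ^ k⌋₊ = t := by
  simp [grid]

lemma two_le_of_loglog_pos (h : 0 < Real.log (Real.log n)) : 2 ≤ n := by
  by_contra hn
  interval_cases n <;> simp at h

lemma grid_bounds (h : 0 < Real.log (Real.log n)) {t : ℕ} (ht : t ∈ grid n) : 1 ≤ t ∧ t < n := by
  have hn : (2 : ℝ) ≤ n := by exact_mod_cast two_le_of_loglog_pos h
  set b := 1 + 1 / Real.log (Real.log n) with hb
  have hb1 : 1 < b := by rw [hb]; have := one_div_pos.2 h; linarith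
  have key : ∀ k ≤ ⌊Real.logb b ((n : ℝ) / 2)⌋₊, 1 ≤ b ^ k ∧ b ^ k ≤ (n : ℝ) / 2 := fun k hk =>
    ⟨one_le_pow₀ hb1.le, (pow_le_pow_right₀ hb1.le hk).trans
      (pow_floor_logb_le hb1 (by linarith))⟩
  rcases mem_grid.1 ht with ⟨k, hk, rfl⟩ | ⟨k, hk, rfl⟩
  · obtain ⟨h1, h2⟩ := key k hk
    exact ⟨Nat.le_floor (by rw [Nat.cast_one]; exact h1), (Nat.floor_lt (by linarith)).2 (by linarith)⟩
  · obtain ⟨h1, h2⟩ := key k hk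
    exact ⟨Nat.le_floor (by push_cast; linarith), (Nat.floor_lt (by linarith)).2 (by linarith)⟩

lemma grid_card_pos : 0 < (grid n).card :=
  Finset.card_pos.2 ⟨_, mem_grid.2 (Or.inl ⟨0, Nat.zero_le _, rfl⟩)⟩

lemma log_grid_card_le (h : 4 ≤ Real.log (Real.log n)) :
    Real.log ((grid n).card : ℝ) ≤ 2 * Real.log (Real.log n) := by
  set l := Real.log (Real.log n) with hl
  have hn : (2 : ℝ) ≤ n := by exact_mod_cast two_le_of_loglog_pos (n := n) (by linarith)
  set b := 1 + 1 / l with hb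
  have hl0 : 0 < l := by linarith
  have hb1 : 1 < b := by rw [hb]; have := one_div_pos.2 hl0; linarith
  have hlogb : 1 / (l + 1) ≤ Real.log b := by
    have := Real.one_sub_inv_le_log_of_pos (show 0 < b by linarith)
    refine le_trans (le_of_eq ?_) this
    rw [hb]; field_simp; ring
  have hlogn : Real.log n = Real.exp l := by
    rw [hl, Real.exp_log]
    by_contra hneg
    have h1 : 0 ≤ Real.log n := Real.log_nonneg (by linarith)
    have h2 : Real.log n = 0 := by linarith
    rw [h2, Real.log_zero] at hl; linarith
  set M := ⌊Real.logb b ((n : ℝ) / 2)⌋₊ with hM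
  have hMle : (M : ℝ) ≤ Real.exp l * (l + 1) := by
    have h1 : (M : ℝ) ≤ Real.logb b ((n : ℝ) / 2) :=
      Nat.floor_le (Real.logb_nonneg hb1 (by linarith))
    have h2 : Real.log ((n : ℝ) / 2) ≤ Real.exp l := by
      rw [← hlogn]; exact Real.log_le_log (by linarith) (by linarith)
    have h3 : 0 ≤ Real.log ((n : ℝ) / 2) := Real.log_nonneg (by linarith)
    refine h1.trans ?_
    rw [Real.logb, div_le_iff₀ (by linarith [one_div_pos.2 (show 0 < l + 1 by linarith)])]
    calc Real.log ((n : ℝ) / 2) ≤ Real.exp l * (l + 1) * (1 / (l + 1)) := by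
          rw [mul_assoc, mul_one_div_cancel (by linarith), mul_one]; exact h2
      _ ≤ _ := by gcongr
  have hcard : ((grid n).card : ℝ) ≤ 2 * (M + 1) := by
    have : (grid n).card ≤ (M + 1) + (M + 1) := by
      refine (Finset.card_union_le _ _).trans (add_le_add ?_ ?_) <;>
      · refine Finset.card_image_le.trans (le_of_eq ?_)
        rw [Finset.card_range]
    have : ((grid n).card : ℝ) ≤ ((M + 1 + (M + 1) : ℕ) : ℝ) := by exact_mod_cast this
    push_cast at this; linarith
  have hexp : 2 * (l + 2) ≤ Real.exp l := by
    have := Real.quadratic_le_exp_of_nonneg hl0.le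
    nlinarith
  have h1 : (1 : ℝ) ≤ Real.exp l := Real.one_le_exp hl0.le
  rw [Real.log_le_iff_le_exp (by exact_mod_cast grid_card_pos), two_mul l, Real.exp_add]
  calc ((grid n).card : ℝ) ≤ 2 * (Real.exp l * (l + 1) + 1) := by linarith
    _ ≤ Real.exp l * (2 * (l + 2)) := by nlinarith
    _ ≤ _ := by gcongr

lemma le_stepCorr_of_le {t t' : ℕ} (h1 : 1 ≤ t) (h : t ≤ t') (h2 : t' < n) {c : ℝ} (hc : 0 ≤ c)
    (hx : c * t' ≤ t) (hy : c * ((n : ℝ) - t) ≤ (n : ℝ) - t') : c ≤ stepCorr n t t' := by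
  have ht : (0 : ℝ) < t := by exact_mod_cast h1
  have htt : (t : ℝ) ≤ t' := by exact_mod_cast h
  have ht' : (0 : ℝ) < t' := by linarith
  have hn' : (0 : ℝ) < (n : ℝ) - t' := by rw [sub_pos]; exact_mod_cast h2
  have hn : (0 : ℝ) < (n : ℝ) - t := by linarith
  rw [stepCorr_eq h1 h h2]
  apply Real.le_sqrt_of_sq_le
  rw [le_div_iff₀ (by positivity)]
  calc c ^ 2 * (t' * ((n : ℝ) - t)) = (c * t') * (c * ((n : ℝ) - t)) := by ring
    _ ≤ t * ((n : ℝ) - t') := by gcongr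

/-- Every changepoint is close, in the sense of correlation of contrasts, to a grid point. -/
lemma exists_mem_grid_stepCorr (h : 4 ≤ Real.log (Real.log n)) {τ : ℕ} (hτ1 : 1 ≤ τ)
    (hτ2 : τ < n) : ∃ t ∈ grid n, 1 - 2 / Real.log (Real.log n) ≤ stepCorr n t τ := by
  set l := Real.log (Real.log n) with hl
  have hl0 : 0 < l := by linarith
  have hn : (2 : ℝ) ≤ n := by exact_mod_cast two_le_of_loglog_pos (n := n) (by linarith)
  set δ := 1 / l with hδ
  have hδ0 : 0 < δ := one_div_pos.2 hl0
  have hδ1 : δ ≤ 1 / 4 := one_div_le_one_div_of_le (by norm_num) h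
  have h2l : 2 / l = 2 * δ := by rw [hδ]; ring
  rw [h2l]
  set b := 1 + δ with hb
  have hb1 : 1 < b := by linarith
  set M := ⌊Real.logb b ((n : ℝ) / 2)⌋₊ with hM
  have hτ1' : (1 : ℝ) ≤ τ := by exact_mod_cast hτ1
  have hτ2' : (τ : ℝ) + 1 ≤ n := by exact_mod_cast hτ2
  have hpowM : b ^ M ≤ (n : ℝ) / 2 := pow_floor_logb_le hb1 (by linarith)
  have hpowM' : (n : ℝ) / 2 < b ^ (M + 1) := lt_pow_floor_logb_succ hb1 (by linarith)
  have hright : ∀ k ≤ M, ⌊(n : ℝ) - b ^ k⌋₊ ∈ grid n := fun k hk =>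
    mem_grid.2 (Or.inr ⟨k, hk, rfl⟩)
  have hfloor : ∀ k ≤ M, (⌊(n : ℝ) - b ^ k⌋₊ : ℝ) ≤ n - b ^ k := fun k hk =>
    Nat.floor_le (by linarith [pow_le_pow_right₀ hb1.le hk])
  rcases lt_or_ge (n : ℝ) (2 * τ) with hcase | hcase
  · -- the right half: the grid point is `n - ⌈b ^ k⌉` with `b ^ k ≤ n - τ < b ^ (k + 1)`
    set u : ℝ := (n : ℝ) - τ with hu
    have hu1 : 1 ≤ u := by linarith
    set k := ⌊Real.logb b u⌋₊ with hk
    have hk1 : b ^ k ≤ u := pow_floor_logb_le hb1 hu1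
    have hk2 : u < b ^ k * b := by rw [← pow_succ]; exact lt_pow_floor_logb_succ hb1 hu1
    have hkM : k ≤ M := Nat.floor_le_floor (Real.logb_le_logb_of_le hb1 (by linarith) (by linarith))
    refine ⟨_, hright k hkM, ?_⟩
    have hg := hfloor k hkM
    have hle : τ ≤ ⌊(n : ℝ) - b ^ k⌋₊ := Nat.le_floor (by linarith)
    have hlt := (grid_bounds (n := n) (by linarith) (hright k hkM)).2
    rw [stepCorr_comm]
    refine le_trans (show 1 - 2 * δ ≤ 1 - δ by linarith)
      (le_stepCorr_of_le hτ1 hle hlt (by linarith) ?_ ?_)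
    · nlinarith
    · nlinarith
  · by_cases hex : ∃ k, (τ : ℝ) ≤ b ^ k ∧ k ≤ M
    · -- the left half: the grid point is `⌊b ^ k⌋` with `b ^ (k - 1) < τ ≤ b ^ k`
      classical
      obtain ⟨hk1, hk2⟩ := Nat.find_spec hex
      set k := Nat.find hex with hk
      have hmem : ⌊b ^ k⌋₊ ∈ grid n := mem_grid.2 (Or.inl ⟨k, hk2, rfl⟩)
      have hkb : b ^ k ≤ b * τ := by
        rcases Nat.eq_zero_or_pos k with h0 | h0
        · rw [h0, pow_zero]; nlinarith
        · have hmin := Nat.find_min hex (show k - 1 < Nat.find hex by omega)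
          have : b ^ (k - 1) < τ := by
            by_contra hc
            exact hmin ⟨not_lt.1 hc, by omega⟩
          rw [← Nat.sub_add_cancel h0, pow_succ]
          nlinarith
      refine ⟨_, hmem, ?_⟩
      have hle : τ ≤ ⌊b ^ k⌋₊ := Nat.le_floor hk1
      have hlt := (grid_bounds (n := n) (by linarith) hmem).2
      have hg : (⌊b ^ k⌋₊ : ℝ) ≤ b ^ k := Nat.floor_le (by positivity)
      rw [stepCorr_comm]
      refine le_trans (show 1 - 2 * δ ≤ 1 - δ by linarith)
        (le_stepCorr_of_le hτ1 hle hlt (by linarith) ?_ ?_)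
      · nlinarith
      · nlinarith
    · -- just left of the middle: the nearest grid point on the right of the middle serves
      have hτM : b ^ M < τ := by
        by_contra hc
        exact hex ⟨M, not_lt.1 hc, le_rfl⟩
      refine ⟨_, hright M le_rfl, ?_⟩
      have hg := hfloor M le_rfl
      have hle : τ ≤ ⌊(n : ℝ) - b ^ M⌋₊ := Nat.le_floor (by linarith)
      have hlt := (grid_bounds (n := n) (by linarith) (hright M le_rfl)).2
      rw [pow_succ] at hpowM'
      rw [stepCorr_comm]
      refine le_stepCorr_of_le hτ1 hle hlt (by linarith) ?_ ?_
      · nlinarith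
      · nlinarith

end Grid

/-! ### Consequences of the calibration -/

section Calibration

variable {a β : ℝ} {n s : ℕ → ℕ}

lemma neg_one_lt_loglog (n : ℕ) : -1 < Real.log (Real.log n) := by
  rcases le_or_gt n 1 with h | h
  · interval_cases n <;> simp
  · have h2 : Real.log 2 ≤ Real.log n := Real.log_le_log (by norm_num) (by exact_mod_cast h)
    have h3 : Real.log (Real.log 2) ≤ Real.log (Real.log n) :=
      Real.log_le_log (Real.log_pos (by norm_num)) h2
    have h4 := Real.one_sub_inv_le_log_of_pos (Real.log_pos (show (1 : ℝ) < 2 by norm_num))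
    have h5 : (Real.log 2)⁻¹ ≤ (0.6931471803 : ℝ)⁻¹ :=
      inv_anti₀ (by norm_num) Real.log_two_gt_d9.le
    norm_num at h5
    linarith

lemma tendsto_log_natCast : Tendsto (fun p : ℕ => Real.log p) atTop atTop :=
  Real.tendsto_log_atTop.comp tendsto_natCast_atTop_atTop

lemma tendsto_natCast_rpow {c : ℝ} (hc : 0 < c) : Tendsto (fun p : ℕ => (p : ℝ) ^ c) atTop atTop :=
  (tendsto_rpow_atTop hc).comp tendsto_natCast_atTop_atTop

lemma rpow_eq_exp_log {p : ℕ} (hp : 1 ≤ p) (c : ℝ) : (p : ℝ) ^ c = Real.exp (c * Real.log p) := by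
  rw [Real.rpow_def_of_pos (by exact_mod_cast hp), mul_comm]

/-- `log log n = p ^ (a + o(1))`. -/
lemma Calibrated.loglog_bounds (ha : 0 < a) (h : Calibrated a β n s) {ε : ℝ} (hε : 0 < ε) :
    ∀ᶠ p : ℕ in atTop, (p : ℝ) ^ (a - ε) ≤ Real.log (Real.log (n p)) ∧
      Real.log (Real.log (n p)) ≤ (p : ℝ) ^ (a + ε) := by
  have hη : 0 < min (ε / a) (1 / 2) := by positivity
  set η := min (ε / a) (1 / 2) with hηdef
  have hηa : η * a ≤ ε := by
    calc η * a ≤ ε / a * a := by gcongr; exact min_le_left _ _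
      _ = ε := by field_simp
  have hη2 : η ≤ 1 / 2 := min_le_right _ _
  filter_upwards [h.1.eventually (Ioo_mem_nhds (show 1 - η < 1 by linarith)
    (show 1 < 1 + η by linarith)), tendsto_log_natCast.eventually_gt_atTop 0,
    tendsto_log_natCast.eventually_gt_atTop (2 / a), eventually_ge_atTop 1] with p hp hlog hlog2 hp1
  obtain ⟨h1, h2⟩ := hp
  have hal : 0 < a * Real.log p := by positivity
  rw [lt_div_iff₀ hal] at h1
  rw [div_lt_iff₀ hal] at h2
  set l := Real.log (Real.log (n p)) with hl
  have hlogl : 1 < Real.log l := by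
    have : 2 < a * Real.log p := by rwa [div_lt_iff₀' ha] at hlog2
    nlinarith
  have hl0 : 0 < l := by
    by_contra hneg
    have h3 := neg_one_lt_loglog (n p)
    have : Real.log l ≤ 0 := by
      rw [← Real.log_abs]
      exact Real.log_nonpos (abs_nonneg _) (abs_le.2 ⟨by linarith, by linarith⟩)
    linarith
  rw [rpow_eq_exp_log hp1, rpow_eq_exp_log hp1, ← Real.exp_log hl0]
  constructor <;> apply Real.exp_le_exp.2 <;> nlinarith

lemma Calibrated.tendsto_loglog (ha : 0 < a) (h : Calibrated a β n s) :
    Tendsto (fun p => Real.log (Real.log (n p))) atTop atTop := by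
  refine tendsto_atTop_mono' _ ?_ (tendsto_natCast_rpow (show 0 < a / 2 by linarith))
  filter_upwards [h.loglog_bounds ha (show 0 < a / 2 by linarith)] with p hp
  have h1 := hp.1
  rwa [show a - a / 2 = a / 2 by ring] at h1

lemma Calibrated.sparsity_bounds (h : Calibrated a β n s) :
    ∀ᶠ p : ℕ in atTop, (p : ℝ) ^ (1 - β) / 2 ≤ s p ∧ (s p : ℝ) ≤ 2 * (p : ℝ) ^ (1 - β) := by
  filter_upwards [h.2.eventually (Ioo_mem_nhds (show (1 / 2 : ℝ) < 1 by norm_num)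
    (show (1 : ℝ) < 2 by norm_num)), eventually_ge_atTop 1] with p hp hp1
  have hpos : 0 < (p : ℝ) ^ (1 - β) := Real.rpow_pos_of_pos (by exact_mod_cast hp1) _
  obtain ⟨h1, h2⟩ := hp
  rw [lt_div_iff₀ hpos] at h1
  rw [div_lt_iff₀ hpos] at h2
  constructor <;> linarith

end Calibration

/-! ### Type II error at a single time and level -/

lemma abs_contrast_alt {p n t τ : ℕ} (h1 : 1 ≤ t) (h2 : t < n) (h1' : 1 ≤ τ) (h2' : τ < n)
    {θ : Obs p n} {μ₁ μ₂ : Fin p → ℝ}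
    (hθ : ∀ j i, θ j i = if (i : ℕ) < τ then μ₁ j else μ₂ j) (j : Fin p) :
    |contrast θ t j| = √((τ : ℝ) * ((n : ℝ) - τ) / n) * |μ₁ j - μ₂ j| * stepCorr n t τ := by
  rw [contrast_eq_sum]
  simp_rw [hθ]
  rw [sum_stepVec_mul_step h1 h2 h1' h2', abs_mul, abs_mul, abs_of_nonneg (Real.sqrt_nonneg _),
    abs_of_nonneg (stepCorr_nonneg h1 h2 h1' h2')]

/-- If a count of exceedances halfway between its null mean and its mean under the alternative
makes the test reject, the Type II error is exponentially small. -/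
lemma integral_one_sub_pbjTest_alt_le {γ : ℝ} {p n s : ℕ} {ρ z m : ℝ}
    (hl : 4 ≤ Real.log (Real.log n)) (hz : 0 < z) (hm0 : 0 ≤ m)
    (hm : m ≤ ρ * (1 - 2 / Real.log (Real.log n)))
    {X : ℝ} (hX0 : 0 < X) (hX : X ≤ s * (exceedProb z m - 2 * gaussianTail z))
    (hthr : ∀ N : ℕ, N ≤ p → p * (2 * gaussianTail z) + X / 2 < N →
      2 * (2 + γ) * Real.log p + 2 * Real.log ((grid n).card : ℝ) <
        p * bernoulliKL (N / p) (2 * gaussianTail z))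
    {θ : Obs p n} (hθ : θ ∈ altSpace p n ρ s) :
    ∫ x, (1 - pbjTest γ p n x) ∂(law θ) ≤
      Real.exp (-(X ^ 2 / (16 * (p * (2 * gaussianTail z) + X)))) := by
  obtain ⟨S, μ₁, μ₂, τ, hτ1, hτ2, hS, hθeq, hSig, -⟩ := hθ
  obtain ⟨t, ht, hcorr⟩ := exists_mem_grid_stepCorr hl hτ1 hτ2
  obtain ⟨h1, h2⟩ := grid_bounds (n := n) (by linarith) ht
  set q := 2 * gaussianTail z with hq
  have hq0 : 0 < q := by have := gaussianTail_pos z; linarith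
  have hq1 : q < 1 := by
    have := strictAnti_gaussianTail hz
    rw [gaussianTail_zero] at this; linarith
  refine (integral_one_sub_pbjTest_le ht h1 h2 ⟨hq0, hq1⟩ θ).trans ?_
  have hprob : ∀ j, (gaussianReal (contrast θ t j) 1).real (levelSet q) =
      exceedProb z (contrast θ t j) := fun j => by
    rw [hq, levelSet_two_mul_gaussianTail]; rfl
  have hge : ∀ j, q ≤ exceedProb z (contrast θ t j) := fun j => by
    rw [hq, ← exceedProb_zero hz.le]
    exact exceedProb_le_of_le_abs hz.le le_rfl (abs_nonneg _)
  have hgeS : ∀ j ∈ S, exceedProb z m ≤ exceedProb z (contrast θ t j) := fun j hj => by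
    refine exceedProb_le_of_le_abs hz.le hm0 (hm.trans ?_)
    rw [abs_contrast_alt h1 h2 hτ1 hτ2 hθeq]
    have hpos : 0 ≤ 1 - 2 / Real.log (Real.log n) := by
      have : 2 / Real.log (Real.log n) ≤ 2 / 4 := by gcongr
      linarith
    exact mul_le_mul (hSig j hj) hcorr hpos (by positivity)
  have hmean : p * q + X ≤ ∑ j, (gaussianReal (contrast θ t j) 1).real (levelSet q) := by
    simp_rw [hprob]
    have hpos : 0 ≤ exceedProb z m - q := by
      rw [hq, ← exceedProb_zero hz.le]
      exact sub_nonneg.2 (exceedProb_le_of_le_abs hz.le le_rfl (abs_nonneg m))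
    calc p * q + X ≤ p * q + S.card * (exceedProb z m - q) := by
          have : (s : ℝ) ≤ S.card := by exact_mod_cast hS
          have := mul_le_mul_of_nonneg_right this hpos
          linarith
      _ = ∑ j : Fin p, q + ∑ j ∈ S, (exceedProb z m - q) := by
          simp only [Finset.sum_const, nsmul_eq_mul, Finset.card_univ, Fintype.card_fin]
      _ ≤ ∑ j : Fin p, q + ∑ j ∈ S, (exceedProb z (contrast θ t j) - q) := by
          gcongr with j hj
          exact hgeS j hj
      _ ≤ ∑ j : Fin p, q + ∑ j, (exceedProb z (contrast θ t j) - q) := by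
          gcongr
          · exact fun j _ _ => sub_nonneg.2 (hge j)
          · exact Finset.subset_univ S
      _ = _ := by rw [← Finset.sum_add_distrib]; simp
  have hpq : 0 ≤ (p : ℝ) * q := by positivity
  have hchern := measureReal_countIn_lt_le (fun j => gaussianReal (contrast θ t j) 1)
    (measurableSet_levelSet q) (μ₀ := p * q + X) (d := X / 2) (by linarith) (by linarith)
    (by linarith) hmean
  refine (measureReal_mono fun y hy => ?_).trans (hchern.trans (le_of_eq ?_))
  · by_contra hN
    have hN' : p * q + X / 2 < (countIn (levelSet q) y : ℝ) := by
      have := not_le.1 (show ¬ ((countIn (levelSet q) y : ℝ) ≤ p * q + X - X / 2) from hN)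
      linarith
    exact absurd hy (not_le.2 (hthr _ (countIn_le _ _) hN'))
  · congr 2; field_simp; norm_num

/-- The Hellinger bound converts an excess count into divergence. -/
lemma le_mul_bernoulliKL_of_excess {p N : ℕ} (hp : 0 < p) (hN : N ≤ p) {q X B : ℝ} (hq0 : 0 < q)
    (hq1 : q < 1) (hB : 0 ≤ B) (hXB : B ≤ X) (hX2 : B * (p * q) ≤ X ^ 2)
    (hcount : p * q + X / 2 < N) : B / 24 ≤ p * bernoulliKL (N / p) q := by
  have hp' : (0 : ℝ) < p := by exact_mod_cast hp
  have hx1 : (N / p : ℝ) ≤ 1 := by rw [div_le_one hp']; exact_mod_cast hN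
  have h := sq_sqrt_sub_sqrt_le_bernoulliKL (x := N / p) (by positivity) hx1 hq0 hq1
  refine le_trans ?_ (mul_le_mul_of_nonneg_left h hp'.le)
  have heq : (p : ℝ) * (√(N / p) - √q) ^ 2 = (√N - √(p * q)) ^ 2 := by
    rw [Real.sqrt_div (by positivity), Real.sqrt_mul hp'.le]
    have : √(p : ℝ) ^ 2 = p := Real.sq_sqrt hp'.le
    have h0 : √(p : ℝ) ≠ 0 := (Real.sqrt_pos.2 hp').ne'
    field_simp
    rw [this]
  rw [heq]
  have hX : 0 ≤ X := hB.trans hXB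
  have hQ0 : 0 ≤ (p : ℝ) * q := by positivity
  set Q := (p : ℝ) * q with hQ
  have hsQ := Real.sq_sqrt hQ0
  have hsB := Real.sq_sqrt (show 0 ≤ B / 24 by positivity)
  have hcross : √Q * √(B / 24) ≤ 0.21 * X := by
    rw [← Real.sqrt_mul hQ0]
    apply Real.sqrt_le_iff.2
    constructor
    · linarith
    · nlinarith [sq_nonneg X]
  -- squaring leaves `2 * 0.21 * X + X / 24 ≤ X / 2`
  have hroot : √Q + √(B / 24) ≤ √N := by
    apply Real.le_sqrt_of_sq_le
    nlinarith
  have h0 : 0 ≤ √(B / 24) := Real.sqrt_nonneg _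
  calc B / 24 = √(B / 24) ^ 2 := hsB.symm
    _ ≤ (√N - √Q) ^ 2 := by
        apply pow_le_pow_left₀ h0; linarith

/-! ### Asymptotic power -/

section Power

variable {a β : ℝ} {n s : ℕ → ℕ}

lemma eventually_rpow_le_mul_rpow {x y C : ℝ} (hxy : x < y) (hC : 0 < C) :
    ∀ᶠ p : ℕ in atTop, (p : ℝ) ^ x ≤ C * (p : ℝ) ^ y := by
  filter_upwards [(tendsto_natCast_rpow (sub_pos.2 hxy)).eventually_ge_atTop C⁻¹,
    eventually_ge_atTop 1] with p hp hp1
  have hp0 : (0 : ℝ) < p := by exact_mod_cast hp1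
  rw [show y = x + (y - x) by ring, Real.rpow_add hp0]
  have hpos : 0 < (p : ℝ) ^ x := Real.rpow_pos_of_pos hp0 _
  have : 1 ≤ C * (p : ℝ) ^ (y - x) := by
    rw [inv_le_iff_one_le_mul₀ hC] at hp; linarith
  nlinarith

lemma eventually_log_le_rpow {x C : ℝ} (hx : 0 < x) (hC : 0 < C) :
    ∀ᶠ p : ℕ in atTop, Real.log p ≤ C * (p : ℝ) ^ x := by
  have h := (isLittleO_log_rpow_atTop hx).def hC
  filter_upwards [tendsto_natCast_atTop_atTop.eventually h, eventually_ge_atTop 1] with p hp hp1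
  rw [Real.norm_of_nonneg (Real.log_nonneg (by exact_mod_cast hp1)),
    Real.norm_of_nonneg (by positivity)] at hp
  exact hp

/-- The rejection threshold is of order `p ^ (a + o(1))`. -/
lemma Calibrated.threshold_lt (ha : 0 < a) (h : Calibrated a β n s) (γ : ℝ) {b C : ℝ} (hb : a < b)
    (hC : 0 < C) : ∀ᶠ p : ℕ in atTop,
      2 * (2 + γ) * Real.log p + 2 * Real.log ((grid (n p)).card : ℝ) < C * (p : ℝ) ^ b := by
  have hε : 0 < (b - a) / 2 := by linarith
  filter_upwards [h.loglog_bounds ha hε, (h.tendsto_loglog ha).eventually_ge_atTop 4,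
    eventually_rpow_le_mul_rpow (show a + (b - a) / 2 < b by linarith)
      (show 0 < C / 16 by positivity),
    eventually_log_le_rpow (show 0 < b by linarith) (show 0 < C / (4 * |2 + γ| + 1) by positivity),
    eventually_ge_atTop 1]
    with p h1 h2 h3 h4 hp1
  have h5 := log_grid_card_le h2
  have hpos : 0 < (p : ℝ) ^ b := Real.rpow_pos_of_pos (by exact_mod_cast hp1) _
  have hlog : 0 ≤ Real.log p := Real.log_nonneg (by exact_mod_cast hp1)
  have h6 : 2 * (2 + γ) * Real.log p ≤ C / 2 * (p : ℝ) ^ b := by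
    calc 2 * (2 + γ) * Real.log p ≤ 2 * |2 + γ| * Real.log p := by
          gcongr; exact le_abs_self _
      _ ≤ 2 * |2 + γ| * (C / (4 * |2 + γ| + 1) * (p : ℝ) ^ b) := by gcongr
      _ = (4 * |2 + γ|) / (4 * |2 + γ| + 1) * (C / 2 * (p : ℝ) ^ b) := by field_simp; ring
      _ ≤ 1 * (C / 2 * (p : ℝ) ^ b) := by
          gcongr; rw [div_le_one (by positivity)]; linarith
      _ = _ := one_mul _
  have : 0 < C * (p : ℝ) ^ b := by positivity
  linarith [h1.2]

/-- The Type II error of the test vanishes uniformly over the alternatives. -/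
def Powerful (γ : ℝ) (n s : ℕ → ℕ) (ρ : ℕ → ℝ) : Prop :=
  ∃ e : ℕ → ℝ, Tendsto e atTop (𝓝 0) ∧ ∀ᶠ p : ℕ in atTop,
    ∀ θ ∈ altSpace p (n p) (ρ p) (s p), ∫ x, (1 - pbjTest γ p (n p) x) ∂(law θ) ≤ e p

lemma tendsto_exp_neg_mul_rpow {c x : ℝ} (hc : 0 < c) (hx : 0 < x) :
    Tendsto (fun p : ℕ => Real.exp (-(c * (p : ℝ) ^ x))) atTop (𝓝 0) :=
  Real.tendsto_exp_neg_atTop_nhds_zero.comp ((tendsto_natCast_rpow hx).const_mul_atTop hc)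

/-- Power when the mean excess count `p ^ x` exceeds both `p ^ a` and `p ^ (a / 2)` times the
standard deviation `p ^ (y / 2)` of the null count. -/
lemma powerful_of_excess (ha : 0 < a) (h : Calibrated a β n s) (γ : ℝ) {ρ z m : ℕ → ℝ}
    {x y c C : ℝ} (hx : a < x) (hxy : a < 2 * x - y) (hc : 0 < c) (hC : 0 < C)
    (hev : ∀ᶠ p : ℕ in atTop, 0 < z p ∧ 0 ≤ m p ∧
      m p ≤ ρ p * (1 - 2 / Real.log (Real.log (n p))) ∧
      c * (p : ℝ) ^ x ≤ s p * (exceedProb (z p) (m p) - 2 * gaussianTail (z p)) ∧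
      p * (2 * gaussianTail (z p)) ≤ C * (p : ℝ) ^ y) : Powerful γ n s ρ := by
  obtain ⟨b, hab, hb⟩ := exists_between (lt_min hx hxy)
  have hbx : b < x := hb.trans_le (min_le_left _ _)
  have hbxy : b < 2 * x - y := hb.trans_le (min_le_right _ _)
  refine ⟨_, tendsto_exp_neg_mul_rpow (show (0 : ℝ) < 1 / 32 by norm_num)
    (show 0 < b by linarith), ?_⟩
  filter_upwards [hev, h.threshold_lt ha γ hab (show (0 : ℝ) < 1 / 24 by norm_num),
    (h.tendsto_loglog ha).eventually_ge_atTop 4, eventually_ge_atTop 1,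
    eventually_rpow_le_mul_rpow hbx hc,
    eventually_rpow_le_mul_rpow (show b + y < 2 * x by linarith)
      (show 0 < c ^ 2 / C by positivity)]
    with p ⟨hz, hm0, hm, hX, hq⟩ hthr hl hp1 hb1 hb2 θ hθ
  have hp0 : (0 : ℝ) < p := by exact_mod_cast hp1
  set X := c * (p : ℝ) ^ x with hXdef
  set B := (p : ℝ) ^ b with hB
  have hB0 : 0 < B := Real.rpow_pos_of_pos hp0 _
  have hX0 : 0 < X := by linarith
  have hX2 : B * (p * (2 * gaussianTail (z p))) ≤ X ^ 2 := by
    calc B * (p * (2 * gaussianTail (z p))) ≤ B * (C * (p : ℝ) ^ y) := by gcongr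
      _ = C * (p : ℝ) ^ (b + y) := by rw [Real.rpow_add hp0]; ring
      _ ≤ C * (c ^ 2 / C * (p : ℝ) ^ (2 * x)) := by gcongr
      _ = X ^ 2 := by
          rw [hXdef, mul_pow, two_mul, Real.rpow_add hp0]; field_simp
  have hq0 : 0 < 2 * gaussianTail (z p) := by have := gaussianTail_pos (z p); linarith
  have hq1 : 2 * gaussianTail (z p) < 1 := by
    have := strictAnti_gaussianTail hz
    rw [gaussianTail_zero] at this; linarith
  refine (integral_one_sub_pbjTest_alt_le hl hz hm0 hm hX0 hX (fun N hN hcount => ?_) hθ).trans ?_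
  · have := le_mul_bernoulliKL_of_excess hp1 hN hq0 hq1 hB0.le hb1 hX2 hcount
    linarith
  · apply Real.exp_le_exp.2
    rw [neg_le_neg_iff, le_div_iff₀ (by positivity)]
    nlinarith

/-- Convergence of the worst-case error of the test, given uniform power. -/
lemma tendsto_worstCaseError_pbjTest (ha : 0 < a) (h : Calibrated a β n s) {γ : ℝ} (hγ : 0 < γ)
    {ρ : ℕ → ℝ} (hpow : Powerful γ n s ρ) :
    Tendsto (fun p : ℕ => worstCaseError (pbjTest γ p (n p)) (ρ p) (s p)) atTop (𝓝 0) := by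
  obtain ⟨e, he, hev⟩ := hpow
  have hlim : Tendsto (fun p : ℕ => 4 / (p : ℝ) + max (e p) 0) atTop (𝓝 0) := by
    have h1 : Tendsto (fun p : ℕ => 4 / (p : ℝ)) atTop (𝓝 0) :=
      tendsto_const_div_atTop_nhds_zero_nat 4
    have h2 := he.max (tendsto_const_nhds (x := (0 : ℝ)))
    simpa using h1.add h2
  refine tendsto_of_tendsto_of_tendsto_of_le_of_le' tendsto_const_nhds hlim ?_ ?_
  · refine Eventually.of_forall fun p => ?_
    have h01 : ∀ x, 0 ≤ pbjTest γ p (n p) x ∧ pbjTest γ p (n p) x ≤ 1 := fun x => by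
      rcases pbjTest_eq_one_or_zero γ x with h | h <;> rw [h] <;> norm_num
    refine add_nonneg (Real.iSup_nonneg fun θ => integral_nonneg fun x => (h01 x).1)
      (Real.iSup_nonneg fun θ => integral_nonneg fun x => sub_nonneg.2 (h01 x).2)
  · filter_upwards [hev, (h.tendsto_loglog ha).eventually_gt_atTop 0, eventually_ge_atTop 1]
      with p hp hl hp1
    refine add_le_add (Real.iSup_le (fun θ => ?_) (by positivity))
      (Real.iSup_le (fun θ => (hp θ.1 θ.2).trans (le_max_left _ _)) (le_max_right _ _))
    exact integral_pbjTest_null_le hγ hp1 (fun t ht => grid_bounds hl ht) grid_card_pos θ.2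

/-! ### The four regimes of the upper bound -/

lemma eventually_one_sub_le_attenuation (ha : 0 < a) (h : Calibrated a β n s) {η : ℝ} (hη : 0 < η) :
    ∀ᶠ p : ℕ in atTop, 1 - η ≤ 1 - 2 / Real.log (Real.log (n p)) := by
  filter_upwards [(h.tendsto_loglog ha).eventually_ge_atTop (2 / η),
    (h.tendsto_loglog ha).eventually_gt_atTop 0] with p hp hp0
  rw [div_le_iff₀ hη] at hp
  have : 2 / Real.log (Real.log (n p)) ≤ η := by rw [div_le_iff₀ hp0]; linarith
  linarith

/-- Weak dense signals: all rows are compared with the fixed critical value `1`. -/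
lemma powerful_dense (ha : 0 < a) (h : Calibrated a β n s) (γ : ℝ) {β₁ : ℝ} (hβ : β < β₁)
    (hβ0 : 0 < β₁) (hreg : a ≤ 1 - 2 * β₁) {ρ : ℕ → ℝ}
    (hρ : ∀ p, ρ p = √((p : ℝ) ^ ((a - (1 - 2 * β₁)) / 2))) : Powerful γ n s ρ := by
  obtain ⟨c, hc, hcm⟩ := exists_exceedProb_one_ge
  -- the excess count is of order `s ρ ^ 2`, and the null count of order `p`
  refine powerful_of_excess ha h γ (z := fun _ => 1) (m := fun p => ρ p / 2)
    (x := (a + 1) / 2 + (β₁ - β)) (y := 1) (c := c / 8) (C := 1) (by linarith) (by linarith)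
    (by positivity) one_pos ?_
  filter_upwards [eventually_one_sub_le_attenuation ha h (show (0 : ℝ) < 1 / 2 by norm_num), h.sparsity_bounds,
    eventually_ge_atTop 1] with p hl hs hp1
  have hp0 : (0 : ℝ) < p := by exact_mod_cast hp1
  have hρ0 : 0 ≤ ρ p := by rw [hρ]; positivity
  have hρ2 : ρ p ^ 2 = (p : ℝ) ^ ((a - (1 - 2 * β₁)) / 2) := by
    rw [hρ, Real.sq_sqrt (by positivity)]
  have hρ1 : ρ p ≤ 1 := by
    rw [hρ]
    refine Real.sqrt_le_one.2 ?_
    exact Real.rpow_le_one_of_one_le_of_nonpos (by exact_mod_cast hp1) (by linarith)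
  refine ⟨one_pos, by positivity, by nlinarith, ?_, ?_⟩
  · have h1 := hcm (ρ p / 2) ⟨by positivity, by linarith⟩
    rw [exceedProb_zero zero_le_one] at h1
    calc c / 8 * (p : ℝ) ^ ((a + 1) / 2 + (β₁ - β)) =
          (p : ℝ) ^ (1 - β) / 2 * (c * ((ρ p) ^ 2 / 4)) := by
            rw [hρ2, show (a + 1) / 2 + (β₁ - β) = (1 - β) + (a - (1 - 2 * β₁)) / 2 by ring,
              Real.rpow_add hp0]; ring
      _ ≤ s p * (exceedProb 1 (ρ p / 2) - 2 * gaussianTail 1) := by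
            have : c * ((ρ p) ^ 2 / 4) ≤ exceedProb 1 (ρ p / 2) - 2 * gaussianTail 1 := by
              nlinarith
            exact mul_le_mul hs.1 this (by positivity) (by positivity)
  · rw [Real.rpow_one, one_mul]
    have : 2 * gaussianTail 1 ≤ 1 := by
      rw [← exceedProb_zero zero_le_one]; exact exceedProb_le_one _ _
    nlinarith

lemma tendsto_sqrt_two_mul_log : Tendsto (fun p : ℕ => √(2 * Real.log p)) atTop atTop :=
  Real.tendsto_sqrt_atTop.comp (tendsto_log_natCast.const_mul_atTop two_pos)

/-- Signals on the scale `√(log p)`, of size `u √(2 log p)`, detected at the critical value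
`w √(2 log p)`. -/
lemma powerful_sparse (ha : 0 < a) (h : Calibrated a β n s) (γ : ℝ) {u w : ℝ} (hu : 0 < u)
    (huw : u ≤ w) (h1 : a < 1 - β - (w - u) ^ 2)
    (h2 : a < 2 * (1 - β - (w - u) ^ 2) - (1 - w ^ 2)) {ρ : ℕ → ℝ}
    (hρ : ∀ᶠ p : ℕ in atTop, ρ p = u * √(2 * Real.log p)) : Powerful γ n s ρ := by
  -- exponents with some room: `(w - u) ^ 2 < g ^ 2`
  have hcont : ∀ᶠ g in 𝓝[>] (w - u), a < 1 - β - g ^ 2 ∧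
      a < 2 * (1 - β - g ^ 2) - (1 - w ^ 2) ∧ g < w := by
    refine nhdsWithin_le_nhds ((Tendsto.eventually_const_lt h1 ?_).and
      ((Tendsto.eventually_const_lt h2 ?_).and (gt_mem_nhds (by linarith))))
    · exact Continuous.tendsto (f := fun g : ℝ => 1 - β - g ^ 2) (by fun_prop) (w - u)
    · exact Continuous.tendsto (f := fun g : ℝ => 2 * (1 - β - g ^ 2) - (1 - w ^ 2))
        (by fun_prop) (w - u)
  obtain ⟨g, ⟨hg1, hg2, hgw⟩, hg⟩ := (hcont.and self_mem_nhdsWithin).exists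
  -- the attenuation `η` of the signal at the grid keeps `w - (1 - η) u` below `g`
  set η := min (1 / 2) ((g - (w - u)) / (2 * u)) with hη
  have hη0 : 0 < η := lt_min (by norm_num) (div_pos (by linarith) (by linarith))
  have hη1 : η ≤ 1 / 2 := min_le_left _ _
  have hηu : η * u ≤ (g - (w - u)) / 2 := by
    calc η * u ≤ (g - (w - u)) / (2 * u) * u := by gcongr; exact min_le_right _ _
      _ = _ := by field_simp
  set α := w - (1 - η) * u with hα
  have hα0 : 0 ≤ α := by nlinarith
  have hαg : α < g := by nlinarith
  refine powerful_of_excess ha h γ (z := fun p => w * √(2 * Real.log p))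
    (m := fun p => (1 - η) * u * √(2 * Real.log p)) (x := 1 - β - g ^ 2) (y := 1 - w ^ 2)
    (c := 1 / 4) (C := 2) hg1 hg2 (by norm_num) two_pos ?_
  -- the polynomial term dominates in the exponent of the Gaussian density
  have hquad : ∀ᶠ p : ℕ in atTop, (α * √(2 * Real.log p) + 1) ^ 2 + Real.log (2 * Real.pi) ≤
      (g * √(2 * Real.log p)) ^ 2 := by
    have hd : 0 < g - α := by linarith
    have hg0 : 0 < g := by linarith
    filter_upwards [tendsto_sqrt_two_mul_log.eventually_ge_atTop
      ((1 + Real.log (2 * Real.pi)) / (g - α)), tendsto_sqrt_two_mul_log.eventually_ge_atTop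
      (1 / g), tendsto_sqrt_two_mul_log.eventually_ge_atTop 1] with p hp hp' hp1
    set Λ := √(2 * Real.log p)
    rw [div_le_iff₀ hd] at hp
    rw [div_le_iff₀ hg0] at hp'
    have hlogpi : 0 ≤ Real.log (2 * Real.pi) :=
      Real.log_nonneg (by linarith [Real.pi_gt_three])
    have h3 : α * Λ + 1 + Real.log (2 * Real.pi) ≤ g * Λ := by nlinarith
    have h4 : 0 ≤ α * Λ := by positivity
    nlinarith
  filter_upwards [hρ, hquad, eventually_one_sub_le_attenuation ha h hη0, h.sparsity_bounds,
    tendsto_sqrt_two_mul_log.eventually_gt_atTop 0, eventually_ge_atTop 1,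
    eventually_rpow_le_mul_rpow (show -w ^ 2 < -g ^ 2 by nlinarith)
      (show (0 : ℝ) < 1 / 4 by norm_num)]
    with p hρp hq hl hs hΛ hp1 hwg
  have hp0 : (0 : ℝ) < p := by exact_mod_cast hp1
  have hlog : 0 ≤ Real.log p := Real.log_nonneg (by exact_mod_cast hp1)
  set Λ := √(2 * Real.log p) with hΛdef
  have hΛ2 : Λ ^ 2 = 2 * Real.log p := Real.sq_sqrt (by positivity)
  have hw : 0 < w := by linarith
  have hpow : ∀ v : ℝ, (p : ℝ) ^ (-v ^ 2) = Real.exp (-(v * Λ) ^ 2 / 2) := fun v => by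
    rw [rpow_eq_exp_log hp1, mul_pow, hΛ2]; congr 1; ring
  have htail : gaussianTail (w * Λ) ≤ (p : ℝ) ^ (-w ^ 2) := by
    rw [hpow]; exact gaussianTail_le_exp (by positivity)
  have hsig : (p : ℝ) ^ (-g ^ 2) ≤ exceedProb (w * Λ) ((1 - η) * u * Λ) := by
    refine le_trans ?_ (gaussianTail_sub_le_exceedProb (by positivity) _)
    rw [show w * Λ - (1 - η) * u * Λ = α * Λ by rw [hα]; ring]
    refine le_trans ?_ (le_gaussianTail (by positivity))
    rw [gaussianPDFReal_std, hpow,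
      ← Real.exp_log (show 0 < (√(2 * Real.pi))⁻¹ by positivity), ← Real.exp_add]
    apply Real.exp_le_exp.2
    rw [Real.log_inv, Real.log_sqrt (by positivity)]
    linarith
  refine ⟨by positivity, ?_, ?_, ?_, ?_⟩
  · have : 0 ≤ 1 - η := by linarith
    positivity
  · rw [hρp]
    calc (1 - η) * u * Λ = u * Λ * (1 - η) := by ring
      _ ≤ _ := by gcongr
  · calc 1 / 4 * (p : ℝ) ^ (1 - β - g ^ 2) = (p : ℝ) ^ (1 - β) / 2 * ((p : ℝ) ^ (-g ^ 2) / 2) := by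
          rw [show 1 - β - g ^ 2 = (1 - β) + (-g ^ 2) by ring, Real.rpow_add hp0]; ring
      _ ≤ _ := by
          refine mul_le_mul hs.1 ?_ (by positivity) (by positivity)
          linarith
  · calc p * (2 * gaussianTail (w * Λ)) ≤ p * (2 * (p : ℝ) ^ (-w ^ 2)) := by gcongr
      _ = 2 * (p : ℝ) ^ (1 - w ^ 2) := by
          rw [show 1 - w ^ 2 = 1 + (-w ^ 2) by ring, Real.rpow_add hp0, Real.rpow_one]; ring

/-- Signals of polynomial size: here the logarithm in the divergence is of the order of the squared
signal. -/
lemma powerful_strong (ha : 0 < a) (h : Calibrated a β n s) (γ : ℝ) {β₁ : ℝ} (hβ : β < β₁)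
    (hβ0 : β < 1) (hreg : 1 - β₁ < a) {ρ : ℕ → ℝ}
    (hρ : ∀ p, ρ p = √((p : ℝ) ^ (a - (1 - β₁)))) : Powerful γ n s ρ := by
  refine ⟨_, tendsto_exp_neg_mul_rpow (show (0 : ℝ) < 1 / 256 by norm_num)
    (show 0 < 1 - β by linarith), ?_⟩
  filter_upwards [(h.tendsto_loglog ha).eventually_ge_atTop 4, h.sparsity_bounds,
    h.threshold_lt ha γ (show a < a + (β₁ - β) by linarith)
      (show (0 : ℝ) < 1 / 256 by norm_num), eventually_ge_atTop 1,
    (tendsto_natCast_rpow (show 0 < 1 - β by linarith)).eventually_ge_atTop 16,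
    (tendsto_natCast_rpow (show 0 < a - (1 - β₁) by linarith)).eventually_ge_atTop
      (32 * (Real.log 8 + 1)),
    eventually_log_le_rpow (show 0 < a - (1 - β₁) by linarith)
      (show (0 : ℝ) < 1 / 32 by norm_num)] with p hl hs hthr hp1 hs16 hρbig hlogρ θ hθ
  have hp0 : (0 : ℝ) < p := by exact_mod_cast hp1
  have hlog : 0 ≤ Real.log p := Real.log_nonneg (by exact_mod_cast hp1)
  set R := (p : ℝ) ^ (a - (1 - β₁)) with hR
  have hlog8 : 0 < Real.log 8 := Real.log_pos (by norm_num)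
  have hR0 : 0 < R := by linarith
  have hρ0 : 0 < ρ p := by rw [hρ]; exact Real.sqrt_pos.2 hR0
  have hρ2 : ρ p ^ 2 = R := by rw [hρ, Real.sq_sqrt hR0.le]
  have hq : 2 * gaussianTail (ρ p / 2) ≤ 2 * Real.exp (-R / 8) := by
    have := gaussianTail_le_exp (z := ρ p / 2) (by positivity)
    rw [show -(ρ p / 2) ^ 2 / 2 = -R / 8 by rw [← hρ2]; ring] at this
    linarith
  set q := 2 * gaussianTail (ρ p / 2) with hqdef
  have hq0 : 0 < q := by have := gaussianTail_pos (ρ p / 2); linarith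
  have hq1 : q < 1 := by
    have := strictAnti_gaussianTail (show 0 < ρ p / 2 by positivity)
    rw [gaussianTail_zero] at this; linarith
  have hexp : Real.exp (-R / 8) ≤ 1 / 8 / p * Real.exp (-R / 16 - 1) := by
    rw [show (1 / 8 / (p : ℝ)) = Real.exp (-Real.log 8 - Real.log p) by
      rw [Real.exp_sub, Real.exp_neg, Real.exp_log (by norm_num), Real.exp_log hp0]; norm_num,
      ← Real.exp_add]
    apply Real.exp_le_exp.2
    linarith
  -- the null count is exponentially small, so `log (N / (p q))` is at least `R / 16`
  have hpq : p * q ≤ 1 / 4 * Real.exp (-R / 16 - 1) := by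
    calc p * q ≤ p * (2 * (1 / 8 / p * Real.exp (-R / 16 - 1))) := by gcongr; linarith
      _ = _ := by field_simp; norm_num
  have hexp1 : Real.exp (-R / 16 - 1) ≤ 1 := Real.exp_le_one_iff.2 (by linarith)
  have hq4 : q ≤ 1 / 4 := by
    have : (1 : ℝ) ≤ p := by exact_mod_cast hp1
    nlinarith
  have hsig : 1 / 2 ≤ exceedProb (ρ p / 2) (ρ p / 2) := by
    have := gaussianTail_sub_le_exceedProb (show 0 ≤ ρ p / 2 by positivity) (ρ p / 2)
    rwa [sub_self, gaussianTail_zero] at this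
  set X := (p : ℝ) ^ (1 - β) / 8 with hX
  have hX2 : 2 ≤ X := by linarith
  refine (integral_one_sub_pbjTest_alt_le hl (z := ρ p / 2) (m := ρ p / 2) (X := X)
    (by positivity) (by positivity) ?_ (by linarith) ?_ (fun N hN hcount => ?_) hθ).trans ?_
  · have : 2 / Real.log (Real.log (n p)) ≤ 2 / 4 := by gcongr
    nlinarith
  · calc X = (p : ℝ) ^ (1 - β) / 2 * (1 / 4) := by rw [hX]; ring
      _ ≤ _ := mul_le_mul hs.1 (by linarith) (by norm_num) (by positivity)
  · rw [← hqdef] at hcount ⊢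
    have hpq0 : 0 < p * q := by positivity
    have hN1 : 1 ≤ (N : ℝ) := by linarith
    have hx1 : (N / p : ℝ) ≤ 1 := by rw [div_le_one hp0]; exact_mod_cast hN
    have hKL := mul_log_sub_le_bernoulliKL hx1 hq1
    have hlogN : R / 16 + 1 ≤ Real.log ((N / p : ℝ) / q) := by
      rw [div_div, Real.le_log_iff_exp_le (by positivity), le_div_iff₀ hpq0]
      calc Real.exp (R / 16 + 1) * (p * q) ≤
          Real.exp (R / 16 + 1) * (1 / 4 * Real.exp (-R / 16 - 1)) := by gcongr
        _ = 1 / 4 := by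
            rw [mul_left_comm, ← Real.exp_add,
              show R / 16 + 1 + (-R / 16 - 1) = 0 by ring, Real.exp_zero, mul_one]
        _ ≤ N := by linarith
    calc _ < 1 / 256 * (p : ℝ) ^ (a + (β₁ - β)) := hthr
      _ = X / 2 * (R / 16) := by
          rw [hX, hR, show a + (β₁ - β) = (1 - β) + (a - (1 - β₁)) by ring, Real.rpow_add hp0]
          ring
      _ ≤ N * (R / 16) := by gcongr; linarith
      _ = p * ((N / p : ℝ) * (R / 16)) := by field_simp
      _ ≤ p * ((N / p : ℝ) * Real.log ((N / p : ℝ) / q) - N / p + q) := by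
          gcongr
          have : 0 ≤ (N / p : ℝ) := by positivity
          nlinarith
      _ ≤ _ := by gcongr
  · apply Real.exp_le_exp.2
    rw [← hqdef, neg_le_neg_iff, le_div_iff₀ (by positivity)]
    nlinarith

/-- Above the detection boundary the test is uniformly powerful. -/
lemma powerful_boundary (ha : 0 < a) (h : Calibrated a β n s) (γ : ℝ) {β₁ : ℝ}
    (hβ₁ : β₁ ∈ Set.Ioo (0 : ℝ) 1) (hβ : β < β₁) : Powerful γ n s (boundary a β₁) := by
  obtain ⟨hβ0, hβ1⟩ := hβ₁
  by_cases hI : a ≤ 1 - 2 * β₁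
  · exact powerful_dense ha h γ hβ hβ0 hI fun p => by rw [boundary, boundarySq, if_pos hI]
  by_cases hII : a ≤ 1 - 4 * β₁ / 3
  · rw [not_le] at hI
    set u := √((a - (1 - 2 * β₁)) / 2) with hu
    have hu2 : u ^ 2 = (a - (1 - 2 * β₁)) / 2 := Real.sq_sqrt (by linarith)
    have hu0 : 0 < u := Real.sqrt_pos.2 (by linarith)
    -- `w = 2 u` maximizes the exponent `2 (1 - β - (w - u) ^ 2) - (1 - w ^ 2)`
    refine powerful_sparse ha h γ (u := u) (w := 2 * u) hu0 (by linarith) ?_ ?_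
      (Eventually.of_forall fun p => ?_)
    · rw [show (2 * u - u) ^ 2 = u ^ 2 by ring, hu2]; linarith
    · rw [show (2 * u - u) ^ 2 = u ^ 2 by ring, show (2 * u) ^ 2 = 4 * u ^ 2 by ring, hu2]
      linarith
    · rw [boundary, boundarySq, if_neg (not_le.2 hI), if_pos hII, hu, ← Real.sqrt_mul (by linarith)]
      congr 1; ring
  by_cases hIII : a ≤ 1 - β₁
  · rw [not_le] at hI hII
    have hA := Real.sq_sqrt (show 0 ≤ 1 - a by linarith)
    have hB := Real.sq_sqrt (show 0 ≤ 1 - a - β₁ by linarith)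
    have hlt : √(1 - a - β₁) < √(1 - a) :=
      Real.sqrt_lt_sqrt (by linarith) (by linarith)
    -- at this critical value the null count is of the order `p ^ a` of the rejection threshold
    refine powerful_sparse ha h γ (u := √(1 - a) - √(1 - a - β₁)) (w := √(1 - a)) (by linarith)
      (by linarith [Real.sqrt_nonneg (1 - a - β₁)]) ?_ ?_ (Eventually.of_forall fun p => ?_)
    · rw [sub_sub_cancel, hB]; linarith
    · rw [sub_sub_cancel, hB, hA]; linarith
    · rw [boundary, boundarySq, if_neg (not_le.2 hI), if_neg (not_le.2 hII), if_pos hIII,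
        mul_comm (2 : ℝ), mul_assoc, Real.sqrt_mul (sq_nonneg _), Real.sqrt_sq (by linarith)]
  · refine powerful_strong ha h γ hβ (by linarith) (not_le.1 hIII) fun p => ?_
    rw [boundary, boundarySq, if_neg hI, if_neg hII, if_neg hIII]

end Power

/-! ### Likelihood ratios of symmetric row signals -/

/-- The likelihood ratio against pure noise of a row whose mean is `± ρ` times the contrast
direction at `t`, with a uniformly random sign. -/
def signLR (n : ℕ) (ρ : ℝ) (t : ℕ) (y : Fin n → ℝ) : ℝ :=
  Real.exp (-ρ ^ 2 / 2) * Real.cosh (ρ * ∑ i, stepVec n t i * y i)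

/-- The likelihood ratio of a row that carries such a signal with probability `ε`. -/
def rowLR (n : ℕ) (ε ρ : ℝ) (t : ℕ) (y : Fin n → ℝ) : ℝ := 1 - ε + ε * signLR n ρ t y

section Row

variable {n : ℕ} {ε ρ : ℝ} {t t' : ℕ}

lemma signLR_pos (y : Fin n → ℝ) : 0 < signLR n ρ t y :=
  mul_pos (Real.exp_pos _) (Real.cosh_pos _)

lemma rowLR_pos (h0 : 0 < ε) (h1 : ε ≤ 1) (y : Fin n → ℝ) : 0 < rowLR n ε ρ t y := by
  have := mul_pos h0 (signLR_pos (ρ := ρ) (t := t) y)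
  unfold rowLR; linarith

lemma continuous_signLR : Continuous (signLR n ρ t) := by
  unfold signLR
  exact continuous_const.mul (Real.continuous_cosh.comp (by fun_prop))

lemma continuous_rowLR : Continuous (rowLR n ε ρ t) :=
  continuous_const.add (continuous_const.mul continuous_signLR)

lemma integrable_exp_mul_sum (r : ℝ) : Integrable
    (fun y : Fin n → ℝ => Real.exp (r * ∑ i, stepVec n t i * y i)) (rowLaw (0 : Fin n → ℝ)) := by
  have := integrable_exp_linear (fun i => r * stepVec n t i)
  simpa only [mul_assoc, ← Finset.mul_sum] using this

lemma integral_exp_mul_sum (h1 : 1 ≤ t) (h2 : t < n) (r : ℝ) :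
    ∫ y, Real.exp (r * ∑ i, stepVec n t i * y i) ∂(rowLaw (0 : Fin n → ℝ)) =
      Real.exp (r ^ 2 / 2) := by
  have := integral_exp_linear (fun i => r * stepVec n t i)
  simp only [mul_assoc, ← Finset.mul_sum] at this
  rw [this]
  have hs : ∑ i, stepVec n t i * (r * stepVec n t i) = r * stepCorr n t t := by
    rw [stepCorr, Finset.mul_sum]; exact Finset.sum_congr rfl fun i _ => by ring
  rw [hs, stepCorr_self h1 h2]; congr 1; ring

lemma integrable_exp_mul_sum_add (r r' : ℝ) : Integrable
    (fun y : Fin n → ℝ => Real.exp (r * ∑ i, stepVec n t i * y i + r' * ∑ i, stepVec n t' i * y i))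
    (rowLaw (0 : Fin n → ℝ)) := by
  have := integrable_exp_linear (fun i => r * stepVec n t i + r' * stepVec n t' i)
  simpa only [add_mul, Finset.sum_add_distrib, mul_assoc, ← Finset.mul_sum] using this

lemma integral_exp_mul_sum_add (h1 : 1 ≤ t) (h2 : t < n) (h1' : 1 ≤ t') (h2' : t' < n) (r r' : ℝ) :
    ∫ y, Real.exp (r * ∑ i, stepVec n t i * y i + r' * ∑ i, stepVec n t' i * y i)
      ∂(rowLaw (0 : Fin n → ℝ)) =
      Real.exp ((r ^ 2 + r' ^ 2) / 2 + r * r' * stepCorr n t t') := by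
  have := integral_exp_linear (fun i => r * stepVec n t i + r' * stepVec n t' i)
  simp only [add_mul, Finset.sum_add_distrib, mul_assoc, ← Finset.mul_sum] at this
  rw [this]
  congr 1
  have e1 : ∑ i, stepVec n t i * (r * stepVec n t i + r' * stepVec n t' i) =
      r * stepCorr n t t + r' * stepCorr n t t' := by
    rw [stepCorr, stepCorr, Finset.mul_sum, Finset.mul_sum, ← Finset.sum_add_distrib]
    exact Finset.sum_congr rfl fun i _ => by ring
  have e2 : ∑ i, stepVec n t' i * (r * stepVec n t i + r' * stepVec n t' i) =
      r * stepCorr n t t' + r' * stepCorr n t' t' := by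
    rw [stepCorr, stepCorr, Finset.mul_sum, Finset.mul_sum, ← Finset.sum_add_distrib]
    exact Finset.sum_congr rfl fun i _ => by ring
  rw [e1, e2, stepCorr_self h1 h2, stepCorr_self h1' h2']
  ring

lemma integrable_cosh_mul_sum (r : ℝ) : Integrable
    (fun y : Fin n → ℝ => Real.cosh (r * ∑ i, stepVec n t i * y i)) (rowLaw (0 : Fin n → ℝ)) := by
  have h := ((integrable_exp_mul_sum (n := n) (t := t) r).add
    (integrable_exp_mul_sum (n := n) (t := t) (-r))).div_const 2
  refine h.congr (ae_of_all _ fun y => ?_)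
  simp [Real.cosh_eq]

lemma integral_cosh_mul_sum (h1 : 1 ≤ t) (h2 : t < n) (r : ℝ) :
    ∫ y, Real.cosh (r * ∑ i, stepVec n t i * y i) ∂(rowLaw (0 : Fin n → ℝ)) =
      Real.exp (r ^ 2 / 2) := by
  have : ∀ y : Fin n → ℝ, Real.cosh (r * ∑ i, stepVec n t i * y i) =
      (Real.exp (r * ∑ i, stepVec n t i * y i) + Real.exp (-r * ∑ i, stepVec n t i * y i)) / 2 :=
    fun y => by rw [Real.cosh_eq, neg_mul]
  simp_rw [this]
  rw [integral_div, integral_add (integrable_exp_mul_sum r) (integrable_exp_mul_sum (-r)),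
    integral_exp_mul_sum h1 h2, integral_exp_mul_sum h1 h2]
  ring_nf

lemma integrable_signLR : Integrable (signLR n ρ t) (rowLaw (0 : Fin n → ℝ)) :=
  (integrable_cosh_mul_sum ρ).const_mul _

lemma integral_signLR (h1 : 1 ≤ t) (h2 : t < n) :
    ∫ y, signLR n ρ t y ∂(rowLaw (0 : Fin n → ℝ)) = 1 := by
  unfold signLR
  rw [integral_const_mul, integral_cosh_mul_sum h1 h2, ← Real.exp_add, neg_div, neg_add_cancel,
    Real.exp_zero]

lemma signLR_mul_signLR (y : Fin n → ℝ) : signLR n ρ t y * signLR n ρ t' y =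
    Real.exp (-ρ ^ 2) / 4 *
      (Real.exp (ρ * ∑ i, stepVec n t i * y i + ρ * ∑ i, stepVec n t' i * y i) +
        Real.exp (ρ * ∑ i, stepVec n t i * y i + -ρ * ∑ i, stepVec n t' i * y i) +
        (Real.exp (-ρ * ∑ i, stepVec n t i * y i + ρ * ∑ i, stepVec n t' i * y i) +
        Real.exp (-ρ * ∑ i, stepVec n t i * y i + -ρ * ∑ i, stepVec n t' i * y i))) := by
  unfold signLR
  rw [Real.cosh_eq, Real.cosh_eq, show -ρ ^ 2 = -ρ ^ 2 / 2 + -ρ ^ 2 / 2 by ring]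
  simp only [Real.exp_add, neg_mul]
  ring_nf

lemma integrable_signLR_mul : Integrable (fun y => signLR n ρ t y * signLR n ρ t' y)
    (rowLaw (0 : Fin n → ℝ)) := by
  simp_rw [signLR_mul_signLR]
  exact (((integrable_exp_mul_sum_add _ _).add (integrable_exp_mul_sum_add _ _)).add
    ((integrable_exp_mul_sum_add _ _).add (integrable_exp_mul_sum_add _ _))).const_mul _

lemma integral_signLR_mul (h1 : 1 ≤ t) (h2 : t < n) (h1' : 1 ≤ t') (h2' : t' < n) :
    ∫ y, signLR n ρ t y * signLR n ρ t' y ∂(rowLaw (0 : Fin n → ℝ)) =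
      Real.cosh (ρ ^ 2 * stepCorr n t t') := by
  simp_rw [signLR_mul_signLR]
  rw [integral_const_mul, integral_add ((integrable_exp_mul_sum_add _ _).fun_add
      (integrable_exp_mul_sum_add _ _)) ((integrable_exp_mul_sum_add _ _).fun_add
      (integrable_exp_mul_sum_add _ _)),
    integral_add (integrable_exp_mul_sum_add _ _) (integrable_exp_mul_sum_add _ _),
    integral_add (integrable_exp_mul_sum_add _ _) (integrable_exp_mul_sum_add _ _)]
  simp only [integral_exp_mul_sum_add h1 h2 h1' h2']
  rw [Real.cosh_eq]
  set c := stepCorr n t t'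
  rw [show (ρ ^ 2 + ρ ^ 2) / 2 + ρ * ρ * c = ρ ^ 2 + ρ ^ 2 * c by ring,
    show (ρ ^ 2 + (-ρ) ^ 2) / 2 + ρ * -ρ * c = ρ ^ 2 + -(ρ ^ 2 * c) by ring,
    show ((-ρ) ^ 2 + ρ ^ 2) / 2 + -ρ * ρ * c = ρ ^ 2 + -(ρ ^ 2 * c) by ring,
    show ((-ρ) ^ 2 + (-ρ) ^ 2) / 2 + -ρ * -ρ * c = ρ ^ 2 + ρ ^ 2 * c by ring]
  simp only [Real.exp_add]
  have : Real.exp (-ρ ^ 2) * Real.exp (ρ ^ 2) = 1 := by rw [← Real.exp_add]; simp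
  linear_combination (Real.exp (ρ ^ 2 * c) + Real.exp (-(ρ ^ 2 * c))) / 2 * this

lemma integrable_rowLR : Integrable (rowLR n ε ρ t) (rowLaw (0 : Fin n → ℝ)) :=
  (integrable_const _).add (integrable_signLR.const_mul _)

lemma integral_rowLR (h1 : 1 ≤ t) (h2 : t < n) :
    ∫ y, rowLR n ε ρ t y ∂(rowLaw (0 : Fin n → ℝ)) = 1 := by
  unfold rowLR
  rw [integral_add (integrable_const _) (integrable_signLR.const_mul _), integral_const_mul,
    integral_signLR h1 h2]
  simp

lemma rowLR_mul_rowLR (y : Fin n → ℝ) : rowLR n ε ρ t y * rowLR n ε ρ t' y =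
    ((1 - ε) ^ 2 + (1 - ε) * ε * signLR n ρ t y) +
      ((1 - ε) * ε * signLR n ρ t' y + ε ^ 2 * (signLR n ρ t y * signLR n ρ t' y)) := by
  unfold rowLR; ring

lemma integrable_rowLR_mul : Integrable (fun y => rowLR n ε ρ t y * rowLR n ε ρ t' y)
    (rowLaw (0 : Fin n → ℝ)) := by
  simp_rw [rowLR_mul_rowLR]
  exact ((integrable_const _).add (integrable_signLR.const_mul _)).add
    ((integrable_signLR.const_mul _).add (integrable_signLR_mul.const_mul _))

lemma integral_rowLR_mul (h1 : 1 ≤ t) (h2 : t < n) (h1' : 1 ≤ t') (h2' : t' < n) :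
    ∫ y, rowLR n ε ρ t y * rowLR n ε ρ t' y ∂(rowLaw (0 : Fin n → ℝ)) =
      1 + ε ^ 2 * (Real.cosh (ρ ^ 2 * stepCorr n t t') - 1) := by
  simp_rw [rowLR_mul_rowLR]
  rw [integral_add ((integrable_const _).fun_add (integrable_signLR.const_mul _))
      ((integrable_signLR.const_mul _).fun_add (integrable_signLR_mul.const_mul _)),
    integral_add (integrable_const _) (integrable_signLR.const_mul _),
    integral_add (integrable_signLR.const_mul _) (integrable_signLR_mul.const_mul _),
    integral_const_mul, integral_const_mul, integral_const_mul, integral_signLR h1 h2,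
    integral_signLR h1' h2', integral_signLR_mul h1 h2 h1' h2']
  simp only [integral_const, probReal_univ, one_smul]
  ring

lemma cosh_rpow_le {κ : ℝ} (hκ : 0 ≤ κ) (x : ℝ) :
    Real.cosh x ^ (1 + κ) ≤ Real.cosh ((1 + κ) * x) := by
  have h := (convexOn_rpow (show 1 ≤ 1 + κ by linarith)).2
    (show Real.exp x ∈ Set.Ici 0 from (Real.exp_pos _).le)
    (show Real.exp (-x) ∈ Set.Ici 0 from (Real.exp_pos _).le)
    (show (0 : ℝ) ≤ 1 / 2 by norm_num) (show (0 : ℝ) ≤ 1 / 2 by norm_num) (by norm_num)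
  simp only [smul_eq_mul, ← Real.exp_mul] at h
  rw [Real.cosh_eq, Real.cosh_eq]
  calc ((Real.exp x + Real.exp (-x)) / 2) ^ (1 + κ) =
        (1 / 2 * Real.exp x + 1 / 2 * Real.exp (-x)) ^ (1 + κ) := by congr 1; ring
    _ ≤ _ := h
    _ = _ := by
      rw [show x * (1 + κ) = (1 + κ) * x by ring, show -x * (1 + κ) = -((1 + κ) * x) by ring]; ring

/-- A pointwise bound for the moment of order `1 + κ`: Bernoulli's inequality on the null part of
the mixture, subadditivity of `x ↦ x ^ κ` on the signal part. -/
lemma rowLR_rpow_le {κ : ℝ} (hκ0 : 0 < κ) (hκ1 : κ ≤ 1) (h0 : 0 < ε) (h1 : ε ≤ 1)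
    (y : Fin n → ℝ) : rowLR n ε ρ t y ^ (1 + κ) ≤
      (1 - ε) * (1 + κ * (ε * (signLR n ρ t y - 1))) + ε * signLR n ρ t y +
        ε ^ (1 + κ) * Real.exp (-(1 + κ) * ρ ^ 2 / 2) *
          Real.cosh ((1 + κ) * ρ * ∑ i, stepVec n t i * y i) := by
  set l := signLR n ρ t y with hl
  have hl0 : 0 < l := signLR_pos y
  have hr0 : 0 < rowLR n ε ρ t y := rowLR_pos h0 h1 y
  have hr : rowLR n ε ρ t y = 1 - ε + ε * l := rfl
  have hbern : rowLR n ε ρ t y ^ κ ≤ 1 + κ * (ε * (l - 1)) := by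
    have := rpow_one_add_le_one_add_mul_self (s := ε * (l - 1)) (by nlinarith) hκ0.le hκ1
    rw [hr, show 1 - ε + ε * l = 1 + ε * (l - 1) by ring]
    exact this
  have hsub : rowLR n ε ρ t y ^ κ ≤ 1 + ε ^ κ * l ^ κ := by
    have h2 := Real.rpow_add_le_add_rpow (show 0 ≤ 1 - ε by linarith)
      (show 0 ≤ ε * l by positivity) hκ0.le hκ1
    have h3 : (1 - ε) ^ κ ≤ 1 := Real.rpow_le_one (by linarith) (by linarith) hκ0.le
    rw [Real.mul_rpow h0.le hl0.le] at h2
    rw [hr]; linarith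
  have hlpow : l ^ (1 + κ) ≤ Real.exp (-(1 + κ) * ρ ^ 2 / 2) *
      Real.cosh ((1 + κ) * ρ * ∑ i, stepVec n t i * y i) := by
    rw [hl, signLR, Real.mul_rpow (Real.exp_pos _).le (Real.cosh_pos _).le, ← Real.exp_mul]
    refine mul_le_mul (le_of_eq (by congr 1; ring)) ((cosh_rpow_le hκ0.le _).trans
      (le_of_eq (by congr 1; ring))) (by positivity) (Real.exp_pos _).le
  rw [Real.rpow_add hr0, Real.rpow_one]
  calc rowLR n ε ρ t y * rowLR n ε ρ t y ^ κ
      = (1 - ε) * rowLR n ε ρ t y ^ κ + ε * l * rowLR n ε ρ t y ^ κ := by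
        rw [← add_mul, ← hr]
    _ ≤ (1 - ε) * (1 + κ * (ε * (l - 1))) + ε * l * (1 + ε ^ κ * l ^ κ) := by
        have : 0 ≤ 1 - ε := by linarith
        gcongr
    _ = (1 - ε) * (1 + κ * (ε * (l - 1))) + ε * l + ε ^ (1 + κ) * l ^ (1 + κ) := by
        rw [Real.rpow_add h0, Real.rpow_add hl0, Real.rpow_one, Real.rpow_one]; ring
    _ ≤ _ := by
        rw [mul_assoc (ε ^ (1 + κ))]
        gcongr

lemma integrable_rowLR_rpow {κ : ℝ} (hκ0 : 0 < κ) (hκ1 : κ ≤ 1) (h0 : 0 < ε) (h1 : ε ≤ 1) :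
    Integrable (fun y => rowLR n ε ρ t y ^ (1 + κ)) (rowLaw (0 : Fin n → ℝ)) := by
  have hint : Integrable (fun y : Fin n → ℝ =>
      (1 - ε) * (1 + κ * (ε * (signLR n ρ t y - 1))) + ε * signLR n ρ t y +
        ε ^ (1 + κ) * Real.exp (-(1 + κ) * ρ ^ 2 / 2) *
          Real.cosh ((1 + κ) * ρ * ∑ i, stepVec n t i * y i)) (rowLaw (0 : Fin n → ℝ)) :=
    (((((integrable_const _).add (((integrable_signLR.sub (integrable_const _)).const_mul _).const_mul
      _)).const_mul _)).add (integrable_signLR.const_mul _)).add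
      ((integrable_cosh_mul_sum _).const_mul _)
  refine hint.mono' ?_ (ae_of_all _ fun y => ?_)
  · exact (continuous_rowLR.rpow_const fun y => Or.inl (rowLR_pos h0 h1 y).ne').aestronglyMeasurable
  · rw [Real.norm_of_nonneg (Real.rpow_nonneg (rowLR_pos h0 h1 y).le _)]
    exact rowLR_rpow_le hκ0 hκ1 h0 h1 y

lemma integral_rowLR_rpow_le {κ : ℝ} (hκ0 : 0 < κ) (hκ1 : κ ≤ 1) (h0 : 0 < ε) (h1 : ε ≤ 1)
    (ht1 : 1 ≤ t) (ht2 : t < n) : ∫ y, rowLR n ε ρ t y ^ (1 + κ) ∂(rowLaw (0 : Fin n → ℝ)) ≤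
      1 + ε ^ (1 + κ) * Real.exp (κ * (1 + κ) * ρ ^ 2 / 2) := by
  have i1 : Integrable (fun y : Fin n → ℝ => (1 - ε) * (1 + κ * (ε * (signLR n ρ t y - 1))))
      (rowLaw (0 : Fin n → ℝ)) :=
    ((integrable_const _).add (((integrable_signLR.sub (integrable_const _)).const_mul _).const_mul
      _)).const_mul _
  have i2 : Integrable (fun y : Fin n → ℝ => ε * signLR n ρ t y) (rowLaw (0 : Fin n → ℝ)) :=
    integrable_signLR.const_mul _
  have i3 : Integrable (fun y : Fin n → ℝ => ε ^ (1 + κ) * Real.exp (-(1 + κ) * ρ ^ 2 / 2) *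
      Real.cosh ((1 + κ) * ρ * ∑ i, stepVec n t i * y i)) (rowLaw (0 : Fin n → ℝ)) :=
    (integrable_cosh_mul_sum _).const_mul _
  have i4 : Integrable (fun y : Fin n → ℝ => signLR n ρ t y - 1) (rowLaw (0 : Fin n → ℝ)) :=
    integrable_signLR.sub (integrable_const _)
  refine (integral_mono (integrable_rowLR_rpow hκ0 hκ1 h0 h1) ((i1.add i2).add i3)
    fun y => rowLR_rpow_le hκ0 hκ1 h0 h1 y).trans (le_of_eq ?_)
  simp only [Pi.add_apply]
  rw [integral_add (i1.fun_add i2) i3, integral_add i1 i2, integral_const_mul, integral_const_mul,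
    integral_const_mul, integral_add (integrable_const _) ((i4.const_mul _).const_mul _),
    integral_const_mul, integral_const_mul, integral_sub integrable_signLR (integrable_const _),
    integral_signLR ht1 ht2, integral_cosh_mul_sum ht1 ht2, mul_assoc (ε ^ (1 + κ)),
    ← Real.exp_add, show -(1 + κ) * ρ ^ 2 / 2 + ((1 + κ) * ρ) ^ 2 / 2 =
      κ * (1 + κ) * ρ ^ 2 / 2 by ring]
  simp

end Row

/-! ### The sparse random prior -/

/-- The likelihood ratio against pure noise of the mixture in which each row independently carries
a signal at `t`, of normalized size `ρ` and random sign, with probability `ε`. -/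
def mixLR {p n : ℕ} (ε ρ : ℝ) (t : ℕ) (x : Obs p n) : ℝ := ∏ j, rowLR n ε ρ t (x j)

section Mixture

variable {p n : ℕ} {ε ρ : ℝ} {t t' : ℕ}

lemma law_zero : law (0 : Obs p n) = Measure.pi fun _ => rowLaw (0 : Fin n → ℝ) := rfl

lemma mixLR_pos (h0 : 0 < ε) (h1 : ε ≤ 1) (x : Obs p n) : 0 < mixLR ε ρ t x :=
  Finset.prod_pos fun _ _ => rowLR_pos h0 h1 _

lemma measurable_mixLR : Measurable (mixLR ε ρ t : Obs p n → ℝ) :=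
  Finset.measurable_prod _ fun j _ => continuous_rowLR.measurable.comp (measurable_pi_apply j)

lemma integrable_mixLR : Integrable (mixLR ε ρ t : Obs p n → ℝ) (law 0) :=
  Integrable.fintype_prod (𝕜 := ℝ) (f := fun _ => rowLR n ε ρ t) fun _ => integrable_rowLR

lemma integral_mixLR (h1 : 1 ≤ t) (h2 : t < n) :
    ∫ x, mixLR ε ρ t x ∂(law (0 : Obs p n)) = 1 := by
  have := integral_fintype_prod_eq_prod (𝕜 := ℝ) (μ := fun _ : Fin p => rowLaw (0 : Fin n → ℝ))
    (fun _ => rowLR n ε ρ t)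
  rw [law_zero]
  refine this.trans ?_
  simp [integral_rowLR h1 h2]

lemma integrable_mixLR_mul :
    Integrable (fun x : Obs p n => mixLR ε ρ t x * mixLR ε ρ t' x) (law 0) := by
  simp_rw [mixLR, ← Finset.prod_mul_distrib]
  exact Integrable.fintype_prod (𝕜 := ℝ) (f := fun _ y => rowLR n ε ρ t y * rowLR n ε ρ t' y)
    fun _ => integrable_rowLR_mul

lemma integral_mixLR_mul (h1 : 1 ≤ t) (h2 : t < n) (h1' : 1 ≤ t') (h2' : t' < n) :
    ∫ x, mixLR ε ρ t x * mixLR ε ρ t' x ∂(law (0 : Obs p n)) =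
      (1 + ε ^ 2 * (Real.cosh (ρ ^ 2 * stepCorr n t t') - 1)) ^ p := by
  have := integral_fintype_prod_eq_prod (𝕜 := ℝ) (μ := fun _ : Fin p => rowLaw (0 : Fin n → ℝ))
    (fun _ y => rowLR n ε ρ t y * rowLR n ε ρ t' y)
  simp_rw [mixLR, ← Finset.prod_mul_distrib]
  rw [law_zero]
  refine this.trans ?_
  simp [integral_rowLR_mul h1 h2 h1' h2']

/-- Mixtures at distant times are nearly uncorrelated. -/
lemma integral_mixLR_mul_le_exp (h0 : 0 ≤ ε) (hε : ε ≤ 1) (h1 : 1 ≤ t) (h2 : t < n) (h1' : 1 ≤ t')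
    (h2' : t' < n) (hc : p * (ρ ^ 2 * stepCorr n t t') ≤ 1) :
    ∫ x, mixLR ε ρ t x * mixLR ε ρ t' x ∂(law (0 : Obs p n)) ≤ Real.exp 1 := by
  rw [integral_mixLR_mul h1 h2 h1' h2']
  set r := ρ ^ 2 * stepCorr n t t' with hr
  have hr0 : 0 ≤ r := mul_nonneg (sq_nonneg _) (stepCorr_nonneg h1 h2 h1' h2')
  have hcosh1 : 1 ≤ Real.cosh r := Real.one_le_cosh r
  have hcosh2 : Real.cosh r ≤ Real.exp r := by
    rw [Real.cosh_eq]
    have := Real.exp_le_exp.2 (show -r ≤ r by linarith)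
    linarith
  have hle : 1 + ε ^ 2 * (Real.cosh r - 1) ≤ Real.exp r := by
    have : ε ^ 2 ≤ 1 := pow_le_one₀ h0 hε
    nlinarith
  calc (1 + ε ^ 2 * (Real.cosh r - 1)) ^ p ≤ Real.exp r ^ p := by
        refine pow_le_pow_left₀ ?_ hle p
        have : 0 ≤ ε ^ 2 * (Real.cosh r - 1) := mul_nonneg (sq_nonneg _) (by linarith)
        linarith
    _ = Real.exp (p * r) := (Real.exp_nat_mul r p).symm
    _ ≤ _ := Real.exp_le_exp.2 hc

lemma mixLR_rpow_eq (h0 : 0 < ε) (h1 : ε ≤ 1) (r : ℝ) (x : Obs p n) :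
    mixLR ε ρ t x ^ r = ∏ j, rowLR n ε ρ t (x j) ^ r :=
  (Real.finsetProd_rpow _ _ (fun _ _ => (rowLR_pos h0 h1 _).le) r).symm

lemma integrable_mixLR_rpow {κ : ℝ} (hκ0 : 0 < κ) (hκ1 : κ ≤ 1) (h0 : 0 < ε) (h1 : ε ≤ 1) :
    Integrable (fun x : Obs p n => mixLR ε ρ t x ^ (1 + κ)) (law 0) := by
  simp_rw [mixLR_rpow_eq h0 h1]
  exact Integrable.fintype_prod (𝕜 := ℝ) (f := fun _ y => rowLR n ε ρ t y ^ (1 + κ))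
    fun _ => integrable_rowLR_rpow hκ0 hκ1 h0 h1

lemma integral_mixLR_rpow_le {κ : ℝ} (hκ0 : 0 < κ) (hκ1 : κ ≤ 1) (h0 : 0 < ε) (h1 : ε ≤ 1)
    (ht1 : 1 ≤ t) (ht2 : t < n) : ∫ x, mixLR ε ρ t x ^ (1 + κ) ∂(law (0 : Obs p n)) ≤
      Real.exp (p * (ε ^ (1 + κ) * Real.exp (κ * (1 + κ) * ρ ^ 2 / 2))) := by
  have := integral_fintype_prod_eq_prod (𝕜 := ℝ) (μ := fun _ : Fin p => rowLaw (0 : Fin n → ℝ))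
    (fun _ y => rowLR n ε ρ t y ^ (1 + κ))
  simp_rw [mixLR_rpow_eq h0 h1]
  rw [law_zero]
  refine this.le.trans ?_
  simp only [Finset.prod_const, Finset.card_univ, Fintype.card_fin]
  rw [Real.exp_nat_mul]
  refine pow_le_pow_left₀ (integral_nonneg fun y => Real.rpow_nonneg (rowLR_pos h0 h1 y).le _) ?_ p
  refine (integral_rowLR_rpow_le hκ0 hκ1 h0 h1 ht1 ht2).trans ?_
  rw [add_comm]
  exact Real.add_one_le_exp _

/-- The second moment, with the cancellation due to the random signs. -/
lemma integral_mixLR_sq_le (h1 : 1 ≤ t) (h2 : t < n) :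
    ∫ x, mixLR ε ρ t x ^ (1 + 1 : ℝ) ∂(law (0 : Obs p n)) ≤
      Real.exp (p * (ε ^ 2 * (Real.cosh (ρ ^ 2) - 1))) := by
  have : ∀ x : Obs p n, mixLR ε ρ t x ^ (1 + 1 : ℝ) = mixLR ε ρ t x * mixLR ε ρ t x := fun x => by
    rw [show (1 + 1 : ℝ) = ((2 : ℕ) : ℝ) by norm_num, Real.rpow_natCast, pow_two]
  simp_rw [this]
  rw [integral_mixLR_mul h1 h2 h1 h2, stepCorr_self h1 h2, mul_one, Real.exp_nat_mul]
  have hcosh1 : 1 ≤ Real.cosh (ρ ^ 2) := Real.one_le_cosh _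
  have : 0 ≤ ε ^ 2 * (Real.cosh (ρ ^ 2) - 1) := mul_nonneg (sq_nonneg _) (by linarith)
  refine pow_le_pow_left₀ (by linarith) ?_ p
  rw [add_comm]
  exact Real.add_one_le_exp _

/-- The prior probability of each sign pattern of a row. -/
def signWeight (ε : ℝ) (z : SignType) : ℝ := if z = 0 then 1 - ε else ε / 2

/-- The mean matrix with signal signs `ζ` at the changepoint `t`. -/
def signMean (n : ℕ) {p : ℕ} (ρ : ℝ) (t : ℕ) (ζ : Fin p → SignType) : Obs p n :=
  fun j i => ρ * (ζ j : ℝ) * stepVec n t i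

lemma signWeight_nonneg (h0 : 0 ≤ ε) (h1 : ε ≤ 1) (z : SignType) : 0 ≤ signWeight ε z := by
  unfold signWeight; split_ifs <;> linarith

lemma sum_signType (f : SignType → ℝ) : ∑ z, f z = f 0 + (f 1 + f (-1)) := by
  have : (Finset.univ : Finset SignType) = {0, 1, -1} := by decide
  rw [this, Finset.sum_insert (by decide), Finset.sum_insert (by decide), Finset.sum_singleton]

lemma prod_sum_signType (f : Fin p → SignType → ℝ) :
    ∏ j, ∑ z, f j z = ∑ ζ : Fin p → SignType, ∏ j, f j (ζ j) := by
  rw [Finset.prod_univ_sum, Fintype.piFinset_univ]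

lemma rowLR_eq_sum (h1 : 1 ≤ t) (h2 : t < n) (y : Fin n → ℝ) : rowLR n ε ρ t y =
    ∑ z : SignType, signWeight ε z * Real.exp (∑ i, ρ * (z : ℝ) * stepVec n t i * y i -
      (∑ i, ρ * (z : ℝ) * stepVec n t i * (ρ * (z : ℝ) * stepVec n t i)) / 2) := by
  have hs : ∀ r : ℝ, ∑ i, r * stepVec n t i * (r * stepVec n t i) = r ^ 2 := fun r => by
    calc _ = r ^ 2 * stepCorr n t t := by
          rw [stepCorr, Finset.mul_sum]; exact Finset.sum_congr rfl fun i _ => by ring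
      _ = _ := by rw [stepCorr_self h1 h2, mul_one]
  have hm : ∀ r : ℝ, ∑ i, r * stepVec n t i * y i = r * ∑ i, stepVec n t i * y i := fun r => by
    simp_rw [mul_assoc, ← Finset.mul_sum]
  simp_rw [hs, hm]
  rw [sum_signType]
  simp only [signWeight, SignType.coe_zero, SignType.coe_one, SignType.coe_neg,
    if_true, one_ne_zero, if_false]
  rw [if_neg (show (-1 : SignType) ≠ 0 by decide), rowLR, signLR, Real.cosh_eq]
  set w := ∑ i, stepVec n t i * y i
  rw [show ρ * 0 * w - (ρ * 0) ^ 2 / 2 = 0 by ring,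
    show ρ * 1 * w - (ρ * 1) ^ 2 / 2 = -ρ ^ 2 / 2 + ρ * w by ring,
    show ρ * -1 * w - (ρ * -1) ^ 2 / 2 = -ρ ^ 2 / 2 + -(ρ * w) by ring]
  simp only [Real.exp_add, Real.exp_zero]
  ring

lemma mixLR_eq_sum (h1 : 1 ≤ t) (h2 : t < n) (x : Obs p n) : mixLR ε ρ t x =
    ∑ ζ : Fin p → SignType, (∏ j, signWeight ε (ζ j)) *
      ∏ j, Real.exp (∑ i, signMean n ρ t ζ j i * x j i -
        (∑ i, signMean n ρ t ζ j i * signMean n ρ t ζ j i) / 2) := by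
  unfold mixLR
  simp_rw [rowLR_eq_sum h1 h2]
  rw [prod_sum_signType]
  simp_rw [Finset.prod_mul_distrib]
  rfl

lemma integrable_likelihoodRatio (θ : Obs p n) : Integrable (fun x : Obs p n =>
    ∏ j, Real.exp (∑ i, θ j i * x j i - (∑ i, θ j i * θ j i) / 2)) (law 0) := by
  have h : ∀ j : Fin p, Integrable (fun y : Fin n → ℝ =>
      Real.exp (∑ i, θ j i * y i - (∑ i, θ j i * θ j i) / 2)) (rowLaw (0 : Fin n → ℝ)) :=
    fun j => by
      simp_rw [Real.exp_sub]
      exact (integrable_exp_linear _).div_const _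
  exact Integrable.fintype_prod (𝕜 := ℝ) h

/-- The mixture likelihood ratio averages expectations over the prior. -/
lemma integral_mixLR_mul_eq_sum (h1 : 1 ≤ t) (h2 : t < n) {g : Obs p n → ℝ} (hg : Measurable g)
    (hgb : ∀ x, |g x| ≤ 1) : ∫ x, mixLR ε ρ t x * g x ∂(law (0 : Obs p n)) =
      ∑ ζ : Fin p → SignType, (∏ j, signWeight ε (ζ j)) * ∫ x, g x ∂(law (signMean n ρ t ζ)) := by
  simp_rw [mixLR_eq_sum h1 h2, Finset.sum_mul, mul_assoc]
  rw [integral_finsetSum]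
  · refine Finset.sum_congr rfl fun ζ _ => ?_
    rw [integral_const_mul, ← integral_law_eq]
  · intro ζ _
    refine Integrable.const_mul ?_ _
    exact Integrable.mul_bdd (c := 1) (integrable_likelihoodRatio _) hg.aestronglyMeasurable
      (ae_of_all _ fun x => hgb x)

lemma signMean_mem_altSpace {s : ℕ} (h1 : 1 ≤ t) (h2 : t < n) (hρ : 0 ≤ ρ)
    {ζ : Fin p → SignType} (hs : s ≤ (Finset.univ.filter fun j => ζ j ≠ 0).card) :
    signMean n ρ t ζ ∈ altSpace p n ρ s := by
  have ht : (0 : ℝ) < t := by exact_mod_cast h1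
  have hn : (0 : ℝ) < (n : ℝ) - t := by rw [sub_pos]; exact_mod_cast h2
  have hn0 : (0 : ℝ) < n := by linarith
  have hw2 : √((t : ℝ) * ((n : ℝ) - t) / n) * √((t : ℝ) * ((n : ℝ) - t) / n) =
    (t : ℝ) * ((n : ℝ) - t) / n := Real.mul_self_sqrt (by positivity)
  refine ⟨_, fun j => ρ * (ζ j : ℝ) * (√((t : ℝ) * ((n : ℝ) - t) / n) * (1 / (t : ℝ))),
    fun j => ρ * (ζ j : ℝ) * (√((t : ℝ) * ((n : ℝ) - t) / n) * -(1 / ((n : ℝ) - t))), t, h1, h2, hs,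
    fun j i => ?_, fun j hj => ?_, fun j hj => ?_⟩
  · unfold signMean stepVec; split_ifs <;> rfl
  · set w := √((t : ℝ) * ((n : ℝ) - t) / n)
    have hz : |(ζ j : ℝ)| = 1 := by
      have := (Finset.mem_filter.1 hj).2
      cases h : ζ j <;> simp_all
    have hdiff : ρ * (ζ j : ℝ) * (w * (1 / (t : ℝ))) -
        ρ * (ζ j : ℝ) * (w * -(1 / ((n : ℝ) - t))) =
        (ρ * (w * (1 / (t : ℝ) + 1 / ((n : ℝ) - t)))) * (ζ j : ℝ) := by ring
    have hw0 : 0 ≤ w := Real.sqrt_nonneg _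
    rw [hdiff, abs_mul, hz, mul_one, abs_of_nonneg (by positivity)]
    apply le_of_eq
    calc ρ = ρ * ((t : ℝ) * ((n : ℝ) - t) / n * (1 / (t : ℝ) + 1 / ((n : ℝ) - t))) := by
          field_simp; ring
      _ = _ := by rw [← hw2]; ring
  · have : ζ j = 0 := by
      by_contra hne
      exact hj (Finset.mem_filter.2 ⟨Finset.mem_univ _, hne⟩)
    simp [this]

lemma sum_prod_signWeight : ∑ ζ : Fin p → SignType, ∏ j, signWeight ε (ζ j) = 1 := by
  rw [← prod_sum_signType (fun _ z => signWeight ε z)]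
  refine Finset.prod_eq_one fun j _ => ?_
  have h1 : (1 : SignType) ≠ 0 := by decide
  have h2 : (-1 : SignType) ≠ 0 := by decide
  rw [sum_signType, signWeight, signWeight, signWeight, if_neg h1, if_neg h2, if_pos rfl]
  ring

open Classical in
/-- The prior rarely produces fewer than `s` signals if it produces `4 s` on average. -/
lemma sum_prod_signWeight_few_le {s : ℕ} (h0 : 0 ≤ ε) (h1 : ε ≤ 1) (hε : p * ε = 4 * s) :
    ∑ ζ : Fin p → SignType, (∏ j, signWeight ε (ζ j)) *
      (if s ≤ (Finset.univ.filter fun j => ζ j ≠ 0).card then 0 else 1) ≤ Real.exp (-s) := by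
  set e1 := Real.exp (-1) with he1
  have he : e1 ≤ 1 / 2 := by
    rw [he1, Real.exp_neg, inv_le_comm₀ (Real.exp_pos _) (by norm_num)]
    have := Real.add_one_le_exp 1
    norm_num at this ⊢; linarith
  have hterm : ∀ ζ : Fin p → SignType, (∏ j, signWeight ε (ζ j)) *
      (if s ≤ (Finset.univ.filter fun j => ζ j ≠ 0).card then 0 else 1) ≤
      Real.exp s * ∏ j, (signWeight ε (ζ j) * if ζ j ≠ 0 then e1 else 1) := by
    intro ζ
    have hw : 0 ≤ ∏ j, signWeight ε (ζ j) :=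
      Finset.prod_nonneg fun j _ => signWeight_nonneg h0 h1 _
    rw [Finset.prod_mul_distrib, Finset.prod_ite, Finset.prod_const, Finset.prod_const_one, mul_one]
    set k := (Finset.univ.filter fun j => ζ j ≠ 0).card
    rw [mul_left_comm]
    refine mul_le_mul_of_nonneg_left ?_ hw
    rw [he1, ← Real.exp_nat_mul, ← Real.exp_add]
    split_ifs with hk
    · exact (Real.exp_pos _).le
    · apply Real.one_le_exp
      have : (k : ℝ) ≤ s := by exact_mod_cast (not_le.1 hk).le
      linarith
  refine (Finset.sum_le_sum fun ζ _ => hterm ζ).trans ?_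
  rw [← Finset.mul_sum,
    ← prod_sum_signType (fun _ z => signWeight ε z * if z ≠ 0 then e1 else 1)]
  have hrow : ∑ z, signWeight ε z * (if z ≠ 0 then e1 else 1) = 1 - ε * (1 - e1) := by
    have h1 : (1 : SignType) ≠ 0 := by decide
    have h2 : (-1 : SignType) ≠ 0 := by decide
    rw [sum_signType, signWeight, signWeight, signWeight, if_neg h1, if_neg h2, if_pos rfl,
      if_pos h1, if_pos h2, if_neg (not_not.2 rfl)]
    ring
  simp only [hrow, Finset.prod_const, Finset.card_univ, Fintype.card_fin]
  have hexp : 1 - ε * (1 - e1) ≤ Real.exp (-(ε / 2)) := by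
    have := Real.add_one_le_exp (-(ε / 2))
    nlinarith
  have he0 : 0 < e1 := Real.exp_pos _
  calc Real.exp s * (1 - ε * (1 - e1)) ^ p ≤ Real.exp s * Real.exp (-(ε / 2)) ^ p := by
        gcongr
        nlinarith
    _ = Real.exp (-s) := by
        rw [← Real.exp_nat_mul, ← Real.exp_add]
        congr 1
        linarith

end Mixture

/-! ### From likelihood ratio moments to the minimax error -/

section Minimax

variable {p n s : ℕ} {ε ρ : ℝ}

lemma IsTest.mem_Icc {ψ : Obs p n → ℝ} (hψ : IsTest ψ) (x : Obs p n) : 0 ≤ ψ x ∧ ψ x ≤ 1 := by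
  rcases hψ.zero_or_one x with h | h <;> rw [h] <;> norm_num

lemma integral_mem_Icc {f : Obs p n → ℝ} (hf : ∀ x, 0 ≤ f x ∧ f x ≤ 1) (θ : Obs p n) :
    0 ≤ ∫ x, f x ∂(law θ) ∧ ∫ x, f x ∂(law θ) ≤ 1 := by
  refine ⟨integral_nonneg fun x => (hf x).1, ?_⟩
  have h := integral_mono_of_nonneg (μ := law θ) (ae_of_all _ fun x => (hf x).1)
    (integrable_const (1 : ℝ)) (ae_of_all _ fun x => (hf x).2)
  simpa using h

/-- The Type II error averaged over the prior is at most its supremum over the alternatives, up to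
the prior probability of too few signals. -/
lemma integral_mixLR_mul_one_sub_le {ψ : Obs p n → ℝ} (hψ : IsTest ψ) (h0 : 0 ≤ ε) (h1 : ε ≤ 1)
    (hε : p * ε = 4 * s) (hρ : 0 ≤ ρ) {t : ℕ} (ht1 : 1 ≤ t) (ht2 : t < n) :
    ∫ x, mixLR ε ρ t x * (1 - ψ x) ∂(law (0 : Obs p n)) ≤
      (⨆ θ : altSpace p n ρ s, ∫ x, (1 - ψ x) ∂(law θ.1)) + Real.exp (-s) := by
  classical
  have h01 : ∀ x, 0 ≤ 1 - ψ x ∧ 1 - ψ x ≤ 1 := fun x =>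
    ⟨sub_nonneg.2 (hψ.mem_Icc x).2, by linarith [(hψ.mem_Icc x).1]⟩
  set M := ⨆ θ : altSpace p n ρ s, ∫ x, (1 - ψ x) ∂(law θ.1) with hM
  have hM0 : 0 ≤ M := Real.iSup_nonneg fun θ => (integral_mem_Icc h01 θ.1).1
  have hbdd : BddAbove (Set.range fun θ : altSpace p n ρ s => ∫ x, (1 - ψ x) ∂(law θ.1)) :=
    ⟨1, by rintro _ ⟨θ, rfl⟩; exact (integral_mem_Icc h01 θ.1).2⟩
  rw [integral_mixLR_mul_eq_sum (g := fun x => 1 - ψ x) ht1 ht2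
    (measurable_const.sub hψ.measurable) fun x => abs_le.2 ⟨by linarith [(h01 x).1], (h01 x).2⟩]
  have hterm : ∀ ζ : Fin p → SignType, (∏ j, signWeight ε (ζ j)) *
      ∫ x, (1 - ψ x) ∂(law (signMean n ρ t ζ)) ≤ (∏ j, signWeight ε (ζ j)) * M +
      (∏ j, signWeight ε (ζ j)) *
        (if s ≤ (Finset.univ.filter fun j => ζ j ≠ 0).card then 0 else 1) := by
    intro ζ
    rw [← mul_add]
    refine mul_le_mul_of_nonneg_left ?_ (Finset.prod_nonneg fun j _ => signWeight_nonneg h0 h1 _)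
    split_ifs with hk
    · rw [add_zero]
      exact le_ciSup hbdd ⟨_, signMean_mem_altSpace ht1 ht2 hρ hk⟩
    · linarith [(integral_mem_Icc h01 (signMean n ρ t ζ)).2]
  refine (Finset.sum_le_sum fun ζ _ => hterm ζ).trans ?_
  rw [Finset.sum_add_distrib, ← Finset.sum_mul, sum_prod_signWeight, one_mul]
  gcongr
  exact sum_prod_signWeight_few_le h0 h1 hε

lemma integral_null_le_iSup {ψ : Obs p n → ℝ} (hψ : IsTest ψ) :
    ∫ x, ψ x ∂(law (0 : Obs p n)) ≤ ⨆ θ : nullSpace p n, ∫ x, ψ x ∂(law θ.1) := by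
  have hbdd : BddAbove (Set.range fun θ : nullSpace p n => ∫ x, ψ x ∂(law θ.1)) :=
    ⟨1, by rintro _ ⟨θ, rfl⟩; exact (integral_mem_Icc hψ.mem_Icc θ.1).2⟩
  exact le_ciSup hbdd ⟨0, fun _ => 0, fun _ _ => rfl⟩

/-- The mixture likelihood ratio, set to zero where it exceeds `τ`. -/
def truncLR (ε ρ τ : ℝ) (t : ℕ) (x : Obs p n) : ℝ :=
  if mixLR ε ρ t x ≤ τ then mixLR ε ρ t x else 0

section Trunc

variable {t t' : ℕ} {τ : ℝ}

lemma truncLR_nonneg (h0 : 0 < ε) (h1 : ε ≤ 1) (x : Obs p n) : 0 ≤ truncLR ε ρ τ t x := by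
  unfold truncLR; split_ifs
  · exact (mixLR_pos h0 h1 x).le
  · exact le_rfl

lemma truncLR_le_mixLR (h0 : 0 < ε) (h1 : ε ≤ 1) (x : Obs p n) :
    truncLR ε ρ τ t x ≤ mixLR ε ρ t x := by
  unfold truncLR; split_ifs
  · exact le_rfl
  · exact (mixLR_pos h0 h1 x).le

lemma truncLR_le (hτ : 0 ≤ τ) (x : Obs p n) : truncLR ε ρ τ t x ≤ τ := by
  unfold truncLR; split_ifs with h
  · exact h
  · exact hτ

lemma measurable_truncLR : Measurable (truncLR ε ρ τ t : Obs p n → ℝ) :=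
  Measurable.ite (measurableSet_le measurable_mixLR measurable_const) measurable_mixLR
    measurable_const

lemma integrable_truncLR (h0 : 0 < ε) (h1 : ε ≤ 1) :
    Integrable (truncLR ε ρ τ t : Obs p n → ℝ) (law 0) :=
  integrable_mixLR.mono' measurable_truncLR.aestronglyMeasurable (ae_of_all _ fun x => by
    rw [Real.norm_of_nonneg (truncLR_nonneg h0 h1 x)]; exact truncLR_le_mixLR h0 h1 x)

lemma integrable_truncLR_mul (h0 : 0 < ε) (h1 : ε ≤ 1) :
    Integrable (fun x : Obs p n => truncLR ε ρ τ t x * truncLR ε ρ τ t' x) (law 0) :=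
  integrable_mixLR_mul.mono' (measurable_truncLR.mul measurable_truncLR).aestronglyMeasurable
    (ae_of_all _ fun x => by
      rw [Real.norm_of_nonneg (mul_nonneg (truncLR_nonneg h0 h1 x) (truncLR_nonneg h0 h1 x))]
      exact mul_le_mul (truncLR_le_mixLR h0 h1 x) (truncLR_le_mixLR h0 h1 x)
        (truncLR_nonneg h0 h1 x) (mixLR_pos h0 h1 x).le)

/-- A moment of order `1 + κ` controls the mass removed by truncation. -/
lemma half_le_integral_truncLR {κ : ℝ} (hκ0 : 0 < κ) (hκ1 : κ ≤ 1) (h0 : 0 < ε) (h1 : ε ≤ 1)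
    (ht1 : 1 ≤ t) (ht2 : t < n) (hτ : 0 < τ)
    (hmom : ∫ x, mixLR ε ρ t x ^ (1 + κ) ∂(law (0 : Obs p n)) ≤ τ ^ κ / 2) :
    1 / 2 ≤ ∫ x, truncLR ε ρ τ t x ∂(law (0 : Obs p n)) := by
  have hτκ : 0 < τ ^ κ := Real.rpow_pos_of_pos hτ _
  have hpt : ∀ x : Obs p n, mixLR ε ρ t x ≤ truncLR ε ρ τ t x +
      (τ ^ κ)⁻¹ * mixLR ε ρ t x ^ (1 + κ) := by
    intro x
    have hpos := mixLR_pos (ρ := ρ) (t := t) h0 h1 x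
    unfold truncLR
    split_ifs with h
    · have : 0 ≤ (τ ^ κ)⁻¹ * mixLR ε ρ t x ^ (1 + κ) := by positivity
      linarith
    · have h3 : τ ^ κ ≤ mixLR ε ρ t x ^ κ :=
        Real.rpow_le_rpow hτ.le (not_le.1 h).le hκ0.le
      rw [Real.rpow_add hpos, Real.rpow_one, zero_add, ← mul_assoc, mul_comm (τ ^ κ)⁻¹, mul_assoc]
      refine le_mul_of_one_le_right hpos.le ?_
      rw [inv_mul_eq_div, one_le_div hτκ]; exact h3
  have hint := integral_mono (μ := law (0 : Obs p n)) integrable_mixLR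
    ((integrable_truncLR h0 h1).add ((integrable_mixLR_rpow hκ0 hκ1 h0 h1).const_mul _)) hpt
  simp only [Pi.add_apply] at hint
  rw [integral_mixLR ht1 ht2, integral_add (integrable_truncLR h0 h1)
    ((integrable_mixLR_rpow hκ0 hκ1 h0 h1).const_mul _), integral_const_mul] at hint
  have : (τ ^ κ)⁻¹ * ∫ x, mixLR ε ρ t x ^ (1 + κ) ∂(law (0 : Obs p n)) ≤ 1 / 2 := by
    rw [inv_mul_le_iff₀ hτκ]; linarith
  linarith

lemma integral_truncLR_mul_self_le (h0 : 0 < ε) (h1 : ε ≤ 1) (ht1 : 1 ≤ t) (ht2 : t < n)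
    (hτ : 0 ≤ τ) :
    ∫ x, truncLR ε ρ τ t x * truncLR ε ρ τ t x ∂(law (0 : Obs p n)) ≤ τ := by
  have hint := integral_mono (μ := law (0 : Obs p n)) (integrable_truncLR_mul (t := t) (t' := t)
    (ρ := ρ) (τ := τ) h0 h1) (integrable_mixLR.const_mul τ) fun x =>
      mul_le_mul (truncLR_le hτ x) (truncLR_le_mixLR h0 h1 x) (truncLR_nonneg h0 h1 x) hτ
  rwa [integral_const_mul, integral_mixLR ht1 ht2, mul_one] at hint

lemma integral_truncLR_mul_le (h0 : 0 < ε) (h1 : ε ≤ 1) (ht1 : 1 ≤ t) (ht2 : t < n)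
    (ht1' : 1 ≤ t') (ht2' : t' < n) (hc : p * (ρ ^ 2 * stepCorr n t t') ≤ 1) :
    ∫ x, truncLR ε ρ τ t x * truncLR ε ρ τ t' x ∂(law (0 : Obs p n)) ≤ Real.exp 1 := by
  refine (integral_mono (μ := law (0 : Obs p n)) (integrable_truncLR_mul h0 h1)
    (integrable_mixLR_mul (t := t) (t' := t') (ρ := ρ) (ε := ε)) fun x => ?_).trans
      (integral_mixLR_mul_le_exp h0.le h1 ht1 ht2 ht1' ht2' hc)
  exact mul_le_mul (truncLR_le_mixLR h0 h1 x) (truncLR_le_mixLR h0 h1 x)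
    (truncLR_nonneg h0 h1 x) (mixLR_pos h0 h1 x).le

end Trunc

lemma stepCorr_pow_le {K i i' : ℕ} (hK : 1 ≤ K) (h : i < i') (hi' : K ^ i' < n) :
    stepCorr n (K ^ i) (K ^ i') ≤ (√K)⁻¹ := by
  have hK' : (0 : ℝ) < K := by exact_mod_cast hK
  have hle : K ^ i * K ≤ K ^ i' := by rw [← pow_succ]; exact Nat.pow_le_pow_right hK h
  have hle0 : K ^ i ≤ K ^ i' := Nat.pow_le_pow_right hK h.le
  rw [stepCorr_eq (Nat.one_le_pow _ _ hK) hle0 hi', ← Real.sqrt_inv]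
  apply Real.sqrt_le_sqrt
  have h1 : ((K ^ i : ℕ) : ℝ) * K ≤ ((K ^ i' : ℕ) : ℝ) := by exact_mod_cast hle
  have h2 : ((K ^ i : ℕ) : ℝ) ≤ ((K ^ i' : ℕ) : ℝ) := by exact_mod_cast hle0
  have h3 : ((K ^ i' : ℕ) : ℝ) < n := by exact_mod_cast hi'
  have h4 : (0 : ℝ) < ((K ^ i : ℕ) : ℝ) := by exact_mod_cast Nat.one_le_pow _ _ hK
  set x := ((K ^ i : ℕ) : ℝ)
  set y := ((K ^ i' : ℕ) : ℝ)
  have hy : 0 < y := by linarith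
  have hnx : 0 < (n : ℝ) - x := by linarith
  rw [div_le_iff₀ (by positivity), inv_mul_eq_div, le_div_iff₀ hK']
  calc x * ((n : ℝ) - y) * K = (x * K) * ((n : ℝ) - y) := by ring
    _ ≤ y * ((n : ℝ) - x) := by
        apply mul_le_mul h1 (by linarith) (by linarith) hy.le

/-- The second moment method with truncation: if at each of `N` well-separated times the moment of
order `1 + κ` of the mixture likelihood ratio is at most `N ^ (κ / 2) / 2`, no test is reliable. -/
lemma sub_exp_le_minimaxError {N K : ℕ} {κ : ℝ} (hN : 1 ≤ N) (hK : 1 ≤ K)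
    (hKn : ∀ i < N, K ^ i < n) (h0 : 0 < ε) (h1 : ε ≤ 1) (hε : p * ε = 4 * s) (hρ : 0 ≤ ρ)
    (hcorr : p * ρ ^ 2 ≤ √K) (hκ0 : 0 < κ) (hκ1 : κ ≤ 1)
    (hmom : ∀ t, 1 ≤ t → t < n →
      ∫ x, mixLR ε ρ t x ^ (1 + κ) ∂(law (0 : Obs p n)) ≤ √N ^ κ / 2) :
    1 / 16 - Real.exp (-s) ≤ minimaxError p n ρ s := by
  have hne : Nonempty {ψ : Obs p n → ℝ // IsTest ψ} :=
    ⟨⟨fun _ => 0, measurable_const, fun _ => Or.inl rfl⟩⟩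
  refine le_ciInf fun ψ => ?_
  obtain ⟨ψ, hψ⟩ := ψ
  have hN' : (1 : ℝ) ≤ N := by exact_mod_cast hN
  have hN0 : (0 : ℝ) < N := by linarith
  have hK' : (0 : ℝ) < K := by exact_mod_cast hK
  have hsK : 0 < √(K : ℝ) := Real.sqrt_pos.2 hK'
  set τ := √(N : ℝ) with hτ
  have hτ0 : 0 < τ := Real.sqrt_pos.2 hN0
  have hτN : τ ≤ N := by rw [hτ]; apply Real.sqrt_le_iff.2; constructor <;> nlinarith
  have htime : ∀ i ∈ Finset.range N, 1 ≤ K ^ i ∧ K ^ i < n := fun i hi =>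
    ⟨Nat.one_le_pow _ _ hK, hKn i (Finset.mem_range.1 hi)⟩
  set Lbar : Obs p n → ℝ := fun x => (N : ℝ)⁻¹ * ∑ i ∈ Finset.range N, mixLR ε ρ (K ^ i) x with hL
  set Ltil : Obs p n → ℝ := fun x =>
    (N : ℝ)⁻¹ * ∑ i ∈ Finset.range N, truncLR ε ρ τ (K ^ i) x with hLt
  have hLt_nonneg : ∀ x, 0 ≤ Ltil x := fun x =>
    mul_nonneg (by positivity) (Finset.sum_nonneg fun i _ => truncLR_nonneg h0 h1 x)
  have hLt_le : ∀ x, Ltil x ≤ Lbar x := fun x =>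
    mul_le_mul_of_nonneg_left (Finset.sum_le_sum fun i _ => truncLR_le_mixLR h0 h1 x)
      (by positivity)
  have iψ : Integrable ψ (law (0 : Obs p n)) :=
    Integrable.of_bound hψ.measurable.aestronglyMeasurable 1 (ae_of_all _ fun x => by
      rw [Real.norm_of_nonneg (hψ.mem_Icc x).1]; exact (hψ.mem_Icc x).2)
  have iLψ : ∀ i, Integrable (fun x : Obs p n => mixLR ε ρ (K ^ i) x * (1 - ψ x)) (law 0) :=
    fun i => Integrable.mul_bdd (c := 1) integrable_mixLR
      (measurable_const.sub hψ.measurable).aestronglyMeasurable (ae_of_all _ fun x => by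
        rw [Real.norm_of_nonneg (sub_nonneg.2 (hψ.mem_Icc x).2)]; linarith [(hψ.mem_Icc x).1])
  have iLbarψ : Integrable (fun x : Obs p n => Lbar x * (1 - ψ x)) (law 0) := by
    simp_rw [hL, mul_assoc, Finset.sum_mul]
    exact (integrable_finsetSum _ fun i _ => iLψ i).const_mul _
  have iLt : Integrable Ltil (law (0 : Obs p n)) :=
    (integrable_finsetSum _ fun i _ => integrable_truncLR h0 h1).const_mul _
  have hsq : ∀ x, Ltil x ^ 2 = (N : ℝ)⁻¹ ^ 2 * ∑ i ∈ Finset.range N, ∑ i' ∈ Finset.range N,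
      truncLR ε ρ τ (K ^ i) x * truncLR ε ρ τ (K ^ i') x := fun x => by
    rw [hLt, mul_pow, pow_two (∑ i ∈ Finset.range N, _), Finset.sum_mul_sum]
  have iLt2 : Integrable (fun x => Ltil x ^ 2) (law (0 : Obs p n)) := by
    simp_rw [hsq]
    exact (integrable_finsetSum _ fun i _ => integrable_finsetSum _ fun i' _ =>
      integrable_truncLR_mul h0 h1).const_mul _
  -- truncation leaves half of the mass
  have hfirst : 1 / 2 ≤ ∫ x, Ltil x ∂(law (0 : Obs p n)) := by
    rw [hLt, integral_const_mul, integral_finsetSum _ fun i _ => integrable_truncLR h0 h1,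
      ← div_eq_inv_mul, le_div_iff₀ hN0]
    calc 1 / 2 * (N : ℝ) = ∑ i ∈ Finset.range N, (1 / 2 : ℝ) := by simp; ring
      _ ≤ _ := Finset.sum_le_sum fun i hi => half_le_integral_truncLR hκ0 hκ1 h0 h1
          (htime i hi).1 (htime i hi).2 hτ0 (hmom _ (htime i hi).1 (htime i hi).2)
  -- second moment: distinct times are nearly uncorrelated, and the truncation level `τ ≤ N` bounds
  -- the diagonal terms
  have hoff : ∀ i ∈ Finset.range N, ∀ i' ∈ Finset.range N, i ≠ i' →
      ∫ x, truncLR ε ρ τ (K ^ i) x * truncLR ε ρ τ (K ^ i') x ∂(law (0 : Obs p n)) ≤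
        Real.exp 1 := by
    intro i hi i' hi' hii'
    refine integral_truncLR_mul_le h0 h1 (htime i hi).1 (htime i hi).2 (htime i' hi').1
      (htime i' hi').2 ?_
    have hc : stepCorr n (K ^ i) (K ^ i') ≤ (√K)⁻¹ := by
      rcases lt_or_gt_of_ne hii' with h | h
      · exact stepCorr_pow_le hK h (htime i' hi').2
      · rw [stepCorr_comm]; exact stepCorr_pow_le hK h (htime i hi).2
    calc p * (ρ ^ 2 * stepCorr n (K ^ i) (K ^ i')) ≤ p * (ρ ^ 2 * (√K)⁻¹) := by gcongr
      _ = (p * ρ ^ 2) / √K := by rw [div_eq_mul_inv]; ring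
      _ ≤ 1 := (div_le_one hsK).2 hcorr
  have hsecond : ∫ x, Ltil x ^ 2 ∂(law (0 : Obs p n)) ≤ 4 := by
    simp_rw [hsq]
    rw [integral_const_mul, integral_finsetSum _ fun i _ => integrable_finsetSum _ fun i' _ =>
      integrable_truncLR_mul h0 h1]
    have hinner : ∀ i ∈ Finset.range N, ∫ x, ∑ i' ∈ Finset.range N,
        truncLR ε ρ τ (K ^ i) x * truncLR ε ρ τ (K ^ i') x ∂(law (0 : Obs p n)) ≤ 4 * N := by
      intro i hi
      rw [integral_finsetSum _ fun i' _ => integrable_truncLR_mul h0 h1,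
        ← Finset.add_sum_erase _ _ hi]
      have hdiag := integral_truncLR_mul_self_le (p := p) (ρ := ρ) h0 h1 (htime i hi).1
        (htime i hi).2 hτ0.le
      have hrest : ∑ i' ∈ (Finset.range N).erase i,
          ∫ x, truncLR ε ρ τ (K ^ i) x * truncLR ε ρ τ (K ^ i') x ∂(law (0 : Obs p n)) ≤
          N * Real.exp 1 := by
        calc _ ≤ ∑ i' ∈ (Finset.range N).erase i, Real.exp 1 :=
              Finset.sum_le_sum fun i' hi' => hoff i hi i' (Finset.mem_of_mem_erase hi')
                (Finset.ne_of_mem_erase hi').symm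
          _ = ((Finset.range N).erase i).card * Real.exp 1 := by
              rw [Finset.sum_const, nsmul_eq_mul]
          _ ≤ _ := by
              gcongr
              simpa using Finset.card_erase_le (s := Finset.range N) (a := i)
      have he : Real.exp 1 ≤ 3 := by linarith [Real.exp_one_lt_d9]
      nlinarith
    calc (N : ℝ)⁻¹ ^ 2 * _ ≤ (N : ℝ)⁻¹ ^ 2 * ∑ i ∈ Finset.range N, 4 * (N : ℝ) := by
          gcongr with i hi; exact hinner i hi
      _ = 4 := by rw [Finset.sum_const, Finset.card_range, nsmul_eq_mul]; field_simp
  -- the risk of `ψ` against the mixture is at least the mean of `min 1 L`, and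
  -- `L / 4 - L ^ 2 / 64` is below both `L` and `1`
  have hpt : ∀ x, 1 / 4 * Ltil x - 1 / 64 * Ltil x ^ 2 ≤ ψ x + Lbar x * (1 - ψ x) := by
    intro x
    rcases hψ.zero_or_one x with h | h
    · rw [h]; nlinarith [hLt_nonneg x, hLt_le x]
    · rw [h]; nlinarith [sq_nonneg (Ltil x - 8)]
  have hrisk := integral_mono (μ := law (0 : Obs p n))
    ((iLt.const_mul (1 / 4)).sub (iLt2.const_mul (1 / 64))) (iψ.add iLbarψ) hpt
  simp only [Pi.add_apply, Pi.sub_apply] at hrisk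
  rw [integral_sub (iLt.const_mul _) (iLt2.const_mul _), integral_add iψ iLbarψ,
    integral_const_mul (1 / 4) Ltil, integral_const_mul (1 / 64) fun x => Ltil x ^ 2] at hrisk
  have hII : ∫ x, Lbar x * (1 - ψ x) ∂(law (0 : Obs p n)) ≤
      (⨆ θ : altSpace p n ρ s, ∫ x, (1 - ψ x) ∂(law θ.1)) + Real.exp (-s) := by
    simp_rw [hL, mul_assoc, Finset.sum_mul]
    rw [integral_const_mul, integral_finsetSum _ fun i _ => iLψ i, inv_mul_le_iff₀ hN0]
    calc _ ≤ ∑ i ∈ Finset.range N, ((⨆ θ : altSpace p n ρ s, ∫ x, (1 - ψ x) ∂(law θ.1)) +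
          Real.exp (-s)) := Finset.sum_le_sum fun i hi =>
            integral_mixLR_mul_one_sub_le hψ h0.le h1 hε hρ (htime i hi).1 (htime i hi).2
      _ = _ := by rw [Finset.sum_const, Finset.card_range, nsmul_eq_mul]
  have hI := integral_null_le_iSup hψ
  change 1 / 16 - Real.exp (-s) ≤ (⨆ θ : nullSpace p n, ∫ x, ψ x ∂(law θ.1)) +
    ⨆ θ : altSpace p n ρ s, ∫ x, (1 - ψ x) ∂(law θ.1)
  linarith

end Minimax

/-! ### The four regimes of the lower bound -/

section LowerBound

variable {a β β₁ : ℝ} {n s : ℕ → ℕ}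

/-- There are at least `(log n) ^ (1 / 2)` geometric times of ratio `p ^ (2 C)` below `n`. -/
lemma Calibrated.exp_half_loglog_le_log (ha : 0 < a) (h : Calibrated a β n s) {C : ℕ} (hC : 0 < C) :
    ∀ᶠ p : ℕ in atTop, Real.exp (Real.log (Real.log (n p)) / 2) ≤ Nat.log (p ^ (2 * C)) (n p) := by
  filter_upwards [h.loglog_bounds ha (show 0 < a / 2 by linarith), eventually_ge_atTop 2,
    eventually_log_le_rpow (show 0 < a / 2 by linarith)
      (show (0 : ℝ) < 1 / (8 * C) by positivity),
    (h.tendsto_loglog ha).eventually_gt_atTop 0] with p hl hp2 hlog hl0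
  have h1 := hl.1
  rw [show a - a / 2 = a / 2 by ring] at h1
  set l := Real.log (Real.log (n p)) with hldef
  have hn : 2 ≤ n p := two_le_of_loglog_pos hl0
  have hn0 : (0 : ℝ) < n p := by exact_mod_cast (by omega : 0 < n p)
  have hlogn : Real.log (n p) = Real.exp l := by
    rw [hldef, Real.exp_log]
    exact Real.log_pos (by exact_mod_cast (by omega : 1 < n p))
  set K := p ^ (2 * C) with hK
  have hK1 : 1 < K := Nat.one_lt_pow (by omega) (by omega)
  have hlogK : Real.log K ≤ Real.exp (l / 2) / 2 := by
    have hC' : (0 : ℝ) < C := by exact_mod_cast hC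
    have h3 : 2 * C * Real.log p ≤ 1 / 4 * (p : ℝ) ^ (a / 2) := by
      calc 2 * C * Real.log p ≤ 2 * C * (1 / (8 * C) * (p : ℝ) ^ (a / 2)) := by gcongr
        _ = _ := by field_simp; norm_num
    have h4 := Real.add_one_le_exp (l / 2)
    rw [hK]; push_cast
    rw [Real.log_pow]; push_cast
    linarith
  have hlogK0 : 0 < Real.log K := Real.log_pos (by exact_mod_cast hK1)
  have hlt : (n p : ℝ) < (K : ℝ) ^ (Nat.log K (n p) + 1) := by
    exact_mod_cast Nat.lt_pow_succ_log_self hK1 (n p)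
  have h5 := Real.log_lt_log hn0 hlt
  rw [Real.log_pow, hlogn] at h5
  set N := Nat.log K (n p)
  have h6 : Real.exp l = Real.exp (l / 2) * Real.exp (l / 2) := by rw [← Real.exp_add]; ring_nf
  have h7 : 1 ≤ Real.exp (l / 2) := Real.one_le_exp (by linarith)
  push_cast at h5
  have h8 : Real.exp (l / 2) * Real.exp (l / 2) <
      ((N : ℝ) + 1) * (Real.exp (l / 2) / 2) := by
    rw [← h6]
    exact h5.trans_le (by gcongr)
  have h9 : 2 * Real.exp (l / 2) < N + 1 := by
    by_contra hneg
    nlinarith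
  linarith

/-- The minimax error stays away from `0` as soon as the logarithm `D` of some moment of order
`1 + κ` of the mixture likelihood ratio is below `κ / 4` times `log log n`. -/
lemma exists_le_minimaxError (ha : 0 < a) (hβ : β ∈ Set.Ioo (0 : ℝ) 1) (h : Calibrated a β n s)
    {ρ : ℕ → ℝ} (hρ0 : ∀ p, 0 ≤ ρ p) {C : ℕ} (hC : 0 < C)
    (hρ : ∀ᶠ p : ℕ in atTop, p * ρ p ^ 2 ≤ (p : ℝ) ^ C) {κ D : ℕ → ℝ}
    (hκ : ∀ᶠ p : ℕ in atTop, 0 < κ p ∧ κ p ≤ 1)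
    (hD : ∀ᶠ p : ℕ in atTop, D p + Real.log 2 ≤ κ p * Real.log (Real.log (n p)) / 4)
    (hmom : ∀ᶠ p : ℕ in atTop, 0 < (4 * s p / p : ℝ) → (4 * s p / p : ℝ) ≤ 1 →
      ∀ t, 1 ≤ t → t < n p →
        ∫ x, mixLR (4 * s p / p) (ρ p) t x ^ (1 + κ p) ∂(law (0 : Obs p (n p))) ≤
          Real.exp (D p)) :
    ∃ c : ℝ, 0 < c ∧ ∀ᶠ p : ℕ in atTop, c ≤ minimaxError p (n p) (ρ p) (s p) := by
  refine ⟨1 / 32, by norm_num, ?_⟩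
  filter_upwards [hρ, hκ, hD, hmom, h.exp_half_loglog_le_log ha hC, h.sparsity_bounds,
    eventually_ge_atTop 2, (tendsto_natCast_rpow (sub_pos.2 hβ.2)).eventually_ge_atTop 64,
    eventually_rpow_le_mul_rpow (show 1 - β < 1 by linarith [hβ.1])
      (show (0 : ℝ) < 1 / 8 by norm_num),
    (h.tendsto_loglog ha).eventually_gt_atTop 0]
    with p hρp hκp hDp hmomp hNp hsp hp2 hs64 hs8 hl0
  have hp0 : (0 : ℝ) < p := by exact_mod_cast (by omega : 0 < p)
  rw [Real.rpow_one] at hs8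
  have hs32 : (32 : ℝ) ≤ s p := by linarith [hsp.1]
  set ε : ℝ := 4 * s p / p with hεdef
  have hε0 : 0 < ε := by positivity
  have hε1 : ε ≤ 1 := by rw [hεdef, div_le_one hp0]; linarith [hsp.2]
  have hpε : p * ε = 4 * s p := by rw [hεdef]; field_simp
  have hexp : Real.exp (-(s p : ℝ)) ≤ 1 / 32 := by
    rw [Real.exp_neg, inv_le_comm₀ (Real.exp_pos _) (by norm_num)]
    have := Real.add_one_le_exp (s p : ℝ)
    norm_num; linarith
  set l := Real.log (Real.log (n p)) with hldef
  -- the ratio `K` satisfies `√K = p ^ C`, so signals at different times are nearly uncorrelated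
  set K := p ^ (2 * C) with hK
  have hK1 : 1 < K := Nat.one_lt_pow (by omega) (by omega)
  set N := Nat.log K (n p) with hNdef
  have hN1 : (1 : ℝ) ≤ N := (Real.one_le_exp (by linarith)).trans hNp
  have hn : 2 ≤ n p := two_le_of_loglog_pos hl0
  have hsqrtK : √(K : ℝ) = (p : ℝ) ^ C := by
    rw [hK]; push_cast
    rw [mul_comm 2 C, pow_mul, Real.sqrt_sq (by positivity)]
  have hfinal := sub_exp_le_minimaxError (p := p) (n := n p) (s := s p) (ε := ε) (ρ := ρ p)
    (N := N) (K := K) (κ := κ p) (by exact_mod_cast hN1) hK1.le (fun i hi => ?_) hε0 hε1 hpε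
    (hρ0 p) (by rw [hsqrtK]; exact hρp) hκp.1 hκp.2 (fun t ht1 ht2 => ?_)
  · linarith
  · exact (Nat.pow_lt_pow_right hK1 hi).trans_le (Nat.pow_log_le_self K (by omega))
  · refine (hmomp hε0 hε1 t ht1 ht2).trans ?_
    have hsqrtN : Real.exp (l / 4) ≤ √(N : ℝ) := by
      apply Real.le_sqrt_of_sq_le
      rw [← Real.exp_nat_mul]
      refine le_trans (le_of_eq ?_) hNp
      congr 1; push_cast; ring
    rw [le_div_iff₀ two_pos]
    calc Real.exp (D p) * 2 = Real.exp (D p + Real.log 2) := by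
          rw [Real.exp_add, Real.exp_log two_pos]
      _ ≤ Real.exp (κ p * l / 4) := Real.exp_le_exp.2 hDp
      _ = Real.exp (l / 4) ^ κ p := by rw [← Real.exp_mul]; congr 1; ring
      _ ≤ √(N : ℝ) ^ κ p := by
          apply Real.rpow_le_rpow (Real.exp_pos _).le hsqrtN hκp.1.le

lemma Calibrated.eventually_mul_rpow_add_le (ha : 0 < a) (h : Calibrated a β n s) {x C c : ℝ}
    (hx : x < a) (hc : 0 < c) :
    ∀ᶠ p : ℕ in atTop, C * (p : ℝ) ^ x + Real.log 2 ≤ c * Real.log (Real.log (n p)) := by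
  obtain ⟨y, hy, hya⟩ := exists_between (max_lt hx ha)
  have hxy : x < y := (le_max_left _ _).trans_lt hy
  have hy0 : 0 < y := (le_max_right _ _).trans_lt hy
  filter_upwards [h.loglog_bounds ha (sub_pos.2 hya),
    eventually_rpow_le_mul_rpow hxy (show 0 < c / (2 * (|C| + 1)) by positivity),
    (tendsto_natCast_rpow hy0).eventually_ge_atTop (2 * Real.log 2 / c), eventually_ge_atTop 1]
    with p hl hx' hlog hp1
  have hl1 := hl.1
  rw [sub_sub_cancel] at hl1
  have hpos : 0 < (p : ℝ) ^ y := Real.rpow_pos_of_pos (by exact_mod_cast hp1) _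
  have h1 : C * (p : ℝ) ^ x ≤ c / 2 * (p : ℝ) ^ y := by
    have hpx : 0 < (p : ℝ) ^ x := Real.rpow_pos_of_pos (by exact_mod_cast hp1) _
    calc C * (p : ℝ) ^ x ≤ (|C| + 1) * (p : ℝ) ^ x := by
          gcongr; linarith [le_abs_self C]
      _ ≤ (|C| + 1) * (c / (2 * (|C| + 1)) * (p : ℝ) ^ y) := by gcongr
      _ = _ := by field_simp
  have h2 : Real.log 2 ≤ c / 2 * (p : ℝ) ^ y := by
    rw [div_le_iff₀ hc] at hlog; linarith
  calc _ ≤ c / 2 * (p : ℝ) ^ y + c / 2 * (p : ℝ) ^ y := add_le_add h1 h2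
    _ = c * (p : ℝ) ^ y := by ring
    _ ≤ _ := by gcongr

lemma prior_rate_le {p : ℕ} (hp1 : 1 ≤ p) {σ : ℕ} (hs : (σ : ℝ) ≤ 2 * (p : ℝ) ^ (1 - β)) :
    (4 * σ / p : ℝ) ≤ 8 * (p : ℝ) ^ (-β) := by
  have hp0 : (0 : ℝ) < p := by exact_mod_cast hp1
  rw [div_le_iff₀ hp0, mul_assoc, ← Real.rpow_add_one hp0.ne',
    show -β + 1 = 1 - β by ring]
  linarith

/-- Weak dense signals: the ordinary second moment, whose leading term is quartic in the signal. -/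
lemma minimaxError_dense (ha : 0 < a) (hβ : β ∈ Set.Ioo (0 : ℝ) 1) (h : Calibrated a β n s)
    (hβ₁ : β₁ < β) (hreg : a ≤ 1 - 2 * β₁) {ρ : ℕ → ℝ}
    (hρ : ∀ p, ρ p = √((p : ℝ) ^ ((a - (1 - 2 * β₁)) / 2))) :
    ∃ c : ℝ, 0 < c ∧ ∀ᶠ p : ℕ in atTop, c ≤ minimaxError p (n p) (ρ p) (s p) := by
  have hρ2 : ∀ p, ρ p ^ 2 = (p : ℝ) ^ ((a - (1 - 2 * β₁)) / 2) := fun p => by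
    rw [hρ, Real.sq_sqrt (by positivity)]
  have hρ1 : ∀ p : ℕ, 1 ≤ p → ρ p ^ 2 ≤ 1 := fun p hp => by
    rw [hρ2]
    exact Real.rpow_le_one_of_one_le_of_nonpos (by exact_mod_cast hp) (by linarith)
  refine exists_le_minimaxError ha hβ h (fun p => by rw [hρ]; positivity) (C := 1) one_pos ?_
    (κ := fun _ => 1) (D := fun p => 64 * (p : ℝ) ^ (a - 2 * (β - β₁)))
    (Eventually.of_forall fun _ => ⟨one_pos, le_rfl⟩) ?_ ?_
  · filter_upwards [eventually_ge_atTop 1] with p hp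
    rw [pow_one]
    exact mul_le_of_le_one_right (by positivity) (hρ1 p hp)
  · filter_upwards [h.eventually_mul_rpow_add_le ha (C := 64)
      (show a - 2 * (β - β₁) < a by linarith) (show (0 : ℝ) < 1 / 4 by norm_num)] with p hp
    linarith
  · filter_upwards [h.sparsity_bounds, eventually_ge_atTop 1] with p hs hp1 hε0 hε1 t ht1 ht2
    have hp0 : (0 : ℝ) < p := by exact_mod_cast hp1
    refine (integral_mixLR_sq_le ht1 ht2).trans (Real.exp_le_exp.2 ?_)
    have hcosh : Real.cosh (ρ p ^ 2) - 1 ≤ (ρ p ^ 2) ^ 2 := by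
      set r := ρ p ^ 2 with hr
      have hr0 : 0 ≤ r := sq_nonneg _
      have hr1 : r ≤ 1 := hρ1 p hp1
      have h1 := Real.cosh_le_exp_half_sq r
      have h2 := Real.abs_exp_sub_one_le (x := r ^ 2 / 2) (by
        rw [abs_of_nonneg (by positivity)]; nlinarith)
      rw [abs_of_nonneg (show (0 : ℝ) ≤ r ^ 2 / 2 by positivity)] at h2
      linarith [le_abs_self (Real.exp (r ^ 2 / 2) - 1)]
    have hε8 := prior_rate_le hp1 hs.2
    calc p * ((4 * s p / p : ℝ) ^ 2 * (Real.cosh (ρ p ^ 2) - 1)) ≤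
          p * ((8 * (p : ℝ) ^ (-β)) ^ 2 * (ρ p ^ 2) ^ 2) := by
            gcongr
            linarith [Real.one_le_cosh (ρ p ^ 2)]
      _ = 64 * (p : ℝ) ^ (a - 2 * (β - β₁)) := by
            rw [hρ2, mul_pow, ← Real.rpow_mul_natCast hp0.le, ← Real.rpow_mul_natCast hp0.le,
              show a - 2 * (β - β₁) =
                1 + (-β * (2 : ℕ) + (a - (1 - 2 * β₁)) / 2 * (2 : ℕ)) by push_cast; ring,
              Real.rpow_add hp0, Real.rpow_add hp0, Real.rpow_one]
            ring

/-- Signals of size `u √(2 log p)`: a moment of fixed order `1 + κ`. -/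
lemma minimaxError_sparse (ha : 0 < a) (hβ : β ∈ Set.Ioo (0 : ℝ) 1) (h : Calibrated a β n s)
    {u κ : ℝ} (hu : 0 ≤ u) (hκ0 : 0 < κ) (hκ1 : κ ≤ 1)
    (hF : 1 - β * (1 + κ) + κ * (1 + κ) * u ^ 2 < a) {ρ : ℕ → ℝ}
    (hρ : ∀ p, ρ p = u * √(2 * Real.log p)) :
    ∃ c : ℝ, 0 < c ∧ ∀ᶠ p : ℕ in atTop, c ≤ minimaxError p (n p) (ρ p) (s p) := by
  have hρ2 : ∀ p : ℕ, 1 ≤ p → ρ p ^ 2 = u ^ 2 * (2 * Real.log p) := fun p hp => by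
    have : 0 ≤ Real.log p := Real.log_nonneg (by exact_mod_cast hp)
    rw [hρ, mul_pow, Real.sq_sqrt (by positivity)]
  refine exists_le_minimaxError ha hβ h (fun p => by rw [hρ]; positivity) (C := 2) two_pos ?_
    (κ := fun _ => κ) (D := fun p => 64 * (p : ℝ) ^ (1 - β * (1 + κ) + κ * (1 + κ) * u ^ 2))
    (Eventually.of_forall fun _ => ⟨hκ0, hκ1⟩) ?_ ?_
  · filter_upwards [eventually_ge_atTop 1, eventually_log_le_rpow one_pos
      (show (0 : ℝ) < 1 / (2 * u ^ 2 + 1) by positivity)] with p hp hlog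
    have hlog0 : 0 ≤ Real.log p := Real.log_nonneg (by exact_mod_cast hp)
    rw [Real.rpow_one] at hlog
    rw [hρ2 p hp, pow_two (p : ℝ)]
    gcongr
    calc u ^ 2 * (2 * Real.log p) ≤ (2 * u ^ 2 + 1) * Real.log p := by nlinarith
      _ ≤ (2 * u ^ 2 + 1) * (1 / (2 * u ^ 2 + 1) * p) := by gcongr
      _ = p := by field_simp
  · filter_upwards [h.eventually_mul_rpow_add_le ha (C := 64) hF
      (show 0 < κ / 4 by positivity)] with p hp
    linarith
  · filter_upwards [h.sparsity_bounds, eventually_ge_atTop 1] with p hs hp1 hε0 hε1 t ht1 ht2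
    have hp0 : (0 : ℝ) < p := by exact_mod_cast hp1
    refine (integral_mixLR_rpow_le hκ0 hκ1 hε0 hε1 ht1 ht2).trans (Real.exp_le_exp.2 ?_)
    have hε8 := prior_rate_le hp1 hs.2
    have h8 : (8 : ℝ) ^ (1 + κ) ≤ 64 := by
      calc (8 : ℝ) ^ (1 + κ) ≤ (8 : ℝ) ^ (2 : ℝ) :=
            Real.rpow_le_rpow_of_exponent_le (by norm_num) (by linarith)
        _ = 64 := by norm_num
    have hεpow : (4 * s p / p : ℝ) ^ (1 + κ) ≤ 64 * (p : ℝ) ^ (-β * (1 + κ)) := by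
      calc (4 * s p / p : ℝ) ^ (1 + κ) ≤ (8 * (p : ℝ) ^ (-β)) ^ (1 + κ) :=
            Real.rpow_le_rpow hε0.le hε8 (by linarith)
        _ = (8 : ℝ) ^ (1 + κ) * (p : ℝ) ^ (-β * (1 + κ)) := by
            rw [Real.mul_rpow (by norm_num) (by positivity), ← Real.rpow_mul hp0.le]
        _ ≤ _ := by gcongr
    have hexp : Real.exp (κ * (1 + κ) * ρ p ^ 2 / 2) = (p : ℝ) ^ (κ * (1 + κ) * u ^ 2) := by
      rw [rpow_eq_exp_log hp1, hρ2 p hp1]; congr 1; ring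
    rw [hexp]
    calc p * ((4 * s p / p : ℝ) ^ (1 + κ) * (p : ℝ) ^ (κ * (1 + κ) * u ^ 2)) ≤
          p * (64 * (p : ℝ) ^ (-β * (1 + κ)) * (p : ℝ) ^ (κ * (1 + κ) * u ^ 2)) := by gcongr
      _ = _ := by
          rw [show 1 - β * (1 + κ) + κ * (1 + κ) * u ^ 2 =
            1 + (-β * (1 + κ) + κ * (1 + κ) * u ^ 2) by ring, Real.rpow_add hp0,
            Real.rpow_add hp0, Real.rpow_one]
          ring

/-- Signals of polynomial size: the order `1 + κ` tends to `1` at the rate of the inverse squared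
signal, which keeps the exponential moment of a single row bounded. -/
lemma minimaxError_strong (ha : 0 < a) (hβ : β ∈ Set.Ioo (0 : ℝ) 1) (h : Calibrated a β n s)
    (hβ₁ : β₁ < β) (hreg : 1 - β₁ < a) (hβ₁1 : β₁ < 1) {ρ : ℕ → ℝ}
    (hρ : ∀ p, ρ p = √((p : ℝ) ^ (a - (1 - β₁)))) :
    ∃ c : ℝ, 0 < c ∧ ∀ᶠ p : ℕ in atTop, c ≤ minimaxError p (n p) (ρ p) (s p) := by
  have hρ2 : ∀ p, ρ p ^ 2 = (p : ℝ) ^ (a - (1 - β₁)) := fun p => by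
    rw [hρ, Real.sq_sqrt (by positivity)]
  refine exists_le_minimaxError ha hβ h (fun p => by rw [hρ]; positivity) (C := ⌈a⌉₊ + 1)
    (Nat.succ_pos _) ?_ (κ := fun p => (p : ℝ) ^ (-(a - (1 - β₁))))
    (D := fun p => 24 * (p : ℝ) ^ (1 - β)) ?_ ?_ ?_
  · filter_upwards [eventually_ge_atTop 1] with p hp
    have hp0 : (0 : ℝ) < p := by exact_mod_cast hp
    rw [hρ2, pow_succ', ← Real.rpow_natCast]
    gcongr
    · exact_mod_cast hp
    · linarith [Nat.le_ceil a]
  · filter_upwards [eventually_ge_atTop 1] with p hp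
    have hp0 : (0 : ℝ) < p := by exact_mod_cast hp
    exact ⟨Real.rpow_pos_of_pos hp0 _,
      Real.rpow_le_one_of_one_le_of_nonpos (by exact_mod_cast hp) (by linarith)⟩
  · filter_upwards [h.eventually_mul_rpow_add_le ha (C := 24 + Real.log 2)
      (show (1 - β) + (a - (1 - β₁)) < a by linarith) (show (0 : ℝ) < 1 / 4 by norm_num),
      eventually_ge_atTop 1] with p hl hp1
    have hp0 : (0 : ℝ) < p := by exact_mod_cast hp1
    have hlog2 : 0 < Real.log 2 := Real.log_pos (by norm_num)
    have hpow : 1 ≤ (p : ℝ) ^ (1 - β) :=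
      Real.one_le_rpow (by exact_mod_cast hp1) (by linarith [hβ.2])
    have hinv : 0 < (p : ℝ) ^ (-(a - (1 - β₁))) := Real.rpow_pos_of_pos hp0 _
    rw [Real.rpow_add hp0] at hl
    have hcancel : (p : ℝ) ^ (-(a - (1 - β₁))) * (p : ℝ) ^ (a - (1 - β₁)) = 1 := by
      rw [← Real.rpow_add hp0, neg_add_cancel, Real.rpow_zero]
    calc 24 * (p : ℝ) ^ (1 - β) + Real.log 2 ≤ (24 + Real.log 2) * (p : ℝ) ^ (1 - β) := by
          nlinarith
      _ = (p : ℝ) ^ (-(a - (1 - β₁))) *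
          ((24 + Real.log 2) * ((p : ℝ) ^ (1 - β) * (p : ℝ) ^ (a - (1 - β₁)))) := by
            linear_combination (-(24 + Real.log 2) * (p : ℝ) ^ (1 - β)) * hcancel
      _ ≤ (p : ℝ) ^ (-(a - (1 - β₁))) * (1 / 4 * Real.log (Real.log (n p))) := by
            exact mul_le_mul_of_nonneg_left (by linarith) hinv.le
      _ = _ := by ring
  · filter_upwards [h.sparsity_bounds, eventually_ge_atTop 1] with p hs hp1 hε0 hε1 t ht1 ht2
    have hp0 : (0 : ℝ) < p := by exact_mod_cast hp1
    set κ := (p : ℝ) ^ (-(a - (1 - β₁))) with hκ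
    have hκ0 : 0 < κ := Real.rpow_pos_of_pos hp0 _
    have hκ1 : κ ≤ 1 :=
      Real.rpow_le_one_of_one_le_of_nonpos (by exact_mod_cast hp1) (by linarith)
    refine (integral_mixLR_rpow_le hκ0 hκ1 hε0 hε1 ht1 ht2).trans (Real.exp_le_exp.2 ?_)
    have hcancel : κ * ρ p ^ 2 = 1 := by
      rw [hρ2, hκ, ← Real.rpow_add hp0, neg_add_cancel, Real.rpow_zero]
    have hexp : Real.exp (κ * (1 + κ) * ρ p ^ 2 / 2) ≤ 3 := by
      calc Real.exp (κ * (1 + κ) * ρ p ^ 2 / 2) ≤ Real.exp 1 := by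
            apply Real.exp_le_exp.2
            rw [show κ * (1 + κ) * ρ p ^ 2 / 2 = κ * ρ p ^ 2 * (1 + κ) / 2 by ring, hcancel]
            linarith
        _ ≤ 3 := by linarith [Real.exp_one_lt_d9]
    have hεpow : (4 * s p / p : ℝ) ^ (1 + κ) ≤ 4 * s p / p := by
      calc (4 * s p / p : ℝ) ^ (1 + κ) ≤ (4 * s p / p : ℝ) ^ (1 : ℝ) :=
            Real.rpow_le_rpow_of_exponent_ge hε0 hε1 (by linarith)
        _ = _ := Real.rpow_one _
    calc p * ((4 * s p / p : ℝ) ^ (1 + κ) * Real.exp (κ * (1 + κ) * ρ p ^ 2 / 2)) ≤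
          p * ((4 * s p / p : ℝ) * 3) := by gcongr
      _ = 12 * s p := by field_simp; ring
      _ ≤ _ := by linarith [hs.2]

/-- Below the detection boundary no sequence of tests is consistent. -/
lemma minimaxError_boundary (ha : 0 < a) (hβ : β ∈ Set.Ioo (0 : ℝ) 1) (h : Calibrated a β n s)
    (hβ₁ : β₁ ∈ Set.Ioo (0 : ℝ) 1) (hlt : β₁ < β) : ∃ c : ℝ, 0 < c ∧
      ∀ᶠ p : ℕ in atTop, c ≤ minimaxError p (n p) (boundary a β₁ p) (s p) := by
  obtain ⟨hβ0, hβ1⟩ := hβ₁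
  by_cases hI : a ≤ 1 - 2 * β₁
  · exact minimaxError_dense ha hβ h hlt hI fun p => by rw [boundary, boundarySq, if_pos hI]
  by_cases hII : a ≤ 1 - 4 * β₁ / 3
  · rw [not_le] at hI
    have hu2 := Real.sq_sqrt (show 0 ≤ (a - (1 - 2 * β₁)) / 2 by linarith)
    refine minimaxError_sparse ha hβ h (u := √((a - (1 - 2 * β₁)) / 2)) (κ := 1)
      (Real.sqrt_nonneg _) one_pos le_rfl ?_ fun p => ?_
    · rw [hu2]; linarith
    · rw [boundary, boundarySq, if_neg (not_le.2 hI), if_pos hII, ← Real.sqrt_mul (by linarith)]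
      congr 1; ring
  by_cases hIII : a ≤ 1 - β₁
  · rw [not_le] at hI hII
    have hA := Real.sq_sqrt (show 0 ≤ 1 - a by linarith)
    have hB := Real.sq_sqrt (show 0 ≤ 1 - a - β₁ by linarith)
    have hlt' : √(1 - a - β₁) < √(1 - a) := Real.sqrt_lt_sqrt (by linarith) (by linarith)
    have hB0 := Real.sqrt_nonneg (1 - a - β₁)
    set A := √(1 - a) with hAdef
    set B := √(1 - a - β₁) with hBdef
    have hu : 0 < A - B := by linarith
    -- the exponent is minimized at `κ₀ = B / (A - B) ∈ [0, 1)`, where it equals `a` for `β = β₁`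
    have hBA : 2 * B < A := by
      by_contra hneg
      nlinarith
    set κ₀ := B / (A - B) with hκ₀
    have hκ₀0 : 0 ≤ κ₀ := by positivity
    have hκ₀1 : κ₀ < 1 := by rw [hκ₀, div_lt_one hu]; linarith
    have hκ₀u : κ₀ * (A - B) = B := by rw [hκ₀]; field_simp
    have hF₀ : 1 - β * (1 + κ₀) + κ₀ * (1 + κ₀) * (A - B) ^ 2 < a := by
      have e1 : κ₀ * (1 + κ₀) * (A - B) ^ 2 = B * A := by
        calc κ₀ * (1 + κ₀) * (A - B) ^ 2 = (κ₀ * (A - B)) * ((A - B) + κ₀ * (A - B)) := by ring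
          _ = B * A := by rw [hκ₀u]; ring
      have e2 : β₁ * (1 + κ₀) = (A + B) * A := by
        have : β₁ = (A + B) * (A - B) := by nlinarith
        calc β₁ * (1 + κ₀) = (A + B) * ((A - B) + κ₀ * (A - B)) := by rw [this]; ring
          _ = (A + B) * A := by rw [hκ₀u]; ring
      rw [e1]
      nlinarith
    have hcont : ∀ᶠ κ in 𝓝[>] κ₀, 1 - β * (1 + κ) + κ * (1 + κ) * (A - B) ^ 2 < a ∧ κ < 1 := by
      refine nhdsWithin_le_nhds ((Tendsto.eventually_lt_const hF₀ ?_).and (gt_mem_nhds hκ₀1))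
      exact Continuous.tendsto
        (f := fun κ : ℝ => 1 - β * (1 + κ) + κ * (1 + κ) * (A - B) ^ 2) (by fun_prop) κ₀
    obtain ⟨κ, ⟨hF, hκ1⟩, hκ⟩ := (hcont.and self_mem_nhdsWithin).exists
    refine minimaxError_sparse ha hβ h (u := A - B) (κ := κ) hu.le (hκ₀0.trans_lt hκ) hκ1.le hF
      fun p => ?_
    rw [boundary, boundarySq, if_neg (not_le.2 hI), if_neg (not_le.2 hII), if_pos hIII,
      mul_comm (2 : ℝ), mul_assoc, Real.sqrt_mul (sq_nonneg _), Real.sqrt_sq hu.le]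
  · refine minimaxError_strong ha hβ h hlt (not_le.1 hIII) hβ1 fun p => ?_
    rw [boundary, boundarySq, if_neg hI, if_neg hII, if_neg hIII]

end LowerBound

/-! ### The minimax error as an infimum over tests -/

lemma worstCaseError_nonneg {p n s : ℕ} {ρ : ℝ} {ψ : Obs p n → ℝ} (hψ : IsTest ψ) :
    0 ≤ worstCaseError ψ ρ s :=
  add_nonneg (Real.iSup_nonneg fun _ => integral_nonneg fun x => (hψ.mem_Icc x).1)
    (Real.iSup_nonneg fun _ => integral_nonneg fun x => sub_nonneg.2 (hψ.mem_Icc x).2)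

lemma minimaxError_nonneg (p n : ℕ) (ρ : ℝ) (s : ℕ) : 0 ≤ minimaxError p n ρ s :=
  Real.iInf_nonneg fun ψ => worstCaseError_nonneg ψ.2

lemma minimaxError_le {p n s : ℕ} {ρ : ℝ} {ψ : Obs p n → ℝ} (hψ : IsTest ψ) :
    minimaxError p n ρ s ≤ worstCaseError ψ ρ s :=
  ciInf_le (f := fun ψ : {ψ : Obs p n → ℝ // IsTest ψ} => worstCaseError ψ.1 ρ s)
    ⟨0, by rintro _ ⟨ψ, rfl⟩; exact worstCaseError_nonneg ψ.2⟩ ⟨ψ, hψ⟩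

end Changepoint

end

theorem theorem2 (a β₁ β : ℝ) (ha : 0 < a) (hβ₁ : β₁ ∈ Set.Ioo (0 : ℝ) 1)
    (hβ : β ∈ Set.Ioo (0 : ℝ) 1) (n s : ℕ → ℕ) (hns : Calibrated a β n s) :
    (β₁ < β →
      ∃ c : ℝ, 0 < c ∧ ∀ᶠ p : ℕ in atTop, c ≤ minimaxError p (n p) (boundary a β₁ p) (s p)) ∧
    (β < β₁ →
      Tendsto (fun p : ℕ => minimaxError p (n p) (boundary a β₁ p) (s p)) atTop (𝓝 0) ∧
      ∀ γ : ℝ, 0 < γ →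
        (∀ p : ℕ, IsTest (pbjTest γ p (n p))) ∧
        Tendsto (fun p : ℕ => worstCaseError (pbjTest γ p (n p)) (boundary a β₁ p) (s p))
          atTop (𝓝 0)) := by
  refine ⟨fun h => minimaxError_boundary ha hβ hns hβ₁ h, fun h => ?_⟩
  have hconv : ∀ γ : ℝ, 0 < γ → Tendsto
      (fun p : ℕ => worstCaseError (pbjTest γ p (n p)) (boundary a β₁ p) (s p)) atTop (𝓝 0) :=
    fun γ hγ => tendsto_worstCaseError_pbjTest ha hns hγ (powerful_boundary ha hns γ hβ₁ h)
  refine ⟨squeeze_zero (fun p => minimaxError_nonneg _ _ _ _)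
    (fun p => minimaxError_le (isTest_pbjTest 1 p (n p))) (hconv 1 one_pos), fun γ hγ =>
      ⟨fun p => isTest_pbjTest γ p (n p), hconv γ hγ⟩⟩
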